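/- **Setting.** Fix $\alpha>0$ and an additive map $\mathbb{N}_0^2\ni\mathbf n\mapsto|\mathbf n|\in\mathbb{R}$ with $|(1,0)|,|(0,1)|>0$. Multi-indices $\gamma$ are finitely supported maps from $\{k\ge 0\}\cup\{\mathbf n\in\mathbb{N}_0^2:\mathbf n\neq\mathbf 0\}$ to $\mathbb{N}_0$; $e_k,e_{\mathbf n}$ are the unit ones and $\mathsf z^\gamma=\prod\mathsf z_k^{\gamma(k)}\mathsf z_{\mathbf n}^{\gamma(\mathbf n)}$. Set $[\gamma]=\sum_k k\gamma(k)-\sum_{\mathbf n\ne\mathbf 0}\gamma(\mathbf n)$ and $|\gamma|=\alpha([\gamma]+1)+\sum_{\mathbf n\neq\mathbf 0}|\mathbf n|\gamma(\mathbf n)$, and let $\mathsf T^*\subset\mathbb{R}[[\mathsf z_k,\mathsf z_{\mathbf n}]]$ be the space of power series supported on $\gamma$ with $[\gamma]\ge0$ or $\gamma=e_{\mathbf n}$, $\mathbf n\ne\mathbf 0$. Consider the endomorphisms of $\mathbb{R}[[\mathsf z_k,\mathsf z_{\mathbf n}]]$ $$D^{(\mathbf 0)}=\sum_{k\ge0}(k+1)\mathsf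 z_{k+1}\partial_{\mathsf z_k},\quad D^{(\mathbf n)}=\partial_{\mathsf z_{\mathbf n}}\ (\mathbf n\neq\mathbf 0),\quad \partial_i=\sum_{\mathbf n\in\mathbb{N}_0^2}(n_i+1)\mathsf z_{\mathbf n+\mathbf e_i}D^{(\mathbf n)}\ (i=1,2),$$ where $\mathbf e_1=(1,0)$, $\mathbf e_2=(0,1)$. For $J$ a multi-index over the pairs $(\gamma,\mathbf n)$ with $[\gamma]\ge0$, $|\gamma|>|\mathbf n|$, and $\mathbf m\in\mathbb{N}_0^2$, let $$D_{(J,\mathbf m)}=\tfrac1{J!\,\mathbf m!}\prod_{(\gamma,\mathbf n)}(\mathsf z^\gamma)^{J(\gamma,\mathbf n)}\,\partial_1^{m_1}\partial_2^{m_2}\prod_{(\gamma,\mathbf n)}(D^{(\mathbf n)})^{J(\gamma,\mathbf n)}$$ (the $D^{(\mathbf n)}$ commute). Let $\mathsf T^+$ be the commutative algebra with basis $Z^{(J,\mathbf m)}$ and product $Z^{(J',\mathbf m')}Z^{(J'',\mathbf m'')}=Z^{(J'+J'',\mathbf m'+\mathbf m'')}$. The elements $f\in{\rm Alg}(\mathsf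 T^+,\mathbb{R})$ (unital multiplicative functionals) are in bijection with pairs of $h\in\mathbb{R}^2$ and $\{\pi^{(\mathbf n)}_\gamma\}_{[\gamma]\ge0,|\gamma|>|\mathbf n|}\subset\mathbb{R}$ via $f^{(J,\mathbf m)}:=f(Z^{(J,\mathbf m)})=h^{\mathbf m}\prod(\pi_\gamma^{(\mathbf n)})^{J(\gamma,\mathbf n)}$. For such $f$ put $$\Gamma_f^*=\sum_{(J,\mathbf m)}f^{(J,\mathbf m)}D_{(J,\mathbf m)}\ \text{ on }\mathsf T^*,\qquad \pi^{(\mathbf n)}=\sum_{[\gamma]\ge0}\pi^{(\mathbf n)}_\gamma\mathsf z^\gamma+\sum_{\mathbf m>\mathbf n}\tbinom{\mathbf m}{\mathbf n}h^{\mathbf m-\mathbf n}\mathsf z_{\mathbf m},$$ where $\pi_\gamma^{(\mathbf n)}=0$ unless $|\gamma|>|\mathbf n|$, and $\mathbf m>\mathbf n$ means $\mathbf m\ge\mathbf n$ componentwise and $\mathbf m\ne\mathbf n$. For $a\in\mathbb{R}[u]$ and $p\in\mathbb{R}[x_1,x_2]$ (more generally $p\in\mathbb{R}[[x_1,x_2]]$)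 let $\mathsf z_k[a,p]$ and $\mathsf z_{\mathbf n}[a,p]$ be the coefficients of $u^k$ in $a$ and of $x^{\mathbf n}$ in $p$. A polynomial in the variables $\mathsf z_k,\mathsf z_{\mathbf n}$ thereby becomes a function of $(a,p)$; a power series $\phi=\sum_\gamma\phi_\gamma\mathsf z^\gamma$ has the value $\phi[a,p]=\sum_\gamma\phi_\gamma\mathsf z^\gamma[a,p]$ whenever this series converges absolutely. **Proposition.** One has $\pi^{(\mathbf n)}\in\mathsf T^*$; for every $\beta$ only finitely many $D_{(J,\mathbf m)}$ contribute to the $\mathsf z^\beta$-coefficient of $\Gamma_f^*\phi$, $\phi\in\mathsf T^*$; and $\Gamma_f^*$ is a linear automorphism of $\mathsf T^*$. Moreover: i) On $\mathsf T^*$, $$\Gamma_f^*=\sum_{k\ge0}\frac1{k!}\sum_{\mathbf n_1,\dots,\mathbf n_k}\pi^{(\mathbf n_1)}\cdots\pi^{(\mathbf n_k)}D^{(\mathbf n_k)}\cdots D^{(\mathbf n_1)},$$ with only finitely many $(k,\mathbf n_1,\dots,\mathbf n_k)$ contributing to each coefficient. In particular $\Gamma_f^*\mathsf z_k=\sum_{l\ge0}\binom{k+l}{k}(\pi^{(\mathbf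 0)})^l\mathsf z_{k+l}$ for $k\ge0$, and $\Gamma_f^*\mathsf z_{\mathbf n}=\mathsf z_{\mathbf n}+\pi^{(\mathbf n)}$ for $\mathbf n\ne\mathbf 0$. ii) If $\pi_1,\dots,\pi_k\in\mathsf T^*$ and $\pi_1\cdots\pi_k\in\mathsf T^*$, then $\Gamma_f^*(\pi_1\cdots\pi_k)=(\Gamma_f^*\pi_1)\cdots(\Gamma_f^*\pi_k)$. iii) For $f,f'\in{\rm Alg}(\mathsf T^+,\mathbb{R})$ with series $\pi^{(\mathbf n)},\pi'^{(\mathbf n)}$ and shifts $h,h'$ there is exactly one $\bar f\in{\rm Alg}(\mathsf T^+,\mathbb{R})$ whose series are $\bar\pi^{(\mathbf n)}=\pi^{(\mathbf n)}+\Gamma_f^*\pi'^{(\mathbf n)}$ for all $\mathbf n$; it has shift $h+h'$ and satisfies $\Gamma_{\bar f}^*=\Gamma_f^*\Gamma_{f'}^*$ on $\mathsf T^*$. iv) Let $\pi\in\mathsf T^*\cap\mathbb{R}[\mathsf z_k,\mathsf z_{\mathbf n}]$. Then $\Gamma_f^*\pi$ arises from $\pi$ by substituting $\Gamma_f^*\mathsf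 z_k$ for $\mathsf z_k$ and $\Gamma_f^*\mathsf z_{\mathbf n}$ for $\mathsf z_{\mathbf n}$. For all $(a,p)\in\mathbb{R}[u]\times\mathbb{R}[x_1,x_2]$ at which the values $\pi^{(\mathbf n)}[a,p]$ exist for all $\mathbf n$, the value $\Gamma_f^*\pi[a,p]$ exists and $$\Gamma_f^*\pi[a,p]=\pi\Big[a\big(\cdot+\pi^{(\mathbf 0)}[a,p]\big),\,p+\sum_{\mathbf n\ne\mathbf 0}\pi^{(\mathbf n)}[a,p]\,x^{\mathbf n}\Big].$$ If for a given $\mathbf n$ only finitely many $\pi^{(\mathbf n)}_\gamma$ are non-zero, $\pi^{(\mathbf n)}[a,p]$ exists for all $(a,p)$. v) $\mathsf G^*=\{\Gamma_f^*\}_f$ is a group under composition. The set of those $\Gamma_f^*$ with $\pi_\gamma^{(\mathbf n)}=0$ for all $(\gamma,\mathbf n)$ is a subgroup of $\mathsf G^*$, isomorphic to $(\mathbb{R}^2,+)$ through $h\leftrightarrow\Gamma_f^*$. For these $f$, all $\pi\in\mathsf T^*\cap\mathbb{R}[\mathsf z_k,\mathsf z_{\mathbf n}]$, all $a\in\mathbb{R}[u]$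 and all $p\in\mathbb{R}[x_1,x_2]$ with $p(0)=0$, the value $\Gamma_f^*\pi[a,p]$ exists and $$\Gamma_f^*\pi[a,p]=\pi\big[a(\cdot+p(h)),\,p(\cdot+h)-p(h)\big].$$ vi) The set of those $\Gamma_f^*$ with $h=(0,0)$ is a subgroup of $\mathsf G^*$. -/

import Mathlib

open Finsupp

noncomputable section

namespace ShiftTilt

/-- Exponents `n = (n₁, n₂)` of space-time monomials `x^n`. The order is componentwise. -/
abbrev N2 : Type := Fin 2 →₀ ℕ

/-- The index set `{k ≥ 0} ∪ {n ≠ 0}` of the coordinates `z_k`, `z_n`. -/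
abbrev Idx : Type := ℕ ⊕ {n : N2 // n ≠ 0}

/-- Multi-indices `γ` over `{k ≥ 0} ∪ {n ≠ 0}`. -/
abbrev MIdx : Type := Idx →₀ ℕ

/-- The algebra of formal power series `ℝ[[z_k, z_n]]`. -/
abbrev PS : Type := MvPowerSeries Idx ℝ

/-- The variable `z_k`. -/
abbrev zk (k : ℕ) : PS := MvPowerSeries.X (Sum.inl k)

/-- The variable `z_n`, `n ≠ 0`. -/
abbrev zn (n : {n : N2 // n ≠ 0}) : PS := MvPowerSeries.X (Sum.inr n)

/-- The monomial `z^γ`. -/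
abbrev zpow (γ : MIdx) : PS := MvPowerSeries.monomial γ (1 : ℝ)

/-- `[γ] = ∑_k k γ(k) - ∑_{n ≠ 0} γ(n)`. -/
def bracket (γ : MIdx) : ℤ :=
  γ.sum fun i c => match i with
    | Sum.inl k => (k : ℤ) * c
    | Sum.inr _ => -(c : ℤ)

/-- The homogeneity `|γ| = α ([γ] + 1) + ∑_{n ≠ 0} |n| γ(n)`, where `|n| = len n`. -/
def homog (α : ℝ) (len : N2 →+ ℝ) (γ : MIdx) : ℝ :=
  α * ((bracket γ : ℝ) + 1) + γ.sum fun i c => match i with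
    | Sum.inl _ => 0
    | Sum.inr n => len n.1 * c

/-- The space `T^*`: power series supported on `[γ] ≥ 0` or `γ = e_n`, `n ≠ 0`. -/
def Tstar : Submodule ℝ PS where
  carrier := {φ | ∀ γ : MIdx, MvPowerSeries.coeff γ φ ≠ 0 →
    0 ≤ bracket γ ∨ ∃ n : {n : N2 // n ≠ 0}, γ = single (Sum.inr n) 1}
  zero_mem' := fun γ h => absurd (map_zero _) h
  add_mem' := by
    intro φ ψ hφ hψ γ h
    by_cases h1 : MvPowerSeries.coeff γ φ = 0
    · refine hψ γ fun h2 => h ?_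
      rw [map_add, h1, h2, add_zero]
    · exact hφ γ h1
  smul_mem' := by
    intro c φ hφ γ h
    refine hφ γ fun h1 => h ?_
    rw [map_smul, h1, smul_zero]

theorem finite_coeff_X_mul {ι : Type*} {g : ι → Idx} (hg : Function.Injective g) (ψ : ι → PS)
    (β : MIdx) :
    (Function.support fun x => MvPowerSeries.coeff β (MvPowerSeries.X (g x) * ψ x)).Finite := by
  classical
  refine Set.Finite.subset (β.support.finite_toSet.preimage (f := g) hg.injOn) ?_
  intro x hx
  simp only [Set.mem_preimage, Finset.mem_coe, Finsupp.mem_support_iff]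
  intro h0
  apply hx
  show MvPowerSeries.coeff β (MvPowerSeries.X (g x) * ψ x) = 0
  rw [MvPowerSeries.X_def, MvPowerSeries.coeff_monomial_mul, if_neg]
  intro hle
  have := hle (g x)
  simp [h0] at this

/-- The endomorphism `∑_x z_{g x} T_x` of `ℝ[[z_k, z_n]]`, for pairwise distinct variables
`z_{g x}`. For every coefficient the sum is finite. -/
def varSum {ι : Type*} (g : ι → Idx) (hg : Function.Injective g) (T : ι → Module.End ℝ PS) :
    Module.End ℝ PS where
  toFun φ := fun β => ∑ᶠ x, MvPowerSeries.coeff β (MvPowerSeries.X (g x) * T x φ)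
  map_add' φ ψ := by
    funext β
    change (∑ᶠ x, MvPowerSeries.coeff β (MvPowerSeries.X (g x) * T x (φ + ψ)) : ℝ) =
      (∑ᶠ x, MvPowerSeries.coeff β (MvPowerSeries.X (g x) * T x φ)) +
        ∑ᶠ x, MvPowerSeries.coeff β (MvPowerSeries.X (g x) * T x ψ)
    rw [← finsum_add_distrib (finite_coeff_X_mul hg _ β) (finite_coeff_X_mul hg _ β)]
    simp only [map_add, mul_add]
  map_smul' c φ := by
    funext β
    change (∑ᶠ x, MvPowerSeries.coeff β (MvPowerSeries.X (g x) * T x (c • φ)) : ℝ) =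
      c * ∑ᶠ x, MvPowerSeries.coeff β (MvPowerSeries.X (g x) * T x φ)
    rw [mul_finsum]
    simp only [map_smul, mul_smul_comm, smul_eq_mul]

theorem coeff_varSum {ι : Type*} (g : ι → Idx) (hg : Function.Injective g)
    (T : ι → Module.End ℝ PS) (φ : PS) (β : MIdx) :
    MvPowerSeries.coeff β (varSum g hg T φ) =
      ∑ᶠ x, MvPowerSeries.coeff β (MvPowerSeries.X (g x) * T x φ) := rfl

/-- The partial derivative with respect to a variable, as an endomorphism. -/
def pd (i : Idx) : Module.End ℝ PS := (MvPowerSeries.pderiv ℝ i).toLinearMap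

theorem inl_succ_injective : Function.Injective fun k : ℕ => (Sum.inl (k + 1) : Idx) :=
  fun _ _ h => by simpa using h

/-- The generators of constant tilt: `D^(0) = ∑_k (k+1) z_{k+1} ∂_{z_k}` and
`D^(n) = ∂_{z_n}` for `n ≠ 0`. -/
def tiltGen (n : N2) : Module.End ℝ PS :=
  open Classical in
  if h : n = 0 then
    varSum (fun k : ℕ => Sum.inl (k + 1)) inl_succ_injective
      (fun k => ((k : ℝ) + 1) • pd (Sum.inl k))
  else pd (Sum.inr ⟨n, h⟩)

theorem add_single_ne_zero (n : N2) (i : Fin 2) : n + single i 1 ≠ 0 := by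
  intro h
  have := DFunLike.congr_fun h i
  simp at this

theorem inr_add_injective (i : Fin 2) : Function.Injective fun n : N2 =>
    (Sum.inr ⟨n + single i 1, add_single_ne_zero n i⟩ : Idx) :=
  fun _ _ h => by simpa using h

/-- The generators of shift: `∂_i = ∑_n (n_i + 1) z_{n + e_i} D^(n)`, the sum being over all `n`
including `n = 0`. -/
def shiftGen (i : Fin 2) : Module.End ℝ PS :=
  varSum (fun n : N2 => Sum.inr ⟨n + single i 1, add_single_ne_zero n i⟩)
    (inr_add_injective i)
    (fun n => ((n i : ℝ) + 1) • tiltGen n)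

theorem pd_comm (i j : Idx) : Commute (pd i) (pd j) := by
  classical
  refine LinearMap.ext fun φ => MvPowerSeries.ext fun β => ?_
  show MvPowerSeries.coeff β (MvPowerSeries.pderiv ℝ i (MvPowerSeries.pderiv ℝ j φ)) =
    MvPowerSeries.coeff β (MvPowerSeries.pderiv ℝ j (MvPowerSeries.pderiv ℝ i φ))
  simp only [MvPowerSeries.coeff_pderiv]
  rcases eq_or_ne i j with rfl | hij
  · rfl
  · rw [add_right_comm]
    simp [hij, hij.symm]
    ring

theorem pd_inr_comm_varSum (n : {n : N2 // n ≠ 0})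
    (hg : Function.Injective fun k : ℕ => (Sum.inl (k + 1) : Idx)) :
    Commute (pd (Sum.inr n)) (varSum (fun k : ℕ => Sum.inl (k + 1)) hg
      (fun k => ((k : ℝ) + 1) • pd (Sum.inl k))) := by
  refine LinearMap.ext fun φ => MvPowerSeries.ext fun β => ?_
  change MvPowerSeries.coeff β (MvPowerSeries.pderiv ℝ (Sum.inr n : Idx)
      (varSum (fun k : ℕ => Sum.inl (k + 1)) hg (fun k => ((k : ℝ) + 1) • pd (Sum.inl k)) φ)) =
    MvPowerSeries.coeff β (varSum (fun k : ℕ => Sum.inl (k + 1)) hg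
      (fun k => ((k : ℝ) + 1) • pd (Sum.inl k)) (pd (Sum.inr n) φ))
  rw [MvPowerSeries.coeff_pderiv, coeff_varSum, coeff_varSum, finsum_mul]
  refine finsum_congr fun k => ?_
  rw [← MvPowerSeries.coeff_pderiv]
  have h1 : pd (Sum.inl k) (pd (Sum.inr n) φ) = pd (Sum.inr n) (pd (Sum.inl k) φ) :=
    DFunLike.congr_fun (pd_comm (Sum.inl k) (Sum.inr n)) φ
  rw [LinearMap.smul_apply, LinearMap.smul_apply, h1, Derivation.leibniz]
  congr 1
  have h2 : MvPowerSeries.pderiv ℝ (Sum.inr n : Idx)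
      (MvPowerSeries.X (Sum.inl (k + 1)) : PS) = 0 := by
    classical
    ext γ
    rw [MvPowerSeries.coeff_pderiv, MvPowerSeries.coeff_X, if_neg, zero_mul, map_zero]
    intro h
    have := DFunLike.congr_fun h (Sum.inr n)
    simp at this
  rw [h2, smul_zero, add_zero, Derivation.map_smul]
  rfl

/-- The generators `D^(n)` commute, so that their products need no order. -/
theorem tiltGen_comm (n m : N2) : Commute (tiltGen n) (tiltGen m) := by
  by_cases hn : n = 0 <;> by_cases hm : m = 0
  · subst hn; subst hm; exact Commute.refl _
  · simp only [tiltGen, dif_pos hn, dif_neg hm]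
    exact (pd_inr_comm_varSum _ _).symm
  · simp only [tiltGen, dif_neg hn, dif_pos hm]
    exact pd_inr_comm_varSum _ _
  · simp only [tiltGen, dif_neg hn, dif_neg hm]
    exact pd_comm _ _

/-- The index set of the generators `z^γ D^(n)` of variable tilt: pairs `(γ, n)` with
`[γ] ≥ 0` and `|γ| > |n|`. -/
abbrev TiltIdx (α : ℝ) (len : N2 →+ ℝ) : Type :=
  {x : MIdx × N2 // 0 ≤ bracket x.1 ∧ len x.2 < homog α len x.1}

/-- The indices `(J, m)`: a multi-index `J` over the pairs `(γ, n)`, and `m ∈ ℕ₀²`. -/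
abbrev JIdx (α : ℝ) (len : N2 →+ ℝ) : Type := (TiltIdx α len →₀ ℕ) × N2

/-- The endomorphism
`D_(J,m) = 1/(J! m!) ∏ (z^γ)^J(γ,n) ∂_1^{m_1} ∂_2^{m_2} ∏ (D^(n))^J(γ,n)`. -/
def dBasis {α : ℝ} {len : N2 →+ ℝ} (x : JIdx α len) : Module.End ℝ PS :=
  (((x.1.prod fun _ c => (c.factorial : ℝ)) * ∏ i, ((x.2 i).factorial : ℝ))⁻¹) •
    (LinearMap.mulLeft ℝ (x.1.prod fun y c => zpow y.1.1 ^ c) *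
      (shiftGen 0 ^ x.2 0 * shiftGen 1 ^ x.2 1) *
      x.1.support.noncommProd (fun y => tiltGen y.1.2 ^ x.1 y)
        (fun _ _ _ _ _ => (tiltGen_comm _ _).pow_pow _ _))

/-- The commutative algebra `T^+` with linear basis `Z^(J,m)` and
`Z^(J',m') Z^(J'',m'') = Z^(J'+J'',m'+m'')`. -/
abbrev Tplus (α : ℝ) (len : N2 →+ ℝ) : Type := AddMonoidAlgebra ℝ (JIdx α len)

/-- The basis element `Z^(J,m)` of `T^+`. -/
def Z {α : ℝ} {len : N2 →+ ℝ} (x : JIdx α len) : Tplus α len := AddMonoidAlgebra.single x 1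

/-- `Alg(T^+, ℝ)`, the multiplicative linear functionals on `T^+`. -/
abbrev Character (α : ℝ) (len : N2 →+ ℝ) : Type := Tplus α len →ₐ[ℝ] ℝ

/-- The shift parameter `h ∈ ℝ²` of `f`. -/
def shift {α : ℝ} {len : N2 →+ ℝ} (f : Character α len) : Fin 2 → ℝ :=
  fun i => f (Z (0, single i 1))

/-- The tilt coefficients `π_γ^(n)` of `f`, for `[γ] ≥ 0` and `|γ| > |n|`. -/
def tilt {α : ℝ} {len : N2 →+ ℝ} (f : Character α len) : TiltIdx α len → ℝ :=
  fun y => f (Z (single y 1, 0))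

/-- The monomial `h^m`. -/
def hpow (h : Fin 2 → ℝ) (m : N2) : ℝ := ∏ i, h i ^ m i

/-- The binomial coefficient `binom(m, n)` for `m, n ∈ ℕ₀²`. -/
def binom (m n : N2) : ℕ := ∏ i, (m i).choose (n i)

open Classical in
/-- The power series
`π^(n) = ∑_{[γ] ≥ 0} π_γ^(n) z^γ + ∑_{m ≠ 0, m > n} binom(m, n) h^{m-n} z_m`,
where `π_γ^(n) = 0` unless `|γ| > |n|`. -/
def tiltSeries {α : ℝ} {len : N2 →+ ℝ} (f : Character α len) (n : N2) : PS := fun γ =>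
  (if hγ : 0 ≤ bracket γ ∧ len n < homog α len γ then tilt f ⟨(γ, n), hγ⟩ else 0) +
    ∑ᶠ m : {m : N2 // m ≠ 0},
      if γ = single (Sum.inr m) 1 ∧ n < m.1 then (binom m.1 n : ℝ) * hpow (shift f) (m.1 - n) else 0

/-- `Γ_f^* φ = ∑_{(J,m)} f^(J,m) D_(J,m) φ`, coefficient by coefficient, where
`f^(J,m) = f(Z^(J,m))`. It is used for `φ ∈ T^*` only. -/
def gammaStar {α : ℝ} {len : N2 →+ ℝ} (f : Character α len) (φ : PS) : PS := fun β =>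
  ∑ᶠ x : JIdx α len, f (Z x) * MvPowerSeries.coeff β (dBasis x φ)

/-- The term `(1/k!) π^(n_1) ⋯ π^(n_k) D^(n_k) ⋯ D^(n_1) φ` of the exponential formula. -/
def expTerm {α : ℝ} {len : N2 →+ ℝ} (f : Character α len) (φ : PS) (k : ℕ) (n : Fin k → N2) : PS :=
  ((k.factorial : ℝ)⁻¹) •
    ((∏ i, tiltSeries f (n i)) * (List.ofFn fun i => tiltGen (n i)).reverse.prod φ)

/-- An automorphism `E` of `T^*` coincides with `Γ_f^*`. -/
def IsGammaStar {α : ℝ} {len : N2 →+ ℝ} (f : Character α len) (E : Tstar ≃ₗ[ℝ] Tstar) : Prop :=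
  ∀ φ : Tstar, ((E φ : Tstar) : PS) = gammaStar f φ

/-- The coordinates `z_k[a,p]`, `z_n[a,p]`: the coefficients of `a` and `p`. Here `p` may be a
formal power series in `x`, of which polynomials are special cases; its constant term plays
no role. -/
def coord (a : Polynomial ℝ) (p : MvPowerSeries (Fin 2) ℝ) : Idx → ℝ
  | Sum.inl k => a.coeff k
  | Sum.inr n => MvPowerSeries.coeff n.1 p

/-- The formal series `∑_{n ≠ 0} c_n x^n`. -/
def tiltBy (c : N2 → ℝ) : MvPowerSeries (Fin 2) ℝ := fun n => if n = 0 then 0 else c n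

/-- The value `P[a,p]` of a polynomial functional. -/
def polyValue (P : MvPolynomial Idx ℝ) (a : Polynomial ℝ) (p : MvPowerSeries (Fin 2) ℝ) : ℝ :=
  MvPolynomial.eval (coord a p) P

/-- `φ[a,p] = v` for a power series `φ`: the series `∑_γ φ_γ z^γ[a,p]` converges absolutely,
with sum `v`. -/
def HasValue (φ : PS) (a : Polynomial ℝ) (p : MvPowerSeries (Fin 2) ℝ) (v : ℝ) : Prop :=
  HasSum (fun γ : MIdx => MvPowerSeries.coeff γ φ * γ.prod fun i c => coord a p i ^ c) v

end ShiftTilt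

end

open ShiftTilt

open Finset.HasAntidiagonal (antidiagonal mem_antidiagonal)

noncomputable section

namespace ShiftTilt

section

/-! The proof rests on the fact that exponentials of derivations are multiplicative, hence
determined by their values on the variables. For fixed J, the terms of Γ_f^* summed over m give a
multiple of z^{tiltExp J} exp(h·∂) ∏ D^(n), and exp(h·∂) (`shiftExp`) is an algebra morphism.
Grouped by |J| = k they form a sequence T_k with T_0 = exp(h·∂) and (k+1) T_{k+1} φ = ∑ π_γ^(n) z^γ
T_k(D^(n) φ). The right-hand side of the exponential formula obeys the same recursion, with T_0 = 1
and with coefficients π^(n). For every such sequence (`IsExpFamily`) the Leibniz rule for D^(n)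
yields T_k(φψ) = ∑_{i+j=k} T_i φ T_j ψ (`leibniz_of_recursion`), so ∑ T_k is multiplicative.

Since `Tstar` is not closed under products, the argument takes place in the algebra `bddSeries` of
series whose bracket is bounded below. There all sums are locally finite: each z^γ D^(n) raises the
bracket by at least one and the shifts preserve it, so |J| is bounded; the grading by length bounds
m. An `IsTameHom` on this algebra is determined by its values on the variables (`IsTameHom.ext`).

These values are z_n + π^(n) on z_n, and on z_k the k-th coefficient of a(· + π^(0)), written
`translate k (tiltSeries f 0)`. The delicate input is `shiftExp_zk`: with generic p(x) = ∑ z_n x^n,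
the derivation ∂_i acts on the coefficients in x of a(· + p(x)) as the partial derivative in x_i, so
that exp(h·∂) evaluates at x = h. The exponential formula (`gammaStar_eq_expSum`) and the
composition rule (`gammaStar_comp`) then follow by comparison on variables, with the semigroup law
`hasSum_translate_add` handling z_k.

Invertibility comes from homogeneity: every term other than the identity raises it strictly because
|γ| > |n|, and on `Tstar` it takes values in a set with finitely many elements below any bound. Thus
Γ_f^* is unitriangular. Inverse characters are found by solving a triangular equation inside the
support allowed for tilt coefficients (`exists_inverse`). Evaluation at (a,p) is compatible with
products by Cauchy's theorem on absolutely convergent series, so substitution of the values on the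
variables gives the action on polynomial functionals. -/

/-! ### The product topology over discrete coefficients -/

/-- The topology of coefficientwise stabilization on `ℝ[[z_k, z_n]]`. -/
instance psTopology : TopologicalSpace PS :=
  @MvPowerSeries.WithPiTopology.instTopologicalSpace Idx ℝ ⊥

instance : IsTopologicalRing PS :=
  letI : TopologicalSpace ℝ := ⊥
  haveI : DiscreteTopology ℝ := ⟨rfl⟩
  MvPowerSeries.WithPiTopology.instIsTopologicalRing Idx ℝ

instance : T2Space PS :=
  letI : TopologicalSpace ℝ := ⊥
  haveI : DiscreteTopology ℝ := ⟨rfl⟩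
  MvPowerSeries.WithPiTopology.instT2Space

instance : ContinuousConstSMul ℝ PS where
  continuous_const_smul c := by
    simp only [MvPowerSeries.smul_eq_C_mul]
    exact continuous_const_mul _

/-- Regularity is what permits regrouping of double sums (`HasSum.sigma`, `HasSum.prod_fiberwise`)
and Cauchy products. -/
instance : T3Space PS where

theorem continuous_iff_coeff {X : Type*} [TopologicalSpace X] {F : X → PS} :
    Continuous F ↔ ∀ β, IsLocallyConstant fun x => MvPowerSeries.coeff β (F x) := by
  let : TopologicalSpace ℝ := ⊥
  have : DiscreteTopology ℝ := ⟨rfl⟩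
  simp only [IsLocallyConstant.iff_continuous]
  exact continuous_pi_iff

theorem isLocallyConstant_coeff (β : MIdx) :
    IsLocallyConstant fun φ : PS => MvPowerSeries.coeff β φ :=
  continuous_iff_coeff.1 continuous_id β

/-- A convergent sum in a discrete group has only finitely many nonzero terms. This links the
`finsum` definitions of the operators with the calculus of `HasSum`. -/
theorem hasSum_iff {ι : Type*} {F : ι → PS} {S : PS} :
    HasSum F S ↔ ∀ β, (Function.support fun i => MvPowerSeries.coeff β (F i)).Finite ∧
      ∑ᶠ i, MvPowerSeries.coeff β (F i) = MvPowerSeries.coeff β S := by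
  let : TopologicalSpace ℝ := ⊥
  have : DiscreteTopology ℝ := ⟨rfl⟩
  rw [show HasSum F S ↔ ∀ β, HasSum (fun i => MvPowerSeries.coeff β (F i))
    (MvPowerSeries.coeff β S) from Pi.hasSum]
  refine forall_congr' fun β => ⟨fun h => ?_, fun ⟨h1, h2⟩ => ?_⟩
  · have hf : (Function.support fun i => MvPowerSeries.coeff β (F i)).Finite :=
      h.summable.hasFiniteSupport_of_discreteTopology
    exact ⟨hf, by rw [← tsum_eq_finsum (L := .unconditional _) hf]; exact h.tsum_eq⟩
  · rw [← h2, finsum_eq_sum _ h1]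
    exact hasSum_sum_of_ne_finset_zero fun i hi => by simpa using hi

theorem _root_.HasSum.of_eq {ι : Type*} {F G : ι → PS} {S : PS} (h : HasSum F S)
    (hFG : ∀ i, G i = F i) : HasSum G S :=
  (funext hFG : G = F) ▸ h

theorem _root_.HasSum.finite_coeff {ι : Type*} {F : ι → PS} {S : PS} (h : HasSum F S) (β : MIdx) :
    (Function.support fun i => MvPowerSeries.coeff β (F i)).Finite :=
  (hasSum_iff.1 h β).1

theorem _root_.HasSum.finsum_coeff {ι : Type*} {F : ι → PS} {S : PS} (h : HasSum F S) (β : MIdx) :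
    ∑ᶠ i, MvPowerSeries.coeff β (F i) = MvPowerSeries.coeff β S :=
  (hasSum_iff.1 h β).2

theorem _root_.HasSum.exists_coeff_ne_zero {ι : Type*} {F : ι → PS} {S : PS} (h : HasSum F S) {β : MIdx}
    (hβ : MvPowerSeries.coeff β S ≠ 0) : ∃ i, MvPowerSeries.coeff β (F i) ≠ 0 := by
  by_contra! hc
  apply hβ
  rw [← h.finsum_coeff β]
  simp [hc]

theorem summable_iff_coeff {ι : Type*} {F : ι → PS} :
    Summable F ↔ ∀ β, (Function.support fun i => MvPowerSeries.coeff β (F i)).Finite :=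
  ⟨fun ⟨_, h⟩ => h.finite_coeff,
    fun h => ⟨fun β => ∑ᶠ i, MvPowerSeries.coeff β (F i), hasSum_iff.2 fun β => ⟨h β, rfl⟩⟩⟩

theorem exists_le_of_coeff_mul_ne_zero {φ ψ : PS} {β : MIdx}
    (h : MvPowerSeries.coeff β (φ * ψ) ≠ 0) :
    ∃ γ δ, γ + δ = β ∧ MvPowerSeries.coeff γ φ ≠ 0 ∧ MvPowerSeries.coeff δ ψ ≠ 0 := by
  classical
  rw [MvPowerSeries.coeff_mul] at h
  obtain ⟨p, hp, h⟩ := Finset.exists_ne_zero_of_sum_ne_zero h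
  exact ⟨p.1, p.2, mem_antidiagonal.1 hp, left_ne_zero_of_mul h, right_ne_zero_of_mul h⟩

theorem exists_le_of_coeff_prod_ne_zero {ι : Type*} {s : Finset ι} {φ : ι → PS} {β : MIdx}
    (h : MvPowerSeries.coeff β (∏ i ∈ s, φ i) ≠ 0) {i : ι} (hi : i ∈ s) :
    ∃ γ ≤ β, MvPowerSeries.coeff γ (φ i) ≠ 0 := by
  classical
  rw [← Finset.mul_prod_erase s φ hi] at h
  obtain ⟨γ, δ, rfl, h1, -⟩ := exists_le_of_coeff_mul_ne_zero h
  exact ⟨γ, self_le_add_right γ δ, h1⟩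

/-- The `β`-coefficient of a product involves only the finitely many multi-indices below `β`. -/
theorem summable_mul_prod {ι κ : Type*} {F : ι → PS} {G : κ → PS} (hF : Summable F)
    (hG : Summable G) : Summable fun p : ι × κ => F p.1 * G p.2 := by
  rw [summable_iff_coeff] at hF hG ⊢
  intro β
  refine (((Set.finite_Iic β).biUnion fun γ _ => hF γ).prod
    ((Set.finite_Iic β).biUnion fun γ _ => hG γ)).subset fun i hi => ?_
  obtain ⟨γ, δ, rfl, h1, h2⟩ := exists_le_of_coeff_mul_ne_zero hi
  exact ⟨Set.mem_biUnion (Set.mem_Iic.2 (self_le_add_right γ δ)) h1,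
    Set.mem_biUnion (Set.mem_Iic.2 (self_le_add_left δ γ)) h2⟩

theorem _root_.HasSum.mul_antidiagonal {A : Type*} [AddCommMonoid A] [Finset.HasAntidiagonal A]
    {F G : A → PS} {S T : PS} (hF : HasSum F S) (hG : HasSum G T) :
    HasSum (fun n => ∑ p ∈ antidiagonal n, F p.1 * G p.2) (S * T) := by
  have hs := summable_mul_prod hF.summable hG.summable
  rw [← hF.tsum_eq, ← hG.tsum_eq,
    hF.summable.tsum_mul_tsum_eq_tsum_sum_antidiagonal hG.summable hs]
  exact (summable_sum_mul_antidiagonal_of_summable_mul hs).hasSum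

theorem hasSum_monomials (φ : PS) :
    HasSum (fun γ : MIdx => MvPowerSeries.coeff γ φ • zpow γ) φ := by
  classical
  rw [hasSum_iff]
  intro β
  have h : ∀ γ, γ ≠ β → MvPowerSeries.coeff β (MvPowerSeries.coeff γ φ • zpow γ) = 0 := by
    intro γ hγ
    rw [map_smul, MvPowerSeries.coeff_monomial_ne hγ.symm, smul_zero]
  refine ⟨(Set.finite_singleton β).subset fun γ hγ => ?_, ?_⟩
  · by_contra hc
    exact hγ (h γ hc)
  · rw [finsum_eq_single _ β h]
    simp

/-! ### Continuity of the generators -/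

theorem continuous_pd (i : Idx) : Continuous (pd i) := by
  rw [continuous_iff_coeff]
  intro β
  change IsLocallyConstant fun φ => MvPowerSeries.coeff β (MvPowerSeries.pderiv ℝ i φ)
  simp only [MvPowerSeries.coeff_pderiv]
  exact (isLocallyConstant_coeff (β + single i 1)).comp fun c => c * (β i + 1 : ℝ)

theorem hasSum_varSum {ι : Type*} (g : ι → Idx) (hg : Function.Injective g)
    (T : ι → Module.End ℝ PS) (φ : PS) :
    HasSum (fun x => MvPowerSeries.X (g x) * T x φ) (varSum g hg T φ) :=
  hasSum_iff.2 fun β => ⟨finite_coeff_X_mul hg _ β, (coeff_varSum g hg T φ β).symm⟩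

/-- For fixed `β` only the variables that divide `z^β` contribute, so each coefficient comes from a
finite sum of continuous operators. -/
theorem continuous_varSum {ι : Type*} (g : ι → Idx) (hg : Function.Injective g)
    (T : ι → Module.End ℝ PS) (hT : ∀ x, Continuous (T x)) : Continuous (varSum g hg T) := by
  classical
  rw [continuous_iff_coeff]
  intro β
  have hfin := β.support.finite_toSet.preimage (f := g) hg.injOn
  have h : ∀ φ, MvPowerSeries.coeff β (varSum g hg T φ) =
      MvPowerSeries.coeff β (∑ x ∈ hfin.toFinset, MvPowerSeries.X (g x) * T x φ) := by
    intro φ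
    rw [coeff_varSum, map_sum]
    refine finsum_eq_sum_of_support_subset _ fun x hx => ?_
    simp only [Set.Finite.coe_toFinset, Set.mem_preimage, Finset.mem_coe, Finsupp.mem_support_iff]
    intro h0
    apply hx
    show MvPowerSeries.coeff β (MvPowerSeries.X (g x) * T x φ) = 0
    rw [MvPowerSeries.X_def, MvPowerSeries.coeff_monomial_mul, if_neg]
    intro hle
    have := hle (g x)
    simp [h0] at this
  simp only [h]
  refine continuous_iff_coeff.1 ?_ β
  exact continuous_finsetSum _ fun x _ => (hT x).const_mul _

theorem tiltGen_zero : tiltGen 0 = varSum (fun k : ℕ => Sum.inl (k + 1)) inl_succ_injective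
    (fun k => ((k : ℝ) + 1) • pd (Sum.inl k)) := by
  simp [tiltGen]

theorem tiltGen_ne_zero (n : {n : N2 // n ≠ 0}) : tiltGen n.1 = pd (Sum.inr n) := by
  simp [tiltGen, n.2]

theorem continuous_tiltGen (n : N2) : Continuous (tiltGen n) := by
  rcases eq_or_ne n 0 with rfl | hn
  · rw [tiltGen_zero]
    exact continuous_varSum _ _ _ fun k => (continuous_pd _).const_smul _
  · rw [tiltGen_ne_zero ⟨n, hn⟩]
    exact continuous_pd _

theorem continuous_shiftGen (i : Fin 2) : Continuous (shiftGen i) :=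
  continuous_varSum _ _ _ fun n => (continuous_tiltGen n).const_smul _

/-! ### The generators are derivations -/

/-- The Leibniz rule. -/
def IsLeibniz (T : Module.End ℝ PS) : Prop := ∀ φ ψ, T (φ * ψ) = T φ * ψ + φ * T ψ

theorem isLeibniz_pd (i : Idx) : IsLeibniz (pd i) := by
  intro φ ψ
  change MvPowerSeries.pderiv ℝ i (φ * ψ) = MvPowerSeries.pderiv ℝ i φ * ψ +
    φ * MvPowerSeries.pderiv ℝ i ψ
  rw [Derivation.leibniz, smul_eq_mul, smul_eq_mul]
  ring

theorem IsLeibniz.smul {T : Module.End ℝ PS} (hT : IsLeibniz T) (c : ℝ) : IsLeibniz (c • T) := by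
  intro φ ψ
  simp only [LinearMap.smul_apply, hT φ ψ, smul_add, smul_mul_assoc, mul_smul_comm]

theorem isLeibniz_varSum {ι : Type*} (g : ι → Idx) (hg : Function.Injective g)
    (T : ι → Module.End ℝ PS) (hT : ∀ x, IsLeibniz (T x)) : IsLeibniz (varSum g hg T) := by
  intro φ ψ
  refine (hasSum_varSum g hg T (φ * ψ)).unique ?_
  refine (((hasSum_varSum g hg T φ).mul_right ψ).add
    ((hasSum_varSum g hg T ψ).mul_left φ)).of_eq fun x => ?_
  rw [hT x]
  ring

theorem isLeibniz_tiltGen (n : N2) : IsLeibniz (tiltGen n) := by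
  rcases eq_or_ne n 0 with rfl | hn
  · rw [tiltGen_zero]
    exact isLeibniz_varSum _ _ _ fun k => (isLeibniz_pd _).smul _
  · rw [tiltGen_ne_zero ⟨n, hn⟩]
    exact isLeibniz_pd _

theorem isLeibniz_shiftGen (i : Fin 2) : IsLeibniz (shiftGen i) :=
  isLeibniz_varSum _ _ _ fun n => (isLeibniz_tiltGen n).smul _

theorem IsLeibniz.map_one {T : Module.End ℝ PS} (hT : IsLeibniz T) : T 1 = 0 := by
  have := hT 1 1
  simpa using this

/-! ### Values of the generators on the variables -/

theorem pd_X_self (i : Idx) : pd i (MvPowerSeries.X i) = 1 := MvPowerSeries.pderiv_X_self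

theorem pd_X_of_ne {i j : Idx} (h : j ≠ i) : pd i (MvPowerSeries.X j) = 0 :=
  MvPowerSeries.pderiv_X_of_ne h

theorem varSum_X_eq {ι : Type*} (g : ι → Idx) (hg : Function.Injective g)
    (T : ι → Module.End ℝ PS) (φ : PS) (x : ι) (h : ∀ y, y ≠ x → T y φ = 0) :
    varSum g hg T φ = MvPowerSeries.X (g x) * T x φ :=
  (hasSum_varSum g hg T φ).unique (hasSum_single x fun y hy => by rw [h y hy, mul_zero])

theorem tiltGen_zero_zk (k : ℕ) : tiltGen 0 (zk k) = ((k : ℝ) + 1) • zk (k + 1) := by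
  rw [tiltGen_zero, varSum_X_eq _ _ _ _ k]
  · rw [LinearMap.smul_apply, pd_X_self, mul_smul_comm, mul_one]
  · intro l hl
    rw [LinearMap.smul_apply, pd_X_of_ne (by simpa using hl.symm), smul_zero]

theorem tiltGen_zero_zn (n : {n : N2 // n ≠ 0}) : tiltGen 0 (zn n) = 0 := by
  -- The index `0` is arbitrary: every summand kills `z_n`.
  rw [tiltGen_zero, varSum_X_eq _ _ _ _ 0]
  · rw [LinearMap.smul_apply, pd_X_of_ne (by simp), smul_zero, mul_zero]
  · intro l hl
    rw [LinearMap.smul_apply, pd_X_of_ne (by simp), smul_zero]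

theorem tiltGen_zk_of_ne {n : N2} (hn : n ≠ 0) (k : ℕ) : tiltGen n (zk k) = 0 := by
  rw [tiltGen_ne_zero ⟨n, hn⟩]
  exact pd_X_of_ne (by simp)

theorem tiltGen_zn_self (n : {n : N2 // n ≠ 0}) : tiltGen n.1 (zn n) = 1 := by
  rw [tiltGen_ne_zero n]
  exact pd_X_self _

theorem tiltGen_zn_of_ne {n : N2} (m : {n : N2 // n ≠ 0}) (h : n ≠ m.1) : tiltGen n (zn m) = 0 := by
  rcases eq_or_ne n 0 with rfl | hn
  · exact tiltGen_zero_zn m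
  · rw [tiltGen_ne_zero ⟨n, hn⟩]
    exact pd_X_of_ne fun h' => h (by simpa using (congrArg Subtype.val (Sum.inr.inj h')).symm)

theorem shiftGen_zn (i : Fin 2) (n : {n : N2 // n ≠ 0}) :
    shiftGen i (zn n) = ((n.1 i : ℝ) + 1) • zn ⟨n.1 + single i 1, add_single_ne_zero n.1 i⟩ := by
  rw [shiftGen, varSum_X_eq _ _ _ _ n.1]
  · rw [LinearMap.smul_apply, tiltGen_zn_self, mul_smul_comm, mul_one]
  · intro m hm
    rw [LinearMap.smul_apply, tiltGen_zn_of_ne n hm, smul_zero]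

theorem shiftGen_zk (i : Fin 2) (k : ℕ) :
    shiftGen i (zk k) = ((k : ℝ) + 1) • (zk (k + 1) * zn ⟨single i 1, by simp⟩) := by
  rw [shiftGen, varSum_X_eq _ _ _ _ 0]
  · rw [LinearMap.smul_apply, tiltGen_zero_zk]
    simp [mul_comm]
  · intro m hm
    rw [LinearMap.smul_apply, tiltGen_zk_of_ne hm, smul_zero]

end

section

/-! ### Series with prescribed support -/

/-- The space of power series supported on a set of multi-indices. -/
def supported (S : Set MIdx) : Submodule ℝ PS where
  carrier := {φ | ∀ γ : MIdx, MvPowerSeries.coeff γ φ ≠ 0 → γ ∈ S}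
  zero_mem' := fun γ h => absurd (map_zero _) h
  add_mem' := by
    intro φ ψ hφ hψ γ h
    by_cases h1 : MvPowerSeries.coeff γ φ = 0
    · refine hψ γ fun h2 => h ?_
      rw [map_add, h1, h2, add_zero]
    · exact hφ γ h1
  smul_mem' := by
    intro c φ hφ γ h
    refine hφ γ fun h1 => h ?_
    rw [map_smul, h1, smul_zero]

theorem supported_mono {S T : Set MIdx} (h : S ⊆ T) : supported S ≤ supported T :=
  fun _ hφ γ hγ => h (hφ γ hγ)

theorem zpow_mem_supported {S : Set MIdx} {γ : MIdx} (h : γ ∈ S) : zpow γ ∈ supported S := by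
  intro δ hδ
  by_contra hc
  refine hδ (MvPowerSeries.coeff_monomial_ne ?_ _)
  rintro rfl
  exact hc h

theorem _root_.HasSum.mem_supported {ι : Type*} {F : ι → PS} {T : PS} (h : HasSum F T)
    {S : Set MIdx} (hF : ∀ i, F i ∈ supported S) : T ∈ supported S := fun _ hγ =>
  let ⟨i, hi⟩ := h.exists_coeff_ne_zero hγ
  hF i _ hi

/-- The multi-indices that span `T^*`. -/
def tstarIdx : Set MIdx :=
  {γ | 0 ≤ bracket γ ∨ ∃ n : {n : N2 // n ≠ 0}, γ = single (Sum.inr n) 1}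

/-! ### Gradings -/

/-- The weights of the variables for the grading `[γ]`. -/
def bracketWeight : Idx → ℤ
  | Sum.inl k => k
  | Sum.inr _ => -1

/-- The weights of the variables for the grading `∑_n |n| γ(n)`. -/
def lenWeight (len : N2 →+ ℝ) : Idx → ℝ
  | Sum.inl _ => 0
  | Sum.inr n => len n.1

/-- The weights of the variables for the grading `|γ| - α`. -/
def homogWeight (α : ℝ) (len : N2 →+ ℝ) : Idx → ℝ
  | Sum.inl k => α * k
  | Sum.inr n => len n.1 - α

theorem bracket_eq_weight (γ : MIdx) : bracket γ = weight bracketWeight γ := by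
  rw [bracket, weight_apply]
  refine Finsupp.sum_congr fun i _ => ?_
  cases i <;> simp [bracketWeight, mul_comm]

theorem homog_eq_bracket_add (α : ℝ) (len : N2 →+ ℝ) (γ : MIdx) :
    homog α len γ = α * (bracket γ + 1) + weight (lenWeight len) γ := by
  rw [homog, weight_apply]
  congr 1
  refine Finsupp.sum_congr fun i _ => ?_
  cases i <;> simp [lenWeight, mul_comm]

theorem homog_eq_weight (α : ℝ) (len : N2 →+ ℝ) (γ : MIdx) :
    homog α len γ = α + weight (homogWeight α len) γ := by
  rw [homog_eq_bracket_add, bracket_eq_weight, weight_apply, weight_apply, weight_apply,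
    Finsupp.sum, Finsupp.sum, Finsupp.sum]
  push_cast
  rw [mul_add, mul_one, add_comm (α * _), add_assoc, Finset.mul_sum, ← Finset.sum_add_distrib]
  congr 1
  refine Finset.sum_congr rfl fun i _ => ?_
  cases i <;> simp [lenWeight, homogWeight, bracketWeight] <;> ring

theorem bracket_zero : bracket 0 = 0 := by simp [bracket_eq_weight]

theorem bracket_add (γ δ : MIdx) : bracket (γ + δ) = bracket γ + bracket δ := by
  simp [bracket_eq_weight]

theorem bracket_single (i : Idx) : bracket (single i 1) = bracketWeight i := by
  simp [bracket_eq_weight, weight_single]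

theorem homog_single_inr (α : ℝ) (len : N2 →+ ℝ) (n : {n : N2 // n ≠ 0}) :
    homog α len (single (Sum.inr n) 1) = len n.1 := by
  simp [homog_eq_weight, weight_single, homogWeight]

theorem len_nonneg {len : N2 →+ ℝ} (hlen : ∀ i : Fin 2, 0 < len (single i 1)) (n : N2) :
    0 ≤ len n := by
  induction n using Finsupp.induction_linear with
  | zero => simp
  | add f g hf hg => rw [map_add]; exact add_nonneg hf hg
  | single i c =>
    rw [show (single i c : N2) = c • single i 1 by simp, map_nsmul]
    exact nsmul_nonneg (hlen i).le c

theorem len_eq (len : N2 →+ ℝ) (n : N2) :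
    len n = n 0 * len (single 0 1) + n 1 * len (single 1 1) := by
  have h : n = n 0 • single 0 1 + n 1 • single 1 1 := by
    ext i
    fin_cases i <;> simp
  conv_lhs => rw [h]
  rw [map_add, map_nsmul, map_nsmul, nsmul_eq_mul, nsmul_eq_mul]

theorem len_pos {len : N2 →+ ℝ} (hlen : ∀ i : Fin 2, 0 < len (single i 1)) {n : N2} (hn : n ≠ 0) :
    0 < len n := by
  obtain ⟨i, hi⟩ := Finsupp.ne_iff.1 hn
  have h : n = single i 1 + (n - single i 1) := by
    ext j
    rcases eq_or_ne j i with rfl | hj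
    · simp at hi ⊢
      omega
    · simp [hj.symm]
  rw [h, map_add]
  exact add_pos_of_pos_of_nonneg (hlen i) (len_nonneg hlen _)

theorem len_lt_len {len : N2 →+ ℝ} (hlen : ∀ i : Fin 2, 0 < len (single i 1)) {n m : N2}
    (h : n < m) : len n < len m := by
  obtain ⟨c, rfl⟩ := exists_add_of_le h.le
  rw [map_add]
  have : c ≠ 0 := by
    rintro rfl
    simp at h
  linarith [len_pos hlen this]

/-- Additivity and positivity bound each component `n i` by `C / len (single i 1)`, which leaves a
finite box. -/
theorem finite_len_le {len : N2 →+ ℝ} (hlen : ∀ i : Fin 2, 0 < len (single i 1)) (C : ℝ) :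
    {n : N2 | len n ≤ C}.Finite := by
  refine (Set.finite_Iic (single 0 ⌈C / len (single 0 1)⌉₊ +
    single 1 ⌈C / len (single 1 1)⌉₊ : N2)).subset fun n hn i => ?_
  have key : n i * len (single i 1) ≤ C := by
    refine le_trans ?_ hn
    rw [len_eq len n]
    have h0 := mul_nonneg (Nat.cast_nonneg (α := ℝ) (n 0)) (hlen 0).le
    have h1 := mul_nonneg (Nat.cast_nonneg (α := ℝ) (n 1)) (hlen 1).le
    fin_cases i
    · exact le_add_of_nonneg_right h1
    · exact le_add_of_nonneg_left h0
  have h2 : n i ≤ ⌈C / len (single i 1)⌉₊ := by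
    rw [← Nat.cast_le (α := ℝ)]
    exact ((le_div_iff₀ (hlen i)).2 key).trans (Nat.le_ceil _)
  fin_cases i
  · simpa using h2
  · simpa using h2

theorem weight_lenWeight_nonneg {len : N2 →+ ℝ} (hlen : ∀ i : Fin 2, 0 < len (single i 1))
    (γ : MIdx) : 0 ≤ weight (lenWeight len) γ := by
  rw [weight_apply]
  refine Finset.sum_nonneg fun i _ => nsmul_nonneg ?_ _
  cases i with
  | inl k => exact le_rfl
  | inr n => exact len_nonneg hlen _

/-- An endomorphism shifts the grading `deg` by `d`. -/
def Moves {M : Type*} [AddCommGroup M] (deg : MIdx →+ M) (T : Module.End ℝ PS) (d : M) : Prop :=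
  ∀ φ β, MvPowerSeries.coeff β (T φ) ≠ 0 →
    ∃ γ, MvPowerSeries.coeff γ φ ≠ 0 ∧ deg β = deg γ + d

/-! ### Operators that are homogeneous for a grading -/

section Moves

variable {M : Type*} [AddCommGroup M] {deg : MIdx →+ M}

theorem moves_one : Moves deg 1 0 := fun _ β h => ⟨β, h, (add_zero _).symm⟩

theorem Moves.mul {S T : Module.End ℝ PS} {c d : M} (hS : Moves deg S c) (hT : Moves deg T d) :
    Moves deg (S * T) (c + d) := by
  intro φ β h
  obtain ⟨γ, h1, h2⟩ := hS _ _ h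
  obtain ⟨δ, h3, h4⟩ := hT _ _ h1
  exact ⟨δ, h3, by rw [h2, h4]; abel⟩

theorem Moves.smul {T : Module.End ℝ PS} {d : M} (hT : Moves deg T d) (c : ℝ) :
    Moves deg (c • T) d := by
  intro φ β h
  rw [LinearMap.smul_apply, map_smul] at h
  exact hT φ β (right_ne_zero_of_mul h)

theorem Moves.pow {T : Module.End ℝ PS} {d : M} (hT : Moves deg T d) (k : ℕ) :
    Moves deg (T ^ k) (k • d) := by
  induction k with
  | zero => simpa using moves_one
  | succ k ih => rw [pow_succ, succ_nsmul]; exact ih.mul hT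

theorem moves_mulLeft (γ : MIdx) : Moves deg (LinearMap.mulLeft ℝ (zpow γ)) (deg γ) := by
  intro φ β h
  obtain ⟨γ', δ, rfl, h1, h2⟩ := exists_le_of_coeff_mul_ne_zero h
  have h3 : γ' = γ := zpow_mem_supported (S := {γ}) rfl γ' h1
  exact ⟨δ, h2, by rw [h3, map_add, add_comm]⟩

theorem moves_pd (i : Idx) : Moves deg (pd i) (-deg (single i 1)) := by
  intro φ β h
  have h' : MvPowerSeries.coeff β (MvPowerSeries.pderiv ℝ i φ) ≠ 0 := h
  rw [MvPowerSeries.coeff_pderiv] at h'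
  exact ⟨_, left_ne_zero_of_mul h', by simp⟩

theorem moves_varSum {ι : Type*} (g : ι → Idx) (hg : Function.Injective g)
    (T : ι → Module.End ℝ PS) (d : M) (hT : ∀ x, Moves deg (T x) (d - deg (single (g x) 1))) :
    Moves deg (varSum g hg T) d := by
  intro φ β h
  obtain ⟨x, hx⟩ := (hasSum_varSum g hg T φ).exists_coeff_ne_zero h
  obtain ⟨γ, h1, h2⟩ := (moves_mulLeft (single (g x) 1)).mul (hT x) φ β hx
  exact ⟨γ, h1, by rw [h2, add_sub_cancel]⟩

/-- The gradings for which the generators of tilt and shift are homogeneous. -/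
structure IsShiftGrading (deg : MIdx →+ M) (d : M) (ℓ : N2 →+ M) : Prop where
  inl : ∀ k : ℕ, deg (single (Sum.inl (k + 1)) 1) = deg (single (Sum.inl k) 1) + d
  inr : ∀ n : {n : N2 // n ≠ 0}, deg (single (Sum.inr n) 1) = ℓ n.1 - d

variable {d : M} {ℓ : N2 →+ M}

theorem IsShiftGrading.moves_tiltGen (h : IsShiftGrading deg d ℓ) (n : N2) :
    Moves deg (tiltGen n) (d - ℓ n) := by
  rcases eq_or_ne n 0 with rfl | hn
  · rw [tiltGen_zero]
    refine moves_varSum _ _ _ _ fun k => ?_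
    have := (moves_pd (deg := deg) (Sum.inl k)).smul ((k : ℝ) + 1)
    rw [h.inl, map_zero, sub_zero]
    convert this using 1
    abel
  · rw [tiltGen_ne_zero ⟨n, hn⟩]
    have := moves_pd (deg := deg) (Sum.inr ⟨n, hn⟩)
    rwa [h.inr, neg_sub] at this

theorem IsShiftGrading.moves_shiftGen (h : IsShiftGrading deg d ℓ) (i : Fin 2) :
    Moves deg (shiftGen i) (ℓ (single i 1)) := by
  refine moves_varSum _ _ _ _ fun n => ?_
  have := (h.moves_tiltGen n).smul ((n i : ℝ) + 1)
  rw [h.inr, map_add]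
  convert this using 1
  abel

/-- In this grading each D^(n) has degree one and each ∂_i degree zero. -/
theorem isShiftGrading_bracket : IsShiftGrading (weight bracketWeight) 1 0 where
  inl k := by simp [weight_single, bracketWeight]
  inr n := by simp [weight_single, bracketWeight]

/-- In this grading D^(n) lowers the degree by |n| and ∂_i raises it by |e_i|; it controls the
exponent m of the shifts. -/
theorem isShiftGrading_len (len : N2 →+ ℝ) : IsShiftGrading (weight (lenWeight len)) 0 len where
  inl k := by simp [weight_single, lenWeight]
  inr n := by simp [weight_single, lenWeight]

/-- In this grading z^γ D^(n) has degree |γ| - |n|, which is positive for the pairs in `TiltIdx`;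
this is the source of triangularity. -/
theorem isShiftGrading_homog (α : ℝ) (len : N2 →+ ℝ) :
    IsShiftGrading (weight (homogWeight α len)) α len where
  inl k := by simp [weight_single, homogWeight]; ring
  inr n := by simp [weight_single, homogWeight]

end Moves

theorem finsupp_induction_add_single {ι : Type*} {p : (ι →₀ ℕ) → Prop} (zero : p 0)
    (step : ∀ J y, p J → p (J + single y 1)) (J : ι →₀ ℕ) : p J := by
  classical
  induction J using Finsupp.induction with
  | zero => exact zero
  | single_add y c J _ _ ih =>
    clear * - ih step
    induction c with
    | zero => simpa using ih
    | succ c ihc =>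
      have := step _ y ihc
      rwa [add_right_comm, ← single_add] at this

/-! ### Structure of `D_(J,m)` -/

variable {α : ℝ} {len : N2 →+ ℝ}

/-- The product of the commuting generators `D^(n)` with multiplicities `J`. -/
def tiltProd (J : TiltIdx α len →₀ ℕ) : Module.End ℝ PS :=
  J.support.noncommProd (fun y => tiltGen y.1.2 ^ J y)
    (fun _ _ _ _ _ => (tiltGen_comm _ _).pow_pow _ _)

theorem tiltProd_zero : tiltProd (0 : TiltIdx α len →₀ ℕ) = 1 := by
  simp [tiltProd]

/-- The generators lie in a commutative submonoid of `Module.End ℝ PS`. There `noncommProd` becomes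
an ordinary `Finsupp.prod`, for which adding one factor is a standard rule. -/
theorem tiltProd_add_single (J : TiltIdx α len →₀ ℕ) (y : TiltIdx α len) :
    tiltProd (J + single y 1) = tiltProd J * tiltGen y.1.2 := by
  classical
  have hcomm : ∀ a ∈ Set.range tiltGen, ∀ b ∈ Set.range tiltGen, a * b = b * a := by
    rintro _ ⟨n, rfl⟩ _ ⟨m, rfl⟩
    exact tiltGen_comm n m
  let C := Submonoid.closure (Set.range tiltGen)
  have hC : IsMulCommutative C := Submonoid.isMulCommutative_closure _ hcomm
  let _ : CommMonoid C := { (inferInstance : Monoid C) with mul_comm := hC.is_comm.comm }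
  let t : TiltIdx α len → C := fun y => ⟨tiltGen y.1.2, Submonoid.subset_closure ⟨_, rfl⟩⟩
  have key : ∀ J : TiltIdx α len →₀ ℕ, tiltProd J = ((J.prod fun y c => t y ^ c : C) :
      Module.End ℝ PS) := by
    intro J
    rw [Finsupp.prod, ← Finset.noncommProd_eq_prod]
    exact (Finset.map_noncommProd J.support (fun y => t y ^ J y) _ C.subtype).symm
  rw [key, key, Finsupp.prod_add_index' (fun _ => pow_zero _) (fun _ _ _ => pow_add _ _ _),
    prod_single_index (h := fun y c => t y ^ c) (pow_zero _), pow_one]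
  rfl

/-- The exponent of `∏ (z^γ)^J(γ,n)`. -/
def tiltExp : (TiltIdx α len →₀ ℕ) →+ MIdx := weight fun y : TiltIdx α len => y.1.1

theorem prod_zpow (J : TiltIdx α len →₀ ℕ) :
    (J.prod fun y c => zpow y.1.1 ^ c) = zpow (tiltExp J) := by
  classical
  induction J using Finsupp.induction_linear with
  | zero => simp [tiltExp, zpow]
  | add f g hf hg =>
    rw [Finsupp.prod_add_index' (by simp) (by simp [pow_add]), hf, hg, map_add]
    simp [zpow, MvPowerSeries.monomial_mul_monomial]
  | single y c =>
    rw [prod_single_index (by simp), tiltExp, weight_single]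
    simp [zpow, MvPowerSeries.monomial_pow]

/-- The normalization `1 / (J! m!)` of `D_(J,m)`. -/
def dNorm (x : JIdx α len) : ℝ :=
  ((x.1.prod fun _ c => (c.factorial : ℝ)) * ∏ i, ((x.2 i).factorial : ℝ))⁻¹

theorem dBasis_eq (x : JIdx α len) : dBasis x = dNorm x •
    (LinearMap.mulLeft ℝ (zpow (tiltExp x.1)) * (shiftGen 0 ^ x.2 0 * shiftGen 1 ^ x.2 1) *
      tiltProd x.1) := by
  rw [dBasis, prod_zpow]
  rfl

theorem continuous_end_mul {S T : Module.End ℝ PS} (hS : Continuous S) (hT : Continuous T) :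
    Continuous (S * T) := hS.comp hT

theorem continuous_end_pow {T : Module.End ℝ PS} (hT : Continuous T) (k : ℕ) :
    Continuous (T ^ k) := by
  induction k with
  | zero => exact continuous_id
  | succ k ih => rw [pow_succ]; exact continuous_end_mul ih hT

theorem continuous_tiltProd (J : TiltIdx α len →₀ ℕ) : Continuous (tiltProd J) := by
  induction J using finsupp_induction_add_single with
  | zero => rw [tiltProd_zero]; exact continuous_id
  | step J y ih =>
    rw [tiltProd_add_single]
    exact continuous_end_mul ih (continuous_tiltGen _)

theorem continuous_shiftGen_pow (a b : ℕ) : Continuous (shiftGen 0 ^ a * shiftGen 1 ^ b) :=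
  continuous_end_mul (continuous_end_pow (continuous_shiftGen 0) _)
    (continuous_end_pow (continuous_shiftGen 1) _)

theorem continuous_dBasis (x : JIdx α len) : Continuous (dBasis x) := by
  rw [dBasis_eq]
  exact (continuous_end_mul (continuous_end_mul (continuous_const_mul _)
    (continuous_shiftGen_pow _ _)) (continuous_tiltProd _)).const_smul _

section Moves

variable {M : Type*} [AddCommGroup M] {deg : MIdx →+ M} {d : M} {ℓ : N2 →+ M}

theorem IsShiftGrading.moves_tiltProd (h : IsShiftGrading deg d ℓ) (J : TiltIdx α len →₀ ℕ) :
    Moves deg (tiltProd J) (weight (fun y : TiltIdx α len => d - ℓ y.1.2) J) := by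
  induction J using finsupp_induction_add_single with
  | zero => rw [tiltProd_zero, map_zero]; exact moves_one
  | step J y ih =>
    rw [tiltProd_add_single, map_add, weight_single, one_smul]
    exact ih.mul (h.moves_tiltGen _)

theorem IsShiftGrading.moves_shiftGen_pow (h : IsShiftGrading deg d ℓ) (m : N2) :
    Moves deg (shiftGen 0 ^ m 0 * shiftGen 1 ^ m 1) (ℓ m) := by
  have h1 := ((h.moves_shiftGen 0).pow (m 0)).mul ((h.moves_shiftGen 1).pow (m 1))
  convert h1 using 1
  have h2 : m = m 0 • single 0 1 + m 1 • single 1 1 := by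
    ext i
    fin_cases i <;> simp
  conv_lhs => rw [h2]
  simp only [map_add, map_nsmul]

theorem IsShiftGrading.moves_dBasis (h : IsShiftGrading deg d ℓ) (x : JIdx α len) :
    Moves deg (dBasis x)
      (weight (fun y : TiltIdx α len => deg y.1.1 + (d - ℓ y.1.2)) x.1 + ℓ x.2) := by
  rw [dBasis_eq]
  have h1 := (((moves_mulLeft (deg := deg) (tiltExp x.1)).mul (h.moves_shiftGen_pow x.2)).mul
    (h.moves_tiltProd x.1)).smul (dNorm x)
  convert h1 using 1
  simp only [tiltExp, weight_apply, Finsupp.sum, map_sum, map_nsmul, smul_add,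
    Finset.sum_add_distrib]
  abel

end Moves

end

section

/-! ### Series whose bracket is bounded from below -/

/-- The power series supported on `[γ] ≥ N`. -/
def level (N : ℤ) : Submodule ℝ PS := supported {γ | N ≤ bracket γ}

theorem level_anti {M N : ℤ} (h : M ≤ N) : level N ≤ level M :=
  supported_mono fun _ hγ => h.trans hγ

theorem mul_mem_level {M N : ℤ} {φ ψ : PS} (hφ : φ ∈ level M) (hψ : ψ ∈ level N) :
    φ * ψ ∈ level (M + N) := by
  intro β h
  obtain ⟨γ, δ, rfl, h1, h2⟩ := exists_le_of_coeff_mul_ne_zero h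
  show _ ≤ bracket _
  rw [bracket_add]
  exact add_le_add (hφ γ h1) (hψ δ h2)

theorem X_mem_level (i : Idx) : (MvPowerSeries.X i : PS) ∈ level (bracketWeight i) :=
  zpow_mem_supported (bracket_single i).ge

theorem one_mem_level : (1 : PS) ∈ level 0 :=
  zpow_mem_supported (γ := 0) bracket_zero.ge

theorem pow_mem_level {N : ℤ} {φ : PS} (hφ : φ ∈ level N) (k : ℕ) : φ ^ k ∈ level (k * N) := by
  induction k with
  | zero => simpa using one_mem_level
  | succ k ih =>
    rw [pow_succ]
    convert mul_mem_level ih hφ using 2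
    push_cast
    ring

theorem bracket_of_mem_tstarIdx {γ : MIdx} (h : γ ∈ tstarIdx) : -1 ≤ bracket γ := by
  rcases h with h | ⟨n, rfl⟩
  · omega
  · rw [bracket_single]
    exact le_rfl

/-- `Tstar` unfolds to `supported tstarIdx`, so the lemmas on prescribed supports apply to it
directly. The value `-1` is the bracket of the monomials z_n. -/
theorem tstar_le_level : Tstar ≤ level (-1) :=
  supported_mono fun _ => bracket_of_mem_tstarIdx

/-- The algebra of power series on the support of which `[γ]` is bounded from below. -/
def bddSeries : Subalgebra ℝ PS where
  carrier := {φ | ∃ N, φ ∈ level N}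
  mul_mem' := fun ⟨M, hM⟩ ⟨N, hN⟩ => ⟨M + N, mul_mem_level hM hN⟩
  add_mem' := fun ⟨M, hM⟩ ⟨N, hN⟩ => ⟨min M N,
    add_mem (level_anti (min_le_left _ _) hM) (level_anti (min_le_right _ _) hN)⟩
  algebraMap_mem' c := ⟨0, by
    rw [Algebra.algebraMap_eq_smul_one]
    exact Submodule.smul_mem _ _ one_mem_level⟩

theorem mem_bddSeries_of_tstar {φ : PS} (h : φ ∈ Tstar) : φ ∈ bddSeries := ⟨-1, tstar_le_level h⟩

theorem X_mem_bddSeries (i : Idx) : (MvPowerSeries.X i : PS) ∈ bddSeries := ⟨_, X_mem_level i⟩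

theorem coe_mem_bddSeries (P : MvPolynomial Idx ℝ) : (P : PS) ∈ bddSeries := by
  induction P using MvPolynomial.induction_on with
  | C a =>
    rw [MvPolynomial.coe_C]
    exact bddSeries.algebraMap_mem a
  | add p q hp hq => rw [MvPolynomial.coe_add]; exact add_mem hp hq
  | mul_X p i hp => rw [MvPolynomial.coe_mul, MvPolynomial.coe_X]; exact mul_mem hp (X_mem_bddSeries i)

/-! ### Locally finite sums of operators -/

/-- A family of continuous operators, of which for given lower bound on `[γ]` only finitely many
contribute to each coefficient. -/
structure IsLocFinite {X : Type*} (F : X → Module.End ℝ PS) : Prop where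
  continuous : ∀ x, Continuous (F x)
  finite : ∀ N β, {x | ∃ φ ∈ level N, MvPowerSeries.coeff β (F x φ) ≠ 0}.Finite

/-- The coefficientwise sum of a family of operators. -/
def famSum {X : Type*} (F : X → Module.End ℝ PS) (φ : PS) : PS :=
  fun β => ∑ᶠ x, MvPowerSeries.coeff β (F x φ)

section famSum

variable {X : Type*} {F : X → Module.End ℝ PS}

theorem coeff_famSum (φ : PS) (β : MIdx) :
    MvPowerSeries.coeff β (famSum F φ) = ∑ᶠ x, MvPowerSeries.coeff β (F x φ) := rfl

theorem IsLocFinite.hasSum (hF : IsLocFinite F) {φ : PS} (hφ : φ ∈ bddSeries) :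
    HasSum (fun x => F x φ) (famSum F φ) := by
  obtain ⟨N, hN⟩ := hφ
  exact hasSum_iff.2 fun β => ⟨(hF.finite N β).subset fun x hx => ⟨φ, hN, hx⟩, rfl⟩

theorem IsLocFinite.map_add (hF : IsLocFinite F) {φ ψ : PS} (hφ : φ ∈ bddSeries)
    (hψ : ψ ∈ bddSeries) : famSum F (φ + ψ) = famSum F φ + famSum F ψ :=
  (hF.hasSum (add_mem hφ hψ)).unique
    (((hF.hasSum hφ).add (hF.hasSum hψ)).of_eq fun x => by rw [_root_.map_add])

theorem IsLocFinite.map_smul (hF : IsLocFinite F) (c : ℝ) {φ : PS} (hφ : φ ∈ bddSeries) :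
    famSum F (c • φ) = c • famSum F φ :=
  (hF.hasSum (bddSeries.smul_mem hφ c)).unique
    (((hF.hasSum hφ).const_smul c).of_eq fun x => by rw [_root_.map_smul])

/-- Once `β` and the lower bound `N` are fixed, one finite set of indices serves all series in
`level N`. On that level the `β`-coefficient of `famSum F` is therefore that of a finite sum of
continuous operators, which pass through the sum. -/
theorem IsLocFinite.map_hasSum (hF : IsLocFinite F) {ι : Type*} {G : ι → PS} {S : PS}
    (h : HasSum G S) {N : ℤ} (hG : ∀ i, G i ∈ level N) :
    HasSum (fun i => famSum F (G i)) (famSum F S) := by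
  classical
  have hS : S ∈ level N := h.mem_supported hG
  rw [hasSum_iff]
  intro β
  have key : ∀ φ ∈ level N, MvPowerSeries.coeff β (famSum F φ) =
      MvPowerSeries.coeff β (∑ x ∈ (hF.finite N β).toFinset, F x φ) := by
    intro φ hφ
    rw [coeff_famSum, map_sum]
    refine finsum_eq_sum_of_support_subset _ fun x hx => ?_
    rw [Set.Finite.coe_toFinset]
    exact ⟨φ, hφ, hx⟩
  have hsum : HasSum (fun i => ∑ x ∈ (hF.finite N β).toFinset, F x (G i))
      (∑ x ∈ (hF.finite N β).toFinset, F x S) :=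
    hasSum_sum fun x _ => h.map (F x) (hF.continuous x)
  simp only [key _ (hG _), key _ hS]
  exact hasSum_iff.1 hsum β

end famSum

/-- Algebra morphisms on `bddSeries` that preserve the levels and locally finite sums. -/
structure IsTameHom (Φ : PS → PS) : Prop where
  map_one : Φ 1 = 1
  map_mul : ∀ φ ∈ bddSeries, ∀ ψ ∈ bddSeries, Φ (φ * ψ) = Φ φ * Φ ψ
  map_add : ∀ φ ∈ bddSeries, ∀ ψ ∈ bddSeries, Φ (φ + ψ) = Φ φ + Φ ψ
  map_smul : ∀ (c : ℝ), ∀ φ ∈ bddSeries, Φ (c • φ) = c • Φ φ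
  mem_level : ∀ N, ∀ φ ∈ level N, Φ φ ∈ level N
  map_hasSum : ∀ {ι : Type} {G : ι → PS} {S : PS} {N : ℤ}, HasSum G S → (∀ i, G i ∈ level N) →
    HasSum (fun i => Φ (G i)) (Φ S)

namespace IsTameHom

variable {Φ Ψ : PS → PS}

theorem mem_bddSeries (hΦ : IsTameHom Φ) {φ : PS} (h : φ ∈ bddSeries) : Φ φ ∈ bddSeries :=
  let ⟨N, hN⟩ := h
  ⟨N, hΦ.mem_level N φ hN⟩

theorem id : IsTameHom id where
  map_one := rfl
  map_mul _ _ _ _ := rfl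
  map_add _ _ _ _ := rfl
  map_smul _ _ _ := rfl
  mem_level _ _ h := h
  map_hasSum h _ := h

theorem comp (hΦ : IsTameHom Φ) (hΨ : IsTameHom Ψ) : IsTameHom (Φ ∘ Ψ) where
  map_one := by simp [hΨ.map_one, hΦ.map_one]
  map_mul φ hφ ψ hψ := by
    simp [hΨ.map_mul φ hφ ψ hψ, hΦ.map_mul _ (hΨ.mem_bddSeries hφ) _ (hΨ.mem_bddSeries hψ)]
  map_add φ hφ ψ hψ := by
    simp [hΨ.map_add φ hφ ψ hψ, hΦ.map_add _ (hΨ.mem_bddSeries hφ) _ (hΨ.mem_bddSeries hψ)]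
  map_smul c φ hφ := by
    simp [hΨ.map_smul c φ hφ, hΦ.map_smul c _ (hΨ.mem_bddSeries hφ)]
  mem_level N φ hφ := hΦ.mem_level N _ (hΨ.mem_level N φ hφ)
  map_hasSum h hG := hΦ.map_hasSum (hΨ.map_hasSum h hG) fun i => hΨ.mem_level _ _ (hG i)

theorem map_pow (hΦ : IsTameHom Φ) {φ : PS} (h : φ ∈ bddSeries) (k : ℕ) :
    Φ (φ ^ k) = Φ φ ^ k := by
  induction k with
  | zero => simp [hΦ.map_one]
  | succ k ih => rw [pow_succ, hΦ.map_mul _ (pow_mem h k) _ h, ih, pow_succ]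

theorem map_prod (hΦ : IsTameHom Φ) {ι : Type*} (s : Finset ι) (φ : ι → PS)
    (h : ∀ i ∈ s, φ i ∈ bddSeries) : Φ (∏ i ∈ s, φ i) = ∏ i ∈ s, Φ (φ i) := by
  classical
  induction s using Finset.induction_on with
  | empty => simp [hΦ.map_one]
  | insert i s hi ih =>
    rw [Finset.prod_insert hi, Finset.prod_insert hi, hΦ.map_mul _ (h i (by simp)) _
      (prod_mem fun j hj => h j (by simp [hj])), ih fun j hj => h j (by simp [hj])]

theorem map_coe (hΦ : IsTameHom Φ) (P : MvPolynomial Idx ℝ) :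
    Φ (P : PS) = MvPolynomial.aeval (fun i : Idx => Φ (MvPowerSeries.X i)) P := by
  induction P using MvPolynomial.induction_on with
  | C a =>
    have h : (MvPowerSeries.C a : PS) = a • 1 := by rw [MvPowerSeries.smul_eq_C_mul, mul_one]
    rw [MvPolynomial.coe_C, h, hΦ.map_smul _ _ (one_mem _), hΦ.map_one, MvPolynomial.aeval_C,
      Algebra.algebraMap_eq_smul_one]
  | add p q hp hq =>
    rw [MvPolynomial.coe_add, hΦ.map_add _ (coe_mem_bddSeries p) _ (coe_mem_bddSeries q), hp, hq,
      _root_.map_add]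
  | mul_X p i hp =>
    rw [MvPolynomial.coe_mul, MvPolynomial.coe_X,
      hΦ.map_mul _ (coe_mem_bddSeries p) _ (X_mem_bddSeries i), hp, _root_.map_mul,
      MvPolynomial.aeval_X]

/-- The values on variables fix those on monomials. The monomial expansion of a series in `level N`
stays in `level N`, so `map_hasSum` extends the equality to all of `bddSeries`. -/
theorem ext (hΦ : IsTameHom Φ) (hΨ : IsTameHom Ψ)
    (h : ∀ i : Idx, Φ (MvPowerSeries.X i) = Ψ (MvPowerSeries.X i)) {φ : PS}
    (hφ : φ ∈ bddSeries) : Φ φ = Ψ φ := by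
  have hz : ∀ γ : MIdx, Φ (zpow γ) = Ψ (zpow γ) := by
    intro γ
    have : zpow γ = ((MvPolynomial.monomial γ (1 : ℝ) : MvPolynomial Idx ℝ) : PS) :=
      (MvPolynomial.coe_monomial γ 1).symm
    rw [this, hΦ.map_coe, hΨ.map_coe]
    simp only [h]
  obtain ⟨N, hN⟩ := hφ
  have hmem : ∀ γ, MvPowerSeries.coeff γ φ • zpow γ ∈ level N := by
    intro γ
    by_cases h0 : MvPowerSeries.coeff γ φ = 0
    · rw [h0, zero_smul]
      exact zero_mem _
    · exact Submodule.smul_mem _ _ (zpow_mem_supported (hN γ h0))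
  have hb : ∀ γ, zpow γ ∈ bddSeries := fun γ => ⟨bracket γ, zpow_mem_supported (γ := γ) (le_refl (bracket γ))⟩
  refine (hΦ.map_hasSum (hasSum_monomials φ) hmem).unique
    ((hΨ.map_hasSum (hasSum_monomials φ) hmem).of_eq fun γ => ?_)
  rw [hΦ.map_smul _ _ (hb γ), hΨ.map_smul _ _ (hb γ), hz]

end IsTameHom

/-! ### Exponential families of derivations -/

/-- The Leibniz rule for families that satisfy the recursion of `(∑ ρ_i δ_i)^k / k!`, with all
multiplications to the left of all derivations. -/
theorem leibniz_of_recursion {ι : Type*} {ρ : ι → PS} {δ : ι → Module.End ℝ PS}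
    (hδ : ∀ i, IsLeibniz (δ i)) {T : ℕ → PS → PS}
    (hadd : ∀ k φ ψ, T k (φ + ψ) = T k φ + T k ψ)
    (hzero : ∀ φ ψ, T 0 (φ * ψ) = T 0 φ * T 0 ψ)
    (hrec : ∀ k φ, HasSum (fun i => ρ i * T k (δ i φ)) (((k : ℝ) + 1) • T (k + 1) φ)) (k : ℕ)
    (φ ψ : PS) : T k (φ * ψ) = ∑ p ∈ antidiagonal k, T p.1 φ * T p.2 ψ := by
  induction k generalizing φ ψ with
  | zero => simp [hzero]
  | succ k ih =>
    have h1 : HasSum (fun i => ρ i * T k (δ i (φ * ψ)))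
        (∑ p ∈ antidiagonal k, ((((p.1 : ℝ) + 1) • T (p.1 + 1) φ) * T p.2 ψ +
          T p.1 φ * (((p.2 : ℝ) + 1) • T (p.2 + 1) ψ))) := by
      refine (hasSum_sum fun p (_ : p ∈ antidiagonal k) =>
        ((hrec p.1 φ).mul_right (T p.2 ψ)).add ((hrec p.2 ψ).mul_left (T p.1 φ))).of_eq
        fun i => ?_
      rw [hδ i, hadd, ih, ih, ← Finset.sum_add_distrib, Finset.mul_sum]
      refine Finset.sum_congr rfl fun p _ => ?_
      ring
    have h2 := (hrec k (φ * ψ)).unique h1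
    have h3 : ∑ p ∈ antidiagonal k, ((((p.1 : ℝ) + 1) • T (p.1 + 1) φ) * T p.2 ψ +
          T p.1 φ * (((p.2 : ℝ) + 1) • T (p.2 + 1) ψ)) =
        ((k : ℝ) + 1) • ∑ p ∈ antidiagonal (k + 1), T p.1 φ * T p.2 ψ := by
      -- The weight `p.1` kills the end point `p.1 = 0`, so the antidiagonal of `k + 1` shrinks to a
      -- shifted antidiagonal of `k`; `e2` does the same for `p.2`. The two weights add up to `k +
      -- 1`.
      have e1 : ∑ p ∈ antidiagonal (k + 1), (p.1 : ℝ) • (T p.1 φ * T p.2 ψ) =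
          ∑ p ∈ antidiagonal k, (((p.1 : ℝ) + 1) • T (p.1 + 1) φ) * T p.2 ψ := by
        rw [Finset.Nat.sum_antidiagonal_succ]
        simp
      have e2 : ∑ p ∈ antidiagonal (k + 1), (p.2 : ℝ) • (T p.1 φ * T p.2 ψ) =
          ∑ p ∈ antidiagonal k, T p.1 φ * (((p.2 : ℝ) + 1) • T (p.2 + 1) ψ) := by
        rw [Finset.Nat.sum_antidiagonal_succ']
        simp
      rw [Finset.sum_add_distrib, ← e1, ← e2, ← Finset.sum_add_distrib, Finset.smul_sum]
      refine Finset.sum_congr rfl fun p hp => ?_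
      rw [← add_smul]
      congr 1
      exact_mod_cast mem_antidiagonal.1 hp
    rw [h3] at h2
    exact smul_right_injective PS (by positivity : (k : ℝ) + 1 ≠ 0) h2

end

/-! ### Operators defined by locally finite sums -/

section

/-- The pointwise sum of a family of operators, if it exists everywhere. -/
def sumEnd {X : Type*} (F : X → Module.End ℝ PS) (hF : ∀ φ, Summable fun x => F x φ) :
    Module.End ℝ PS where
  toFun φ := ∑' x, F x φ
  map_add' φ ψ := by
    simp only [map_add]
    exact (hF φ).tsum_add (hF ψ)
  map_smul' c φ := by
    simp only [map_smul]
    exact (hF φ).tsum_const_smul c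

theorem hasSum_sumEnd {X : Type*} (F : X → Module.End ℝ PS) (hF : ∀ φ, Summable fun x => F x φ)
    (φ : PS) : HasSum (fun x => F x φ) (sumEnd F hF φ) := (hF φ).hasSum

theorem _root_.HasSum.sum_antidiagonal {F : ℕ × ℕ → PS} {S : PS} (h : HasSum F S) :
    HasSum (fun n => ∑ p ∈ antidiagonal n, F p) S := by
  have h1 := (Finset.HasAntidiagonal.sigmaAntidiagonalEquivProd (A := ℕ)).hasSum_iff.2 h
  refine (h1.sigma fun n => ?_)
  have h2 := hasSum_fintype (L := .unconditional _) (fun p : antidiagonal n => F p)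
  rw [Finset.sum_coe_sort (antidiagonal n) F] at h2
  exact h2

theorem coeff_mul_X_eq_zero (ψ : PS) {i : Idx} {β : MIdx} (h : β i = 0) :
    MvPowerSeries.coeff β (ψ * MvPowerSeries.X i) = 0 := by
  classical
  rw [MvPowerSeries.X_def, MvPowerSeries.coeff_mul_monomial, if_neg]
  intro hle
  have := hle i
  simp [h] at this

/-! ### Translation of `a(u) = ∑_k z_k u^k` in `u` -/

theorem summable_mul_zk (ψ : ℕ → PS) (k : ℕ) : Summable fun l => ψ l * zk (k + l) := by
  rw [summable_iff_coeff]
  intro β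
  have h := finite_coeff_X_mul (g := fun l : ℕ => (Sum.inl (k + l) : Idx))
    (fun _ _ h => by simpa using h) ψ β
  simpa only [mul_comm] using h

/-- The series `∑_l binom(k+l, k) ρ^l z_{k+l}`, the `k`-th coefficient of `a(· + ρ)`. -/
def translate (k : ℕ) (ρ : PS) : PS := ∑' l, ((k + l).choose k : ℝ) • (ρ ^ l * zk (k + l))

theorem hasSum_translate (k : ℕ) (ρ : PS) :
    HasSum (fun l => ((k + l).choose k : ℝ) • (ρ ^ l * zk (k + l))) (translate k ρ) := by
  have := summable_mul_zk (fun l => ((k + l).choose k : ℝ) • ρ ^ l) k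
  simp only [smul_mul_assoc] at this
  exact this.hasSum

/-- This is the semigroup law a(· + (ρ + σ)) = (a(· + σ))(· + ρ) on coefficients. One double series
over (j, l) is summed along rows, which gives the translates by `σ`, and along antidiagonals, where
the binomial theorem assembles powers of `ρ + σ`. -/
theorem hasSum_translate_add (k : ℕ) (ρ σ : PS) :
    HasSum (fun j => ((k + j).choose k : ℝ) • (ρ ^ j * translate (k + j) σ))
      (translate k (ρ + σ)) := by
  let F : ℕ × ℕ → PS := fun p => (((k + p.1).choose k * (k + p.1 + p.2).choose (k + p.1) : ℕ) : ℝ) •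
    (ρ ^ p.1 * (σ ^ p.2 * zk (k + p.1 + p.2)))
  have hF : Summable F := by
    rw [summable_iff_coeff]
    intro β
    have h2 : {l : ℕ | Sum.inl l ∈ β.support}.Finite :=
      β.support.finite_toSet.preimage Sum.inl_injective.injOn
    obtain ⟨B, hB⟩ := h2.bddAbove
    refine ((Set.finite_Iic B).prod (Set.finite_Iic B)).subset fun p hp => ?_
    have hp' : MvPowerSeries.coeff β (F p) ≠ 0 := hp
    -- A nonzero coefficient forces the variable `z_{k+p.1+p.2}` to divide `z^β`, which bounds both
    -- indices at once.
    have hle : k + p.1 + p.2 ≤ B := by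
      refine hB ?_
      show Sum.inl (k + p.1 + p.2) ∈ β.support
      rw [Finsupp.mem_support_iff]
      intro h0
      apply hp'
      simp only [F, ← mul_assoc, map_smul]
      rw [coeff_mul_X_eq_zero _ h0, smul_zero]
    constructor <;> simp only [Set.mem_Iic] <;> omega
  obtain ⟨S, hS⟩ := hF
  have h1 : HasSum (fun j => ((k + j).choose k : ℝ) • (ρ ^ j * translate (k + j) σ)) S := by
    refine hS.prod_fiberwise fun j => ?_
    refine (((hasSum_translate (k + j) σ).mul_left (ρ ^ j)).const_smul
      ((k + j).choose k : ℝ)).of_eq fun l => ?_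
    simp only [F, mul_smul_comm, smul_smul]
    push_cast
    rfl
  have h2 : HasSum (fun l => ((k + l).choose k : ℝ) • ((ρ + σ) ^ l * zk (k + l))) S := by
    refine hS.sum_antidiagonal.of_eq fun N => ?_
    rw [(Commute.all ρ σ).add_pow', Finset.sum_mul, Finset.smul_sum]
    refine Finset.sum_congr rfl fun p hp => ?_
    have hpN : p.1 + p.2 = N := mem_antidiagonal.1 hp
    -- The identity is C(k+N, k+p.1) C(k+p.1, k) = C(k+N, k) C(N, p.1).
    have hc := Nat.choose_mul (n := k + N) (k := k + p.1) (s := k) (by omega)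
    rw [show k + N - k = N by omega, show k + p.1 - k = p.1 by omega] at hc
    simp only [F]
    rw [show k + p.1 + p.2 = k + N by omega, mul_comm ((k + p.1).choose k), hc,
      ← Nat.cast_smul_eq_nsmul ℝ, smul_mul_assoc, smul_smul, mul_assoc]
    push_cast
    rfl
  rw [(hasSum_translate k (ρ + σ)).unique h2]
  exact h1

/-! ### Exponential families built from the generators of tilt -/

/-- Families `T_k` that satisfy the recursion of `(1/k!) ∑ ρ_{i_1} ⋯ ρ_{i_k} T_0 D^(n_{i_1}) ⋯`. Here
`σ^(n)` collects the coefficients of `D^(n)`. -/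
structure IsExpFamily {ι : Type*} (ρ : ι → PS) (ν : ι → N2) (σ : N2 → PS)
    (T : ℕ → Module.End ℝ PS) : Prop where
  hasSum_coeff : ∀ n, HasSum (fun i => open Classical in if ν i = n then ρ i else 0) (σ n)
  zero_one : T 0 1 = 1
  zero_mul : ∀ φ ψ, T 0 (φ * ψ) = T 0 φ * T 0 ψ
  recursion : ∀ k φ, HasSum (fun i => ρ i * T k (tiltGen (ν i) φ)) (((k : ℝ) + 1) • T (k + 1) φ)

namespace IsExpFamily

variable {ι : Type*} {ρ : ι → PS} {ν : ι → N2} {σ : N2 → PS} {T : ℕ → Module.End ℝ PS}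

theorem leibniz (h : IsExpFamily ρ ν σ T) (k : ℕ) (φ ψ : PS) :
    T k (φ * ψ) = ∑ p ∈ antidiagonal k, T p.1 φ * T p.2 ψ :=
  leibniz_of_recursion (fun i => isLeibniz_tiltGen (ν i)) (fun k => map_add (T k)) h.zero_mul
    h.recursion k φ ψ

theorem succ_eq_of_hasSum (h : IsExpFamily ρ ν σ T) {k : ℕ} {φ S : PS}
    (hS : HasSum (fun i => ρ i * T k (tiltGen (ν i) φ)) S) :
    T (k + 1) φ = ((k : ℝ) + 1)⁻¹ • S := by
  have h1 := (h.recursion k φ).unique hS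
  rw [← h1, smul_smul, inv_mul_cancel₀ (by positivity), one_smul]

theorem succ_one (h : IsExpFamily ρ ν σ T) (k : ℕ) : T (k + 1) 1 = 0 := by
  rw [h.succ_eq_of_hasSum (S := 0), smul_zero]
  refine hasSum_zero.of_eq fun i => ?_
  rw [(isLeibniz_tiltGen _).map_one, map_zero, mul_zero]

/-- The generators send z_n to 0 or 1, and all `T (k + 1)` kill constants, so only the first order
acts; it collects the coefficients of D^(n). -/
theorem succ_zn (h : IsExpFamily ρ ν σ T) (k : ℕ) (n : {n : N2 // n ≠ 0}) :
    T (k + 1) (zn n) = if k = 0 then σ n.1 else 0 := by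
  classical
  have h1 : HasSum (fun i => ρ i * T k (tiltGen (ν i) (zn n))) (σ n.1 * T k 1) := by
    refine ((h.hasSum_coeff n.1).mul_right (T k 1)).of_eq fun i => ?_
    split_ifs with hi
    · rw [hi, tiltGen_zn_self]
    · rw [tiltGen_zn_of_ne n hi, map_zero, mul_zero, MulZeroClass.zero_mul]
  rw [h.succ_eq_of_hasSum h1]
  cases k with
  | zero => simp [h.zero_one]
  | succ k => simp [h.succ_one]

/-- Among the generators only D^(0) acts on z_k, and it raises the index with factor k + 1.
Iteration turns these factors, divided by j!, into a binomial coefficient. -/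
theorem apply_zk (h : IsExpFamily ρ ν σ T) (j k : ℕ) :
    T j (zk k) = ((k + j).choose k : ℝ) • (σ 0 ^ j * T 0 (zk (k + j))) := by
  classical
  induction j generalizing k with
  | zero => simp
  | succ j ih =>
    have h1 : HasSum (fun i => ρ i * T j (tiltGen (ν i) (zk k)))
        (σ 0 * (((k : ℝ) + 1) • T j (zk (k + 1)))) := by
      refine ((h.hasSum_coeff 0).mul_right _).of_eq fun i => ?_
      split_ifs with hi
      · rw [hi, tiltGen_zero_zk, map_smul]
      · rw [tiltGen_zk_of_ne hi, map_zero, mul_zero, MulZeroClass.zero_mul]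
    rw [h.succ_eq_of_hasSum h1, ih, mul_smul_comm, mul_smul_comm, smul_smul, smul_smul, ← mul_assoc,
      ← pow_succ', show k + 1 + j = k + (j + 1) by ring]
    congr 1
    have h2 : (k + (j + 1)).choose (k + 1) * (k + 1) = (k + (j + 1)).choose k * (j + 1) := by
      rw [Nat.choose_succ_right_eq]
      congr 1
      omega
    have h3 : ((k + (j + 1)).choose (k + 1) : ℝ) * (k + 1) = (k + (j + 1)).choose k * (j + 1) := by
      exact_mod_cast h2
    field_simp
    linarith

/-- The sum over `k` of an exponential family. -/
theorem hasSum_zk (h : IsExpFamily ρ ν σ T) {Φ : PS → PS}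
    (hΦ : ∀ φ ∈ bddSeries, HasSum (fun k => T k φ) (Φ φ)) (k : ℕ) :
    HasSum (fun j => ((k + j).choose k : ℝ) • (σ 0 ^ j * T 0 (zk (k + j)))) (Φ (zk k)) :=
  (hΦ _ (X_mem_bddSeries _)).of_eq fun j => (h.apply_zk j k).symm

theorem sum_zn (h : IsExpFamily ρ ν σ T) {Φ : PS → PS}
    (hΦ : ∀ φ ∈ bddSeries, HasSum (fun k => T k φ) (Φ φ)) (n : {n : N2 // n ≠ 0}) :
    Φ (zn n) = T 0 (zn n) + σ n.1 := by
  refine (hΦ _ (X_mem_bddSeries _)).unique ?_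
  -- Only the orders 0 and 1 survive on z_n.
  have h1 := hasSum_sum_of_ne_finset_zero (L := .unconditional _) (f := fun k => T k (zn n))
    (s := Finset.range 2) (by
      intro k hk
      obtain ⟨l, rfl⟩ : ∃ l, k = l + 1 + 1 := ⟨k - 2, by simp at hk; omega⟩
      simp [h.succ_zn])
  rwa [Finset.sum_range_succ, Finset.sum_range_one, h.succ_zn, if_pos rfl] at h1

theorem sum_mul (h : IsExpFamily ρ ν σ T) {Φ : PS → PS}
    (hΦ : ∀ φ ∈ bddSeries, HasSum (fun k => T k φ) (Φ φ)) {φ ψ : PS} (hφ : φ ∈ bddSeries)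
    (hψ : ψ ∈ bddSeries) : Φ (φ * ψ) = Φ φ * Φ ψ :=
  (hΦ _ (mul_mem hφ hψ)).unique
    (((hΦ φ hφ).mul_antidiagonal (hΦ ψ hψ)).of_eq fun k => h.leibniz k φ ψ)

theorem sum_one (h : IsExpFamily ρ ν σ T) {Φ : PS → PS}
    (hΦ : ∀ φ ∈ bddSeries, HasSum (fun k => T k φ) (Φ φ)) : Φ 1 = 1 := by
  refine (hΦ _ (one_mem _)).unique ?_
  have := hasSum_single (f := fun k => T k 1) 0 (fun k hk => by
    obtain ⟨l, rfl⟩ := Nat.exists_eq_succ_of_ne_zero hk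
    exact h.succ_one l)
  rwa [h.zero_one] at this

theorem isTameHom (h : IsExpFamily ρ ν σ T) {X : Type*} {F : X → Module.End ℝ PS}
    (hF : IsLocFinite F) (hΦ : ∀ φ ∈ bddSeries, HasSum (fun k => T k φ) (famSum F φ))
    (hlevel : ∀ x N, ∀ φ ∈ level N, F x φ ∈ level N) : IsTameHom (famSum F) where
  map_one := h.sum_one hΦ
  map_mul _ hφ _ hψ := h.sum_mul hΦ hφ hψ
  map_add _ hφ _ hψ := hF.map_add hφ hψ
  map_smul c _ hφ := hF.map_smul c hφ
  mem_level N φ hφ := (hF.hasSum ⟨N, hφ⟩).mem_supported fun x => hlevel x N φ hφ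
  map_hasSum h hG := hF.map_hasSum h hG

end IsExpFamily

end

section

variable {len : N2 →+ ℝ}

/-! ### The exponential of the generators of shift -/

/-- The operator `h^k ∂_i^k / k!`. -/
def flowTerm (i : Fin 2) (h : ℝ) (k : ℕ) : Module.End ℝ PS :=
  (h ^ k * (k.factorial : ℝ)⁻¹) • shiftGen i ^ k

/-- The operator `h^m ∂^m / m!`. -/
def shiftTerm (h : Fin 2 → ℝ) (m : N2) : Module.End ℝ PS :=
  (hpow h m * (∏ i, ((m i).factorial : ℝ))⁻¹) • (shiftGen 0 ^ m 0 * shiftGen 1 ^ m 1)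

theorem shiftTerm_eq (h : Fin 2 → ℝ) (m : N2) :
    shiftTerm h m = flowTerm 0 (h 0) (m 0) * flowTerm 1 (h 1) (m 1) := by
  simp only [shiftTerm, flowTerm, hpow, Fin.prod_univ_two, smul_mul_smul_comm]
  congr 1
  rw [mul_inv]
  ring

/-- ∂^m raises the nonnegative length weight by |m|, so |m| is at most the weight of `β`. -/
theorem summable_shiftTerm (hlen : ∀ i : Fin 2, 0 < len (single i 1)) (h : Fin 2 → ℝ) (φ : PS) :
    Summable fun m => shiftTerm h m φ := by
  rw [summable_iff_coeff]
  intro β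
  refine (finite_len_le hlen (weight (lenWeight len) β)).subset fun m hm => ?_
  obtain ⟨γ, -, h2⟩ := ((isShiftGrading_len len).moves_shiftGen_pow m).smul
    (hpow h m * (∏ i, ((m i).factorial : ℝ))⁻¹) φ β hm
  have := weight_lenWeight_nonneg hlen γ
  show len m ≤ _
  linarith

theorem summable_flowTerm (i : Fin 2) (h : ℝ) (φ : PS) : Summable fun k => flowTerm i h k φ := by
  -- `flow` does not depend on a given length function. Any positive one proves summability; total
  -- degree is taken.
  let len : N2 →+ ℝ := ⟨⟨fun n => ((n 0 + n 1 : ℕ) : ℝ), by simp⟩, fun a b => by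
    simp only [Finsupp.add_apply]; push_cast; ring⟩
  have hlen : ∀ i : Fin 2, 0 < len (single i 1) := by
    intro i
    fin_cases i <;> simp [len]
  rw [summable_iff_coeff]
  intro β
  refine ((finite_len_le hlen (weight (lenWeight len) β)).preimage
    (f := fun k : ℕ => (single i k : N2)) (single_injective i).injOn).subset fun k hk => ?_
  obtain ⟨γ, -, h2⟩ := (((isShiftGrading_len len).moves_shiftGen i).pow k).smul
    (h ^ k * (k.factorial : ℝ)⁻¹) φ β hk
  have := weight_lenWeight_nonneg hlen γ
  show len (single i k) ≤ _
  have h3 : (single i k : N2) = k • single i 1 := by simp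
  rw [h3, map_nsmul]
  linarith

/-- The operator `exp(h ∂_i)`. -/
def flow (i : Fin 2) (h : ℝ) : Module.End ℝ PS := sumEnd (flowTerm i h) (summable_flowTerm i h)

/-- The operator `exp(h_1 ∂_1) exp(h_2 ∂_2)`. -/
def shiftExp (h : Fin 2 → ℝ) : Module.End ℝ PS := flow 0 (h 0) * flow 1 (h 1)

theorem flowTerm_zero (i : Fin 2) (h : ℝ) : flowTerm i h 0 = 1 := by
  simp [flowTerm]

theorem flowTerm_succ (i : Fin 2) (h : ℝ) (k : ℕ) (φ : PS) :
    ((k : ℝ) + 1) • flowTerm i h (k + 1) φ = h • flowTerm i h k (shiftGen i φ) := by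
  simp only [flowTerm, LinearMap.smul_apply, smul_smul, pow_succ, Module.End.mul_apply,
    Nat.factorial_succ]
  congr 1
  push_cast
  field_simp

/-- This is the general Leibniz recursion for a single derivation with constant coefficient `h`. -/
theorem flow_mul (i : Fin 2) (h : ℝ) (φ ψ : PS) : flow i h (φ * ψ) = flow i h φ * flow i h ψ := by
  refine (hasSum_sumEnd _ (summable_flowTerm i h) _).unique
    (((hasSum_sumEnd _ (summable_flowTerm i h) φ).mul_antidiagonal
      (hasSum_sumEnd _ (summable_flowTerm i h) ψ)).of_eq fun k => ?_)
  refine leibniz_of_recursion (ι := Unit) (ρ := fun _ => h • 1) (δ := fun _ => shiftGen i)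
    (fun _ => isLeibniz_shiftGen i) (T := fun k => flowTerm i h k) (fun k => map_add _)
    (fun φ ψ => by simp [flowTerm_zero]) (fun k φ => ?_) k φ ψ
  simp [flowTerm_succ]

theorem flow_one (i : Fin 2) (h : ℝ) : flow i h 1 = 1 := by
  refine (hasSum_sumEnd _ (summable_flowTerm i h) _).unique ?_
  have := hasSum_single (f := fun k => flowTerm i h k 1) 0 (fun k hk => by
    obtain ⟨l, rfl⟩ := Nat.exists_eq_succ_of_ne_zero hk
    rw [flowTerm, LinearMap.smul_apply, pow_succ (shiftGen i), Module.End.mul_apply,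
      (isLeibniz_shiftGen i).map_one, map_zero, smul_zero])
  simpa [flowTerm_zero] using this

theorem shiftExp_mul (h : Fin 2 → ℝ) (φ ψ : PS) :
    shiftExp h (φ * ψ) = shiftExp h φ * shiftExp h ψ := by
  simp [shiftExp, flow_mul]

theorem shiftExp_one (h : Fin 2 → ℝ) : shiftExp h 1 = 1 := by
  simp [shiftExp, flow_one]

theorem continuous_flowTerm (i : Fin 2) (h : ℝ) (k : ℕ) : Continuous (flowTerm i h k) :=
  (continuous_end_pow (continuous_shiftGen i) k).const_smul _

/-- The double sum over the two exponents factorizes, the inner one passing through the continuous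
operator `flowTerm 0`. Powers of the second derivation stand to the right on both sides, so no
commutation of the two shifts is needed. -/
theorem hasSum_shiftExp (hlen : ∀ i : Fin 2, 0 < len (single i 1)) (h : Fin 2 → ℝ) (φ : PS) :
    HasSum (fun m => shiftTerm h m φ) (shiftExp h φ) := by
  let e : ℕ × ℕ ≃ N2 := (finTwoArrowEquiv ℕ).symm.trans equivFunOnFinite.symm
  obtain ⟨S, hS⟩ := summable_shiftTerm hlen h φ
  have h1 : HasSum (fun p : ℕ × ℕ => flowTerm 0 (h 0) p.1 (flowTerm 1 (h 1) p.2 φ)) S := by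
    refine (e.hasSum_iff.2 hS).of_eq fun p => ?_
    simp [shiftTerm_eq, e, finTwoArrowEquiv]
  have h2 := h1.prod_fiberwise fun a =>
    (hasSum_sumEnd _ (summable_flowTerm 1 (h 1)) φ).map (flowTerm 0 (h 0) a)
      (continuous_flowTerm 0 (h 0) a)
  have h3 := h2.unique (hasSum_sumEnd _ (summable_flowTerm 0 (h 0)) _)
  rw [h3] at hS
  exact hS

/-! ### Linear series in the variables `z_n` -/

/-- The series `∑_{m ≠ 0} c_m z_m`. -/
def linSeries (c : N2 → ℝ) : PS := fun γ =>
  ∑ᶠ m : {m : N2 // m ≠ 0}, open Classical in if γ = single (Sum.inr m) 1 then c m.1 else 0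

theorem coeff_linSeries_single (c : N2 → ℝ) (m : {m : N2 // m ≠ 0}) :
    MvPowerSeries.coeff (single (Sum.inr m) 1) (linSeries c) = c m.1 := by
  classical
  refine (finsum_eq_single _ m fun n hn => if_neg fun h => hn ?_).trans (if_pos rfl)
  have := single_left_injective one_ne_zero h
  exact (Sum.inr_injective this).symm

theorem coeff_linSeries_eq_zero (c : N2 → ℝ) {γ : MIdx}
    (h : ∀ m : {m : N2 // m ≠ 0}, γ ≠ single (Sum.inr m) 1) :
    MvPowerSeries.coeff γ (linSeries c) = 0 := by
  classical
  refine (finsum_congr fun m => if_neg (h m)).trans ?_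
  simp

theorem coeff_zn (m n : {m : N2 // m ≠ 0}) : MvPowerSeries.coeff (single (Sum.inr m) 1) (zn n) =
    (open Classical in if n = m then 1 else 0 : ℝ) := by
  classical
  rw [MvPowerSeries.coeff_X]
  refine if_congr ⟨fun h => ?_, fun h => by rw [h]⟩ rfl rfl
  exact (Sum.inr_injective (single_left_injective one_ne_zero h)).symm

theorem coeff_zn_eq_zero (n : {m : N2 // m ≠ 0}) {γ : MIdx}
    (h : ∀ m : {m : N2 // m ≠ 0}, γ ≠ single (Sum.inr m) 1) :
    MvPowerSeries.coeff γ (zn n) = 0 := by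
  classical
  rw [MvPowerSeries.coeff_X, if_neg (h n)]

theorem hasSum_linSeries (c : N2 → ℝ) :
    HasSum (fun m : {m : N2 // m ≠ 0} => c m.1 • zn m) (linSeries c) := by
  classical
  rw [hasSum_iff]
  intro β
  by_cases h : ∃ m : {m : N2 // m ≠ 0}, β = single (Sum.inr m) 1
  · obtain ⟨m, rfl⟩ := h
    have h0 : ∀ n, n ≠ m → MvPowerSeries.coeff (single (Sum.inr m) 1) (c n.1 • zn n) = 0 := by
      intro n hn
      rw [map_smul, coeff_zn, if_neg hn, smul_zero]
    refine ⟨(Set.finite_singleton m).subset fun n hn => ?_, ?_⟩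
    · by_contra hc
      exact hn (h0 n hc)
    · rw [finsum_eq_single _ m h0, coeff_linSeries_single, map_smul, coeff_zn, if_pos rfl,
        smul_eq_mul, mul_one]
  · push Not at h
    have h0 : ∀ n, MvPowerSeries.coeff β (c n.1 • zn n) = 0 := by
      intro n
      rw [map_smul, coeff_zn_eq_zero n h, smul_zero]
    refine ⟨?_, ?_⟩
    · simp only [h0]
      simp
    · simp only [h0]
      rw [coeff_linSeries_eq_zero c h, finsum_zero]

/-- The variable `z_n`, with the convention `z_0 = 0`. -/
def znTotal (n : N2) : PS := open Classical in if h : n ≠ 0 then zn ⟨n, h⟩ else 0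

theorem znTotal_zero : znTotal 0 = 0 := by simp [znTotal]

theorem znTotal_of_ne {n : N2} (h : n ≠ 0) : znTotal n = zn ⟨n, h⟩ := by simp [znTotal, h]

theorem znTotal_coe (n : {n : N2 // n ≠ 0}) : znTotal n.1 = zn n := znTotal_of_ne n.2

theorem hasSum_linSeries_total (c : N2 → ℝ) :
    HasSum (fun m => c m • znTotal m) (linSeries c) := by
  have h := hasSum_linSeries c
  have hi : Function.Injective (Subtype.val : {m : N2 // m ≠ 0} → N2) := Subtype.val_injective
  refine (hi.hasSum_iff fun m hm => ?_).1 (h.of_eq fun m => ?_)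
  · have h0 : m = 0 := by
      by_contra hc
      exact hm ⟨⟨m, hc⟩, rfl⟩
    rw [h0, znTotal_zero, smul_zero]
  · simp [znTotal_coe]

/-- The case n = 0 is a true exception: the left side would be 0 and the right side z_{e_i}. It
accounts for the subtracted constant in `coeffShift_genericP`. -/
theorem shiftGen_znTotal (i : Fin 2) {n : N2} (hn : n ≠ 0) :
    shiftGen i (znTotal n) = ((n i : ℝ) + 1) • znTotal (n + single i 1) := by
  rw [znTotal_of_ne hn, shiftGen_zn, znTotal_of_ne (add_single_ne_zero n i)]

theorem shiftGen_pow_znTotal (i : Fin 2) {n : N2} (hn : n ≠ 0) (k : ℕ) :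
    (k.factorial : ℝ)⁻¹ • (shiftGen i ^ k) (znTotal n) =
      ((n i + k).choose k : ℝ) • znTotal (n + single i k) := by
  induction k with
  | zero => simp
  | succ k ih =>
    have hne : n + single i k ≠ 0 := fun h => hn (by
      have := add_eq_zero.1 h
      exact this.1)
    have h1 : ((k + 1).factorial : ℝ)⁻¹ • (shiftGen i ^ (k + 1)) (znTotal n) =
        ((k : ℝ) + 1)⁻¹ • shiftGen i ((k.factorial : ℝ)⁻¹ • (shiftGen i ^ k) (znTotal n)) := by
      rw [pow_succ', Module.End.mul_apply, map_smul, smul_smul, Nat.factorial_succ]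
      push_cast
      rw [mul_inv]
    rw [h1, ih, map_smul, shiftGen_znTotal i hne, smul_smul, smul_smul, add_assoc, ← single_add]
    congr 1
    have h2 := Nat.add_one_mul_choose_eq (n i + k) k
    have h3 : ((n i + k : ℝ) + 1) * (n i + k).choose k = (n i + k + 1).choose (k + 1) * (k + 1) := by
      exact_mod_cast h2
    simp only [Finsupp.add_apply, single_eq_same]
    rw [← add_assoc]
    field_simp
    push_cast
    linarith

theorem hpow_zero (h : Fin 2 → ℝ) : hpow h 0 = 1 := by simp [hpow]

theorem hpow_add (h : Fin 2 → ℝ) (m n : N2) : hpow h (m + n) = hpow h m * hpow h n := by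
  simp [hpow, pow_add, Finset.prod_mul_distrib]

theorem binom_self (n : N2) : binom n n = 1 := by simp [binom]

theorem shiftTerm_znTotal (h : Fin 2 → ℝ) {n : N2} (hn : n ≠ 0) (m : N2) :
    shiftTerm h m (znTotal n) = (binom (n + m) n * hpow h m) • znTotal (n + m) := by
  have hne : n + single 1 (m 1) ≠ 0 := fun h => hn (add_eq_zero.1 h).1
  have e1 : shiftTerm h m (znTotal n) = hpow h m • (((m 0).factorial : ℝ)⁻¹ •
      (shiftGen 0 ^ m 0) (((m 1).factorial : ℝ)⁻¹ • (shiftGen 1 ^ m 1) (znTotal n))) := by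
    simp only [shiftTerm, LinearMap.smul_apply, Module.End.mul_apply, map_smul, smul_smul,
      Fin.prod_univ_two, mul_inv]
  have e2 : n + single 1 (m 1) + single 0 (m 0) = n + m := by
    ext i
    fin_cases i <;> simp
  rw [e1, shiftGen_pow_znTotal 1 hn, map_smul,
    smul_comm ((m 0).factorial : ℝ)⁻¹, shiftGen_pow_znTotal 0 hne, e2,
    smul_smul, smul_smul]
  congr 1
  simp only [binom, Fin.prod_univ_two, Finsupp.add_apply]
  rw [Nat.choose_symm_add (a := n 0), Nat.choose_symm_add (a := n 1)]
  push_cast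
  simp
  ring

open Classical in
/-- The series `∑_{m > n} binom(m, n) h^{m-n} z_m`. -/
def shiftPart (h : Fin 2 → ℝ) (n : N2) : PS :=
  linSeries fun m => if n < m then (binom m n : ℝ) * hpow h (m - n) else 0

/-- The terms h^m ∂^m z_n / m! run through the binomial multiples of z_{n+m}. The term m = 0 is z_n
itself, and the others make up `shiftPart`. -/
theorem shiftExp_zn (hlen : ∀ i : Fin 2, 0 < len (single i 1)) (h : Fin 2 → ℝ)
    (n : {n : N2 // n ≠ 0}) : shiftExp h (zn n) = zn n + shiftPart h n.1 := by
  classical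
  have h1 : HasSum (fun m => (if n.1 ≤ m then (binom m n.1 : ℝ) * hpow h (m - n.1) else 0) •
      znTotal m) (znTotal n.1 + shiftPart h n.1) := by
    have e := hasSum_single (f := fun m => (if m = n.1 then (1 : ℝ) else 0) • znTotal m) n.1
      (fun m hm => by simp [hm])
    rw [if_pos rfl, one_smul] at e
    refine (e.add (hasSum_linSeries_total _)).of_eq fun m => ?_
    rw [← add_smul]
    congr 1
    rcases eq_or_ne m n.1 with rfl | hm
    · simp [binom_self, hpow_zero]
    · rw [if_neg hm, zero_add]
      refine if_congr ⟨fun h => lt_of_le_of_ne h hm.symm, fun h => h.le⟩ rfl rfl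
  have hi : Function.Injective fun m : N2 => n.1 + m := add_right_injective n.1
  rw [← znTotal_coe]
  refine (hasSum_shiftExp hlen h _).unique (((hi.hasSum_iff fun m hm => ?_).2 h1).of_eq fun m => ?_)
  · rw [if_neg, zero_smul]
    intro hle
    obtain ⟨c, rfl⟩ := exists_add_of_le hle
    exact hm ⟨c, rfl⟩
  · rw [shiftTerm_znTotal h n.2]
    simp

end

section

variable {len : N2 →+ ℝ}

/-! ### The shift of `z_k` -/

/-- Formal power series in `x` with coefficients in `ℝ[[z_k, z_n]]`. -/
abbrev XPS : Type := MvPowerSeries (Fin 2) PS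

/-- The generic series `p(x) = ∑_{n ≠ 0} z_n x^n`. -/
def genericP : XPS := fun n => znTotal n

theorem coeff_genericP (n : N2) : MvPowerSeries.coeff n genericP = znTotal n := rfl

/-- p(x) has no constant term, so p^l starts in degree l. This is why truncations in l are harmless
for each coefficient in x. -/
theorem coeff_genericP_pow_eq_zero {n : N2} {l : ℕ} (h : n.degree < l) :
    MvPowerSeries.coeff n (genericP ^ l) = 0 := by
  refine MvPowerSeries.coeff_eq_zero_of_constantCoeff_nilpotent (m := 1) ?_ (by omega)
  rw [pow_one, ← MvPowerSeries.coeff_zero_eq_constantCoeff_apply, coeff_genericP, znTotal_zero]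

/-- The derivation `∂_i` applied to the coefficients of a series in `x`. -/
def coeffShift (i : Fin 2) : XPS →+ XPS where
  toFun w := fun m => shiftGen i (MvPowerSeries.coeff m w)
  map_zero' := by
    funext m
    exact map_zero (shiftGen i)
  map_add' v w := by
    funext m
    exact map_add (shiftGen i) _ _

theorem coeff_coeffShift (i : Fin 2) (w : XPS) (m : N2) :
    MvPowerSeries.coeff m (coeffShift i w) = shiftGen i (MvPowerSeries.coeff m w) := rfl

theorem coeffShift_mul (i : Fin 2) (v w : XPS) :
    coeffShift i (v * w) = coeffShift i v * w + v * coeffShift i w := by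
  classical
  ext1 m
  rw [coeff_coeffShift, map_add, MvPowerSeries.coeff_mul, MvPowerSeries.coeff_mul,
    MvPowerSeries.coeff_mul, map_sum, ← Finset.sum_add_distrib]
  exact Finset.sum_congr rfl fun p _ => isLeibniz_shiftGen i _ _

theorem coeffShift_C (i : Fin 2) (φ : PS) :
    coeffShift i (MvPowerSeries.C φ) = MvPowerSeries.C (shiftGen i φ) := by
  classical
  ext1 m
  rw [coeff_coeffShift, MvPowerSeries.coeff_C, MvPowerSeries.coeff_C]
  split_ifs
  · rfl
  · exact map_zero _

theorem coeffShift_pow_succ (i : Fin 2) (w : XPS) (l : ℕ) :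
    coeffShift i (w ^ (l + 1)) = (l + 1 : ℕ) * (w ^ l * coeffShift i w) := by
  induction l with
  | zero => simp
  | succ l ih =>
    rw [pow_succ, coeffShift_mul, ih]
    push_cast
    ring

theorem coeffShift_genericP (i : Fin 2) : coeffShift i genericP =
    MvPowerSeries.pderiv PS i genericP - MvPowerSeries.C (znTotal (single i 1)) := by
  classical
  ext1 m
  rw [coeff_coeffShift, map_sub, MvPowerSeries.coeff_pderiv, MvPowerSeries.coeff_C, coeff_genericP,
    coeff_genericP]
  rcases eq_or_ne m 0 with rfl | hm
  · rw [if_pos rfl, znTotal_zero, map_zero]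
    simp
  · rw [if_neg hm, shiftGen_znTotal i hm, MvPowerSeries.smul_eq_C_mul, sub_zero, mul_comm]
    simp

/-- The `l`-th summand of the `k`-th coefficient of `a(· + p(x))`. -/
def genericTerm (k l : ℕ) : XPS :=
  MvPowerSeries.C (((k + l).choose k : ℝ) • zk (k + l)) * genericP ^ l

/-- Up to a boundary term, ∂_i acts on a(· + p(x)) as differentiation in x_i. On p it differs from
that by -z_{e_i}, on z_{k+l} it produces a factor z_{e_i}, and these two contributions telescope in
l; only the last one remains. -/
theorem coeffShift_sum_genericTerm (i : Fin 2) (k L : ℕ) :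
    coeffShift i (∑ l ∈ Finset.range (L + 1), genericTerm k l) =
      MvPowerSeries.pderiv PS i (∑ l ∈ Finset.range (L + 1), genericTerm k l) +
        MvPowerSeries.C ((((k + L + 1 : ℕ) : ℝ) * (k + L).choose k) • zk (k + L + 1)) *
          MvPowerSeries.C (znTotal (single i 1)) * genericP ^ L := by
  have hz : ∀ l, coeffShift i (MvPowerSeries.C (((k + l).choose k : ℝ) • zk (k + l))) =
      MvPowerSeries.C ((((k + l + 1 : ℕ) : ℝ) * (k + l).choose k) • zk (k + l + 1)) *
          MvPowerSeries.C (znTotal (single i 1)) := by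
    intro l
    rw [coeffShift_C, map_smul, shiftGen_zk, ← map_mul, znTotal_of_ne (by simp), smul_smul,
      smul_mul_assoc]
    congr 2
    push_cast
    ring
  induction L with
  | zero =>
    rw [Finset.sum_range_one, genericTerm, pow_zero, mul_one, hz, MvPowerSeries.pderiv_C, zero_add,
      mul_one, add_zero]
  | succ L ih =>
    rw [Finset.sum_range_succ, map_add, ih, map_add]
    have h1 : MvPowerSeries.pderiv PS i (genericTerm k (L + 1)) =
        MvPowerSeries.C (((k + (L + 1)).choose k : ℝ) • zk (k + (L + 1))) *
          (((L + 1 : ℕ) : XPS) * (genericP ^ L * MvPowerSeries.pderiv PS i genericP)) := by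
      rw [genericTerm, Derivation.leibniz, MvPowerSeries.pderiv_C, smul_zero, add_zero,
        MvPowerSeries.pderiv_pow, smul_eq_mul, Nat.add_sub_cancel]
      ring
    have h2 : coeffShift i (genericTerm k (L + 1)) =
        MvPowerSeries.C ((((k + (L + 1) + 1 : ℕ) : ℝ) * (k + (L + 1)).choose k) •
          zk (k + (L + 1) + 1)) * MvPowerSeries.C (znTotal (single i 1)) * genericP ^ (L + 1) +
        MvPowerSeries.C (((k + (L + 1)).choose k : ℝ) • zk (k + (L + 1))) *
          (((L + 1 : ℕ) : XPS) * (genericP ^ L * (MvPowerSeries.pderiv PS i genericP -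
            MvPowerSeries.C (znTotal (single i 1))))) := by
      rw [genericTerm, coeffShift_mul, hz, coeffShift_pow_succ, coeffShift_genericP]
    -- Since (k+L+1) C(k+L, k) = (L+1) C(k+L+1, k), the former boundary term cancels the one with
    -- -z_{e_i} from the new summand.
    have h3 : (MvPowerSeries.C ((((k + L + 1 : ℕ) : ℝ) * (k + L).choose k) • zk (k + L + 1)) : XPS) =
        ((L + 1 : ℕ) : XPS) * MvPowerSeries.C (((k + (L + 1)).choose k : ℝ) • zk (k + (L + 1))) := by
      have h4 := Nat.add_one_mul_choose_eq (k + L) L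
      rw [← Nat.choose_symm_add, add_assoc, ← Nat.choose_symm_add, mul_comm _ (L + 1)] at h4
      have h5 : (((k + L + 1 : ℕ) : ℝ) * (k + L).choose k) • zk (k + L + 1) =
          ((L + 1 : ℕ) : PS) * (((k + (L + 1)).choose k : ℝ) • zk (k + (L + 1))) := by
        rw [mul_smul_comm, ← nsmul_eq_mul (L + 1) (zk _), ← Nat.cast_smul_eq_nsmul ℝ, smul_smul,
          add_assoc,
          mul_comm (((k + (L + 1)).choose k : ℕ) : ℝ)]
        congr 1
        exact_mod_cast h4
      rw [h5, map_mul, map_natCast]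
    rw [h1, h2, h3]
    ring

/-- The coefficient of `x^m` in the `k`-th coefficient of `a(· + p(x))`. -/
def genericCoeff (k : ℕ) (m : N2) : PS :=
  MvPowerSeries.coeff m (∑ l ∈ Finset.range (m.degree + 1), genericTerm k l)

theorem coeff_genericTerm (k l : ℕ) (m : N2) : MvPowerSeries.coeff m (genericTerm k l) =
    ((k + l).choose k : ℝ) • (MvPowerSeries.coeff m (genericP ^ l) * zk (k + l)) := by
  rw [genericTerm, MvPowerSeries.coeff_C_mul, smul_mul_assoc, mul_comm]

theorem genericCoeff_eq (k : ℕ) {m : N2} {L : ℕ} (hL : m.degree ≤ L) :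
    genericCoeff k m = MvPowerSeries.coeff m (∑ l ∈ Finset.range (L + 1), genericTerm k l) := by
  rw [genericCoeff, map_sum, map_sum]
  refine Finset.sum_subset (Finset.range_mono (by omega)) fun l _ hl => ?_
  rw [coeff_genericTerm, coeff_genericP_pow_eq_zero (by simpa using hl), zero_mul, smul_zero]

theorem shiftGen_genericCoeff (i : Fin 2) (k : ℕ) (m : N2) :
    shiftGen i (genericCoeff k m) = ((m i : ℝ) + 1) • genericCoeff k (m + single i 1) := by
  have hdeg : (m + single i 1).degree = m.degree + 1 := by simp
  -- Truncation at `m.degree + 1` is exact for both `m` and `m + single i 1`, and the boundary term,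
  -- a multiple of p^{m.degree+1}, has no coefficient at `m`.
  rw [genericCoeff_eq k (L := m.degree + 1) (by omega), ← coeff_coeffShift,
    coeffShift_sum_genericTerm, map_add, ← map_mul, MvPowerSeries.coeff_C_mul,
    coeff_genericP_pow_eq_zero (by omega), mul_zero, add_zero, MvPowerSeries.coeff_pderiv,
    ← genericCoeff_eq k hdeg.le, MvPowerSeries.smul_eq_C_mul, mul_comm]
  simp

/-- Starting from exponent zero in direction `i`, the successive factors are 1, …, a. -/
theorem shiftGen_pow_genericCoeff (i : Fin 2) (k : ℕ) (m : N2) (hm : m i = 0) (a : ℕ) :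
    (shiftGen i ^ a) (genericCoeff k m) = (a.factorial : ℝ) • genericCoeff k (m + single i a) := by
  induction a with
  | zero => simp
  | succ a ih =>
    rw [pow_succ', Module.End.mul_apply, ih, map_smul, shiftGen_genericCoeff, smul_smul,
          add_assoc,
      ← single_add, Nat.factorial_succ]
    congr 1
    simp only [Finsupp.add_apply, hm, single_eq_same]
    push_cast
    ring

theorem genericCoeff_zero (k : ℕ) : genericCoeff k 0 = zk k := by
  simp [genericCoeff, coeff_genericTerm]

theorem shiftTerm_zk (h : Fin 2 → ℝ) (k : ℕ) (m : N2) :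
    shiftTerm h m (zk k) = hpow h m • genericCoeff k m := by
  have e2 : (0 + single 1 (m 1) + single 0 (m 0) : N2) = m := by
    ext i
    fin_cases i <;> simp
  rw [shiftTerm, LinearMap.smul_apply, Module.End.mul_apply, ← genericCoeff_zero,
    shiftGen_pow_genericCoeff 1 k 0 rfl, map_smul, shiftGen_pow_genericCoeff 0 k _ (by simp), e2,
    smul_smul, smul_smul, Fin.prod_univ_two]
  congr 1
  have h0 : ((m 0).factorial : ℝ) ≠ 0 := by positivity
  have h1 : ((m 1).factorial : ℝ) ≠ 0 := by positivity
  field_simp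

theorem shiftPart_zero (h : Fin 2 → ℝ) : shiftPart h 0 = linSeries (hpow h) := by
  classical
  refine (hasSum_linSeries _).unique ((hasSum_linSeries _).of_eq fun m => ?_)
  have : (0 : N2) < m.1 := pos_iff_ne_zero.2 m.2
  simp [this, binom]

/-- This is substitution of x = h into p(x)^l, which respects products because h^m is multiplicative
in m; p(h) is `shiftPart h 0`. -/
theorem hasSum_genericP_pow (h : Fin 2 → ℝ) (l : ℕ) :
    HasSum (fun m => hpow h m • MvPowerSeries.coeff m (genericP ^ l)) (shiftPart h 0 ^ l) := by
  classical
  induction l with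
  | zero =>
    have := hasSum_single (f := fun m => hpow h m • MvPowerSeries.coeff m (genericP ^ 0)) 0
      (fun m hm => by rw [pow_zero, MvPowerSeries.coeff_one, if_neg hm, smul_zero])
    simpa [hpow_zero] using this
  | succ l ih =>
    have h1 : HasSum (fun m => hpow h m • MvPowerSeries.coeff m genericP) (shiftPart h 0) := by
      rw [shiftPart_zero]
      exact hasSum_linSeries_total _
    rw [pow_succ]
    refine (ih.mul_antidiagonal h1).of_eq fun m => ?_
    rw [MvPowerSeries.coeff_mul, Finset.smul_sum]
    refine Finset.sum_congr rfl fun p hp => ?_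
    rw [smul_mul_smul_comm, ← hpow_add, mem_antidiagonal.1 hp]

/-- Consider the double series over (l, m) of C(k+l, k) h^m z_{k+l} times the x^m-coefficient of
p^l. Summed first over m it is the translate by p(h); summed first over l it is, by `shiftTerm_zk`,
the shift exponential of z_k. -/
theorem shiftExp_zk (hlen : ∀ i : Fin 2, 0 < len (single i 1)) (h : Fin 2 → ℝ) (k : ℕ) :
    shiftExp h (zk k) = translate k (shiftPart h 0) := by
  let F : ℕ × N2 → PS := fun p => ((k + p.1).choose k : ℝ) •
    ((hpow h p.2 • MvPowerSeries.coeff p.2 (genericP ^ p.1)) * zk (k + p.1))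
  have hfib : ∀ l, HasSum (fun m => F (l, m))
      (((k + l).choose k : ℝ) • (shiftPart h 0 ^ l * zk (k + l))) := fun l =>
    ((hasSum_genericP_pow h l).mul_right _).const_smul _
  have hF : Summable F := by
    rw [summable_iff_coeff]
    intro β
    have h2 : {l : ℕ | Sum.inl (k + l) ∈ β.support}.Finite :=
      β.support.finite_toSet.preimage (f := fun l : ℕ => (Sum.inl (k + l) : Idx))
        (fun _ _ _ _ h => by simpa using h)
    refine (h2.biUnion fun l _ => ((hfib l).finite_coeff β).image fun m => (l, m)).subset
      fun p hp => ?_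
    refine Set.mem_biUnion (x := p.1) ?_ ⟨p.2, hp, rfl⟩
    show Sum.inl (k + p.1) ∈ β.support
    rw [Finsupp.mem_support_iff]
    intro h0
    apply hp
    simp only [F]
    rw [map_smul, coeff_mul_X_eq_zero _ h0, smul_zero]
  obtain ⟨S, hS⟩ := hF
  have h1 := (hS.prod_fiberwise hfib).unique (hasSum_translate k _)
  have h2 := (Equiv.prodComm N2 ℕ).hasSum_iff.2 hS
  rw [← h1]
  refine (hasSum_shiftExp hlen h _).unique ((h2.prod_fiberwise fun m => ?_).of_eq
    fun m => shiftTerm_zk h k m)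
  have h3 := hasSum_sum_of_ne_finset_zero (L := .unconditional _)
    (f := fun l => hpow h m • MvPowerSeries.coeff m (genericTerm k l))
    (s := Finset.range (m.degree + 1)) (fun l hl => by
      rw [coeff_genericTerm, coeff_genericP_pow_eq_zero (by simpa using hl), zero_mul, smul_zero,
        smul_zero])
  rw [← Finset.smul_sum, ← map_sum] at h3
  refine h3.of_eq fun l => ?_
  simp only [Function.comp_apply, Equiv.prodComm_apply, Prod.swap_prod_mk, F]
  rw [coeff_genericTerm, smul_mul_assoc, smul_comm]

end

section

variable {α : ℝ} {len : N2 →+ ℝ}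

/-! ### Characters of `T^+` -/

theorem Z_add (x y : JIdx α len) : Z (x + y) = Z x * Z y := by
  simp [Z, AddMonoidAlgebra.single_mul_single]

theorem character_apply_Z (f : Character α len) (x : JIdx α len) :
    f (Z x) = hpow (shift f) x.2 * x.1.prod fun y c => tilt f y ^ c := by
  obtain ⟨J, m⟩ := x
  have h1 : f (Z (0, m)) = hpow (shift f) m := by
    induction m using finsupp_induction_add_single with
    | zero => rw [hpow_zero, ← map_one f]; rfl
    | step m i ih =>
      have : ((0, m + single i 1) : JIdx α len) = (0, m) + (0, single i 1) := by simp
      rw [this, Z_add, map_mul, ih, hpow_add]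
      congr 1
      rw [hpow, Finset.prod_eq_single i (fun j _ hj => by simp [hj]) (by simp)]
      simp [shift]
  have h2 : f (Z (J, 0)) = J.prod fun y c => tilt f y ^ c := by
    induction J using finsupp_induction_add_single with
    | zero => rw [Finsupp.prod_zero_index, ← map_one f]; rfl
    | step J y ih =>
      classical
      have : ((J + single y 1, 0) : JIdx α len) = (J, 0) + (single y 1, 0) := by simp
      rw [this, Z_add, map_mul, ih, Finsupp.prod_add_index' (fun _ => pow_zero _)
        (fun _ _ _ => pow_add _ _ _), prod_single_index (h := fun y c => tilt f y ^ c) (pow_zero _),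
        pow_one]
      rfl
  have h3 : ((J, m) : JIdx α len) = (0, m) + (J, 0) := by simp
  rw [h3, Z_add, map_mul, h1, h2]
  simp

/-- The character with given shift and tilt coefficients. -/
def charOf (h : Fin 2 → ℝ) (t : TiltIdx α len → ℝ) : Character α len :=
  AddMonoidAlgebra.lift ℝ ℝ (JIdx α len)
    { toFun := fun x => hpow h x.toAdd.2 * x.toAdd.1.prod fun y c => t y ^ c
      map_one' := by simp [hpow_zero]
      map_mul' := fun x y => by
        classical
        simp only [toAdd_mul, Prod.fst_add, Prod.snd_add, hpow_add]
        rw [Finsupp.prod_add_index' (fun _ => pow_zero _) (fun _ _ _ => pow_add _ _ _)]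
        ring }

theorem charOf_Z (h : Fin 2 → ℝ) (t : TiltIdx α len → ℝ) (x : JIdx α len) :
    charOf h t (Z x) = hpow h x.2 * x.1.prod fun y c => t y ^ c := by
  rw [charOf, Z, AddMonoidAlgebra.lift_single, one_smul]
  rfl

theorem shift_charOf (h : Fin 2 → ℝ) (t : TiltIdx α len → ℝ) : shift (charOf h t) = h := by
  funext i
  rw [shift, charOf_Z, hpow, Finset.prod_eq_single i (fun j _ hj => by simp [hj]) (by simp)]
  simp

theorem tilt_charOf (h : Fin 2 → ℝ) (t : TiltIdx α len → ℝ) : tilt (charOf h t) = t := by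
  funext y
  rw [tilt, charOf_Z, prod_single_index (h := fun y c => t y ^ c) (pow_zero _), hpow_zero]
  simp

theorem character_ext {f g : Character α len} (h1 : shift f = shift g) (h2 : tilt f = tilt g) :
    f = g := by
  have h : ∀ x, f (Z x) = g (Z x) := fun x => by
    rw [character_apply_Z, character_apply_Z, h1, h2]
  exact AddMonoidAlgebra.algHom_ext h (AlgHom.ext fun c => by simp)

theorem bijective_shift_tilt :
    Function.Bijective (fun f : Character α len => (shift f, tilt f)) := by
  refine ⟨fun f g h => ?_, fun ⟨h, t⟩ => ⟨charOf h t, ?_⟩⟩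
  · exact character_ext (congrArg Prod.fst h) (congrArg Prod.snd h)
  · simp only [shift_charOf, tilt_charOf]

/-! ### The series `π^(n)` -/

open Classical in
/-- The series `∑_γ t_γ^(n) z^γ` over `[γ] ≥ 0`, `|γ| > |n|`. -/
def tiltPart (t : TiltIdx α len → ℝ) (n : N2) : PS := fun γ =>
  if hγ : 0 ≤ bracket γ ∧ len n < homog α len γ then t ⟨(γ, n), hγ⟩ else 0

theorem coeff_tiltPart (t : TiltIdx α len → ℝ) {n : N2} {γ : MIdx}
    (hγ : 0 ≤ bracket γ ∧ len n < homog α len γ) :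
    MvPowerSeries.coeff γ (tiltPart t n) = t ⟨(γ, n), hγ⟩ := by
  exact dif_pos hγ

theorem coeff_tiltPart_eq_zero (t : TiltIdx α len → ℝ) {n : N2} {γ : MIdx}
    (hγ : ¬ (0 ≤ bracket γ ∧ len n < homog α len γ)) :
    MvPowerSeries.coeff γ (tiltPart t n) = 0 := by
  exact dif_neg hγ

/-- The multi-indices `γ` with `[γ] ≥ 0` and `|γ| > |n|`. -/
def tiltSupport (α : ℝ) (len : N2 →+ ℝ) (n : N2) : Set MIdx :=
  {γ | 0 ≤ bracket γ ∧ len n < homog α len γ}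

theorem tiltPart_mem (t : TiltIdx α len → ℝ) (n : N2) :
    tiltPart t n ∈ supported (tiltSupport α len n) := by
  intro γ h
  by_contra hc
  exact h (coeff_tiltPart_eq_zero t hc)

theorem tiltSeries_eq (f : Character α len) (n : N2) :
    tiltSeries f n = tiltPart (tilt f) n + shiftPart (shift f) n := by
  classical
  ext γ
  rw [map_add]
  refine congrArg (MvPowerSeries.coeff γ (tiltPart (tilt f) n) + ·)
    (finsum_congr fun m => ?_)
  rw [ite_and]

theorem hasSum_tiltPart (t : TiltIdx α len → ℝ) (n : N2) :
    HasSum (fun y : TiltIdx α len => open Classical in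
      if y.1.2 = n then t y • zpow y.1.1 else 0) (tiltPart t n) := by
  classical
  rw [hasSum_iff]
  intro β
  have key : ∀ y : TiltIdx α len, ¬ (y.1.1 = β ∧ y.1.2 = n) →
      MvPowerSeries.coeff β (if y.1.2 = n then t y • zpow y.1.1 else 0) = 0 := by
    intro y hy
    split_ifs with h
    · rw [map_smul, MvPowerSeries.coeff_monomial_ne, smul_zero]
      exact fun h' => hy ⟨h'.symm, h⟩
    · exact map_zero _
  by_cases hγ : 0 ≤ bracket β ∧ len n < homog α len β
  · have key' : ∀ y : TiltIdx α len, y ≠ ⟨(β, n), hγ⟩ →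
        MvPowerSeries.coeff β (if y.1.2 = n then t y • zpow y.1.1 else 0) = 0 :=
      fun y hy => key y fun h => hy (Subtype.ext (Prod.ext h.1 h.2))
    refine ⟨(Set.finite_singleton (⟨(β, n), hγ⟩ : TiltIdx α len)).subset fun y hy => ?_, ?_⟩
    · by_contra hc
      exact hy (key' y hc)
    · rw [finsum_eq_single _ _ key', coeff_tiltPart t hγ]
      simp
  · have key' : ∀ y : TiltIdx α len,
        MvPowerSeries.coeff β (if y.1.2 = n then t y • zpow y.1.1 else 0) = 0 := by
      intro y
      refine key y ?_
      rintro ⟨rfl, rfl⟩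
      exact hγ y.2
    simp only [key']
    exact ⟨by simp, by rw [coeff_tiltPart_eq_zero t hγ, finsum_zero]⟩

theorem exists_of_coeff_shiftPart_ne_zero {h : Fin 2 → ℝ} {n : N2} {γ : MIdx}
    (hγ : MvPowerSeries.coeff γ (shiftPart h n) ≠ 0) :
    ∃ m : {m : N2 // m ≠ 0}, γ = single (Sum.inr m) 1 ∧ n < m.1 := by
  classical
  by_cases hc : ∃ m : {m : N2 // m ≠ 0}, γ = single (Sum.inr m) 1
  · obtain ⟨m, rfl⟩ := hc
    refine ⟨m, rfl, ?_⟩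
    by_contra hlt
    exact hγ (by rw [shiftPart, coeff_linSeries_single, if_neg hlt])
  · push Not at hc
    exact absurd (coeff_linSeries_eq_zero _ hc) hγ

theorem shiftPart_mem_tstar (h : Fin 2 → ℝ) (n : N2) : shiftPart h n ∈ Tstar := by
  intro γ hγ
  obtain ⟨m, rfl, -⟩ := exists_of_coeff_shiftPart_ne_zero hγ
  exact Or.inr ⟨m, rfl⟩

theorem tiltPart_mem_tstar (t : TiltIdx α len → ℝ) (n : N2) : tiltPart t n ∈ Tstar :=
  fun γ h => Or.inl (tiltPart_mem t n γ h).1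

theorem tiltSeries_mem_tstar (f : Character α len) (n : N2) : tiltSeries f n ∈ Tstar := by
  rw [tiltSeries_eq]
  exact add_mem (tiltPart_mem_tstar _ _) (shiftPart_mem_tstar _ _)

theorem len_lt_of_coeff_tiltSeries (hlen : ∀ i : Fin 2, 0 < len (single i 1))
    {f : Character α len} {n : N2} {γ : MIdx}
    (h : MvPowerSeries.coeff γ (tiltSeries f n) ≠ 0) : len n < homog α len γ := by
  by_cases h1 : MvPowerSeries.coeff γ (tiltPart (tilt f) n) = 0
  · rw [tiltSeries_eq, map_add, h1, zero_add] at h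
    obtain ⟨m, rfl, hm⟩ := exists_of_coeff_shiftPart_ne_zero h
    rw [homog_single_inr]
    exact len_lt_len hlen hm
  · exact (tiltPart_mem _ _ γ h1).2

theorem finite_len_lt_homog (hlen : ∀ i : Fin 2, 0 < len (single i 1)) (β : MIdx) :
    {n : N2 | ∃ γ ≤ β, len n < homog α len γ}.Finite := by
  refine ((Set.finite_Iic β).biUnion fun γ _ => finite_len_le hlen (homog α len γ)).subset ?_
  rintro n ⟨γ, hγ, h⟩
  exact Set.mem_biUnion (Set.mem_Iic.2 hγ) h.le

/-! ### Finiteness of the sums -/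

theorem finite_tiltIdx (hlen : ∀ i : Fin 2, 0 < len (single i 1)) (β : MIdx) :
    {y : TiltIdx α len | y.1.1 ≤ β}.Finite := by
  refine (((Set.finite_Iic β).prod (finite_len_lt_homog (α := α) hlen β)).preimage
    (f := fun y : TiltIdx α len => y.1) Subtype.val_injective.injOn).subset fun y hy => ?_
  exact ⟨hy, y.1.1, hy, y.2.2⟩

theorem le_tiltExp {J : TiltIdx α len →₀ ℕ} {y : TiltIdx α len} (hy : J y ≠ 0) :
    y.1.1 ≤ tiltExp J := by
  classical
  have h : J = (J - single y 1) + single y 1 := by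
    ext z
    rcases eq_or_ne z y with rfl | hz
    · simp; omega
    · simp [hz.symm]
  rw [h, map_add, tiltExp, weight_single, one_smul]
  exact self_le_add_left _ _

/-- Pairs (γ, n) with γ = 0 leave no trace in `tiltExp J`, so a bound on the exponent must be
supplemented by one on the degree of `J`. -/
theorem finite_tiltMultiIdx (hlen : ∀ i : Fin 2, 0 < len (single i 1)) (β : MIdx) (K : ℕ) :
    {J : TiltIdx α len →₀ ℕ | tiltExp J ≤ β ∧ J.degree ≤ K}.Finite := by
  classical
  refine (Set.finite_Iic (∑ y ∈ (finite_tiltIdx (α := α) hlen β).toFinset, single y K)).subset ?_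
  rintro J ⟨h1, h2⟩ y
  by_cases hy : J y = 0
  · rw [hy]
    exact Nat.zero_le _
  · have hmem : y ∈ (finite_tiltIdx (α := α) hlen β).toFinset := by
      simpa using (le_tiltExp hy).trans h1
    rw [Finsupp.finsetSum_apply]
    refine le_trans ?_ (Finset.single_le_sum (fun _ _ => Nat.zero_le _) hmem)
    rw [single_eq_same]
    exact (le_degree y J).trans h2

theorem tiltExp_le_of_coeff_ne_zero {J : TiltIdx α len →₀ ℕ} {ψ : PS} {β : MIdx}
    (h : MvPowerSeries.coeff β (zpow (tiltExp J) * ψ) ≠ 0) : tiltExp J ≤ β := by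
  classical
  by_contra hc
  exact h (by rw [MvPowerSeries.coeff_monomial_mul, if_neg hc])

/-- Each factor z^γ D^(n) raises the bracket by [γ] + 1 ≥ 1. -/
theorem degree_le_of_weight {J : TiltIdx α len →₀ ℕ} :
    (J.degree : ℤ) ≤ weight (fun y : TiltIdx α len =>
      weight bracketWeight y.1.1 + (1 - (0 : N2 →+ ℤ) y.1.2)) J := by
  rw [weight_apply, Finsupp.sum, Finsupp.degree_apply]
  push_cast
  refine Finset.sum_le_sum fun y _ => ?_
  rw [← bracket_eq_weight, nsmul_eq_mul]
  have h1 := y.2.1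
  have : (0 : ℤ) ≤ J y := Int.natCast_nonneg _
  simp only [AddMonoidHom.zero_apply, sub_zero]
  nlinarith

/-- The bracket gains at least |J|, hence |J| ≤ [β] - N; the monomial prefactor must divide z^β; and
the shifts act on a series whose length weights are nonnegative, so |m| is at most the length weight
of `β`. -/
theorem finite_dBasis (hlen : ∀ i : Fin 2, 0 < len (single i 1)) (N : ℤ) (β : MIdx) :
    {x : JIdx α len | ∃ φ ∈ level N, MvPowerSeries.coeff β (dBasis x φ) ≠ 0}.Finite := by
  refine ((finite_tiltMultiIdx (α := α) hlen β (bracket β - N).toNat).prod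
    (finite_len_le hlen (weight (lenWeight len) β))).subset ?_
  rintro ⟨J, m⟩ ⟨φ, hφ, h⟩
  obtain ⟨γ, h1, h2⟩ := isShiftGrading_bracket.moves_dBasis (J, m) φ β h
  rw [dBasis_eq, LinearMap.smul_apply, map_smul, mul_assoc] at h
  have h' : MvPowerSeries.coeff β (zpow (tiltExp J) * (shiftGen 0 ^ m 0 * shiftGen 1 ^ m 1)
    (tiltProd J φ)) ≠ 0 := right_ne_zero_of_mul h
  refine ⟨⟨tiltExp_le_of_coeff_ne_zero h', ?_⟩, ?_⟩
  · have h3 := degree_le_of_weight (J := J)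
    rw [← bracket_eq_weight, ← bracket_eq_weight] at h2
    have h4 : N ≤ bracket γ := hφ γ h1
    have h5 : ((0 : N2 →+ ℤ) m) = 0 := rfl
    simp only [h5, add_zero] at h2
    show J.degree ≤ _
    omega
  · obtain ⟨γ', δ, rfl, -, h3⟩ := exists_le_of_coeff_mul_ne_zero h'
    obtain ⟨ε, -, h4⟩ := (isShiftGrading_len len).moves_shiftGen_pow m _ _ h3
    have h5 := weight_lenWeight_nonneg hlen γ'
    have h6 := weight_lenWeight_nonneg hlen ε
    show len m ≤ weight (lenWeight len) (γ' + δ)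
    rw [map_add]
    linarith

end

section

variable {α : ℝ} {len : N2 →+ ℝ}

/-! ### `Γ_f^*` as the sum of an exponential family -/

/-- The coefficient `∏ t^J / J!`. -/
def tiltCoeff (t : TiltIdx α len → ℝ) (J : TiltIdx α len →₀ ℕ) : ℝ :=
  J.prod fun y c => t y ^ c / (c.factorial : ℝ)

theorem tiltCoeff_add_single (t : TiltIdx α len → ℝ) (J : TiltIdx α len →₀ ℕ)
    (y : TiltIdx α len) :
    ((J y : ℝ) + 1) * tiltCoeff t (J + single y 1) = t y * tiltCoeff t J := by
  classical
  have he : (J + single y 1).erase y = J.erase y := by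
    ext z
    rcases eq_or_ne z y with rfl | hz
    · simp
    · simp [erase_ne hz]
  rw [tiltCoeff, tiltCoeff, ← mul_prod_erase' (J + single y 1) y _ (fun _ => by simp),
    ← mul_prod_erase' J y _ (fun _ => by simp), he]
  simp only [Finsupp.add_apply, single_eq_same, Nat.factorial_succ, pow_succ]
  push_cast
  field_simp

/-- The summands of `Γ_f^*`, summed over `m`. -/
def tiltTerm (h : Fin 2 → ℝ) (t : TiltIdx α len → ℝ) (J : TiltIdx α len →₀ ℕ) :
    Module.End ℝ PS :=
  tiltCoeff t J • (LinearMap.mulLeft ℝ (zpow (tiltExp J)) * shiftExp h * tiltProd J)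

theorem tiltTerm_apply (h : Fin 2 → ℝ) (t : TiltIdx α len → ℝ) (J : TiltIdx α len →₀ ℕ) (φ : PS) :
    tiltTerm h t J φ = tiltCoeff t J • (zpow (tiltExp J) * shiftExp h (tiltProd J φ)) := rfl

/-- Adding one copy of y puts its z^γ on the far left and its D^(n) on the far right. Weighting by
the multiplicity of y absorbs the change in J!. -/
theorem tiltTerm_add_single (h : Fin 2 → ℝ) (t : TiltIdx α len → ℝ) (J : TiltIdx α len →₀ ℕ)
    (y : TiltIdx α len) (φ : PS) :
    (((J + single y 1 : TiltIdx α len →₀ ℕ) y : ℕ) : ℝ) • tiltTerm h t (J + single y 1) φ =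
      (t y • zpow y.1.1) * tiltTerm h t J (tiltGen y.1.2 φ) := by
  rw [tiltTerm_apply, tiltTerm_apply, tiltProd_add_single, smul_smul, Finsupp.add_apply,
    single_eq_same, Nat.cast_add, Nat.cast_one, tiltCoeff_add_single, smul_mul_smul_comm, map_add]
  congr 1
  rw [← mul_assoc]
  congr 1
  simp [zpow, MvPowerSeries.monomial_mul_monomial, tiltExp, weight_single, add_comm]

theorem coeff_tiltTerm_ne_zero {h : Fin 2 → ℝ} {t : TiltIdx α len → ℝ} {J : TiltIdx α len →₀ ℕ}
    {φ : PS} {β : MIdx} (hβ : MvPowerSeries.coeff β (tiltTerm h t J φ) ≠ 0) : tiltExp J ≤ β := by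
  rw [tiltTerm_apply, map_smul] at hβ
  exact tiltExp_le_of_coeff_ne_zero (right_ne_zero_of_mul hβ)

theorem summable_tiltTerm (hlen : ∀ i : Fin 2, 0 < len (single i 1)) (h : Fin 2 → ℝ)
    (t : TiltIdx α len → ℝ) (k : ℕ) (φ : PS) :
    Summable fun J : {J : TiltIdx α len →₀ ℕ // J.degree = k} => tiltTerm h t J.1 φ := by
  rw [summable_iff_coeff]
  intro β
  refine ((finite_tiltMultiIdx (α := α) hlen β k).preimage
    (f := fun J : {J : TiltIdx α len →₀ ℕ // J.degree = k} => J.1)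
    Subtype.val_injective.injOn).subset fun J hJ => ⟨coeff_tiltTerm_ne_zero hJ, J.2.le⟩

/-- The part of `Γ_f^*` with `|J| = k`. -/
def tiltSum (hlen : ∀ i : Fin 2, 0 < len (single i 1)) (h : Fin 2 → ℝ) (t : TiltIdx α len → ℝ)
    (k : ℕ) : Module.End ℝ PS :=
  sumEnd (fun J : {J : TiltIdx α len →₀ ℕ // J.degree = k} => tiltTerm h t J.1)
    (summable_tiltTerm hlen h t k)

theorem hasSum_tiltSum (hlen : ∀ i : Fin 2, 0 < len (single i 1)) (h : Fin 2 → ℝ)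
    (t : TiltIdx α len → ℝ) (k : ℕ) (φ : PS) :
    HasSum (fun J : {J : TiltIdx α len →₀ ℕ // J.degree = k} => tiltTerm h t J.1 φ)
      (tiltSum hlen h t k φ) :=
  hasSum_sumEnd _ _ φ

theorem tiltSum_zero (hlen : ∀ i : Fin 2, 0 < len (single i 1)) (h : Fin 2 → ℝ)
    (t : TiltIdx α len → ℝ) : tiltSum hlen h t 0 = shiftExp h := by
  refine LinearMap.ext fun φ => (hasSum_tiltSum hlen h t 0 φ).unique ?_
  have := hasSum_single (f := fun J : {J : TiltIdx α len →₀ ℕ // J.degree = 0} =>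
    tiltTerm h t J.1 φ) ⟨0, by simp⟩ (fun J hJ => absurd (Subtype.ext (by
      simpa [degree_eq_zero_iff] using J.2)) hJ)
  rw [tiltTerm_apply, tiltProd_zero] at this
  simpa [tiltCoeff, zpow] using this

/-- The proof is a double count of pairs (y, J) with |J| = k + 1, weighted by the multiplicity of y
in J. Summation over y gives the factor k + 1; removal of one copy of y from J gives the other side.
-/
theorem tiltSum_recursion (hlen : ∀ i : Fin 2, 0 < len (single i 1)) (h : Fin 2 → ℝ)
    (t : TiltIdx α len → ℝ) (k : ℕ) (φ : PS) :
    HasSum (fun y : TiltIdx α len => (t y • zpow y.1.1) * tiltSum hlen h t k (tiltGen y.1.2 φ))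
      (((k : ℝ) + 1) • tiltSum hlen h t (k + 1) φ) := by
  classical
  let B : TiltIdx α len × {J : TiltIdx α len →₀ ℕ // J.degree = k + 1} → PS :=
    fun p => ((p.2.1 p.1 : ℕ) : ℝ) • tiltTerm h t p.2.1 φ
  have hB : Summable B := by
    rw [summable_iff_coeff]
    intro β
    have hJ := (hasSum_tiltSum hlen h t (k + 1) φ).finite_coeff β
    refine (hJ.biUnion fun J _ => (J.1.support.finite_toSet.image fun y => (y, J))).subset ?_
    rintro ⟨y, J⟩ hp
    have hp' : MvPowerSeries.coeff β (((J.1 y : ℕ) : ℝ) • tiltTerm h t J.1 φ) ≠ 0 := hp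
    rw [map_smul] at hp'
    refine Set.mem_biUnion (x := J) (right_ne_zero_of_mul hp') ⟨y, ?_, rfl⟩
    simpa using left_ne_zero_of_mul hp'
  obtain ⟨S, hS⟩ := hB
  have h1 : HasSum (fun J : {J : TiltIdx α len →₀ ℕ // J.degree = k + 1} =>
      ((k : ℝ) + 1) • tiltTerm h t J.1 φ) S := by
    refine ((Equiv.prodComm _ _).hasSum_iff.2 hS).prod_fiberwise fun J => ?_
    have h2 := hasSum_sum_of_ne_finset_zero (L := .unconditional _)
      (f := fun y => ((J.1 y : ℕ) : ℝ) • tiltTerm h t J.1 φ) (s := J.1.support)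
      (fun y hy => by rw [notMem_support_iff.1 hy, Nat.cast_zero, zero_smul])
    rw [← Finset.sum_smul, ← Nat.cast_sum, ← Finsupp.degree_apply, J.2, Nat.cast_add,
      Nat.cast_one] at h2
    exact h2
  have h2 := h1.unique ((hasSum_tiltSum hlen h t (k + 1) φ).const_smul ((k : ℝ) + 1))
  rw [← h2]
  -- Outside the range of this injection y does not occur in J, so the weight vanishes.
  let g : TiltIdx α len × {J : TiltIdx α len →₀ ℕ // J.degree = k} →
      TiltIdx α len × {J : TiltIdx α len →₀ ℕ // J.degree = k + 1} :=
    fun p => (p.1, ⟨p.2.1 + single p.1 1, by simp [p.2.2]⟩)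
  have hg : Function.Injective g := by
    rintro ⟨y, J⟩ ⟨z, K⟩ hp
    simp only [g, Prod.mk.injEq, Subtype.mk.injEq] at hp
    obtain ⟨rfl, hJK⟩ := hp
    exact Prod.ext rfl (Subtype.ext (add_right_cancel hJK))
  have h3 := (hg.hasSum_iff fun p hp => ?_).2 hS
  · refine h3.prod_fiberwise fun y => ?_
    refine ((hasSum_tiltSum hlen h t k (tiltGen y.1.2 φ)).mul_left _).of_eq fun J => ?_
    exact tiltTerm_add_single h t J.1 y φ
  · obtain ⟨y, J⟩ := p
    have h0 : J.1 y = 0 := by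
      by_contra hc
      have e : J.1 - single y 1 + single y 1 = J.1 := by
        ext z
        rcases eq_or_ne z y with rfl | hz
        · simp; omega
        · simp [hz.symm]
      refine hp ⟨(y, ⟨J.1 - single y 1, ?_⟩), ?_⟩
      · have := congrArg Finsupp.degree e
        rw [map_add, J.2, degree_single] at this
        omega
      · exact Prod.ext rfl (Subtype.ext e)
    simp [B, h0]

theorem isExpFamily_tiltSum (hlen : ∀ i : Fin 2, 0 < len (single i 1)) (h : Fin 2 → ℝ)
    (t : TiltIdx α len → ℝ) :
    IsExpFamily (fun y : TiltIdx α len => t y • zpow y.1.1) (fun y => y.1.2) (tiltPart t)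
      (tiltSum hlen h t) where
  hasSum_coeff := hasSum_tiltPart t
  zero_one := by rw [tiltSum_zero, shiftExp_one]
  zero_mul φ ψ := by rw [tiltSum_zero, shiftExp_mul]
  recursion := tiltSum_recursion hlen h t

/-- The family of operators `f^(J,m) D_(J,m)`. -/
def gammaTerm (f : Character α len) (x : JIdx α len) : Module.End ℝ PS := f (Z x) • dBasis x

theorem gammaStar_eq_famSum (f : Character α len) : gammaStar f = famSum (gammaTerm f) := by
  funext φ β
  exact finsum_congr fun x => by simp [gammaTerm]

theorem isLocFinite_gammaTerm (hlen : ∀ i : Fin 2, 0 < len (single i 1)) (f : Character α len) :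
    IsLocFinite (gammaTerm f) where
  continuous x := (continuous_dBasis x).const_smul _
  finite N β := (finite_dBasis hlen N β).subset fun x ⟨φ, hφ, h⟩ => ⟨φ, hφ, by
    rw [gammaTerm, LinearMap.smul_apply, map_smul] at h
    exact right_ne_zero_of_mul h⟩

theorem gammaTerm_apply (f : Character α len) (J : TiltIdx α len →₀ ℕ) (m : N2) (φ : PS) :
    gammaTerm f (J, m) φ =
      tiltCoeff (tilt f) J • (zpow (tiltExp J) * shiftTerm (shift f) m (tiltProd J φ)) := by
  rw [gammaTerm, dBasis_eq, character_apply_Z, shiftTerm, tiltCoeff]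
  simp only [LinearMap.smul_apply, Module.End.mul_apply, LinearMap.mulLeft_apply, mul_smul_comm,
    smul_smul, dNorm, Finsupp.prod, Finset.prod_div_distrib]
  congr 1
  rw [mul_inv]
  ring

theorem hasSum_gammaStar (hlen : ∀ i : Fin 2, 0 < len (single i 1)) (f : Character α len) {φ : PS}
    (hφ : φ ∈ bddSeries) : HasSum (fun x => gammaTerm f x φ) (gammaStar f φ) := by
  rw [gammaStar_eq_famSum]
  exact (isLocFinite_gammaTerm hlen f).hasSum hφ

/-- The sum over (J, m) is taken first over m, which produces `shiftExp`, and then along the fibres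
of the degree of J. -/
theorem hasSum_tiltSum_gammaStar (hlen : ∀ i : Fin 2, 0 < len (single i 1)) (f : Character α len)
    {φ : PS} (hφ : φ ∈ bddSeries) :
    HasSum (fun k => tiltSum hlen (shift f) (tilt f) k φ) (gammaStar f φ) := by
  have h1 : HasSum (fun J => tiltTerm (shift f) (tilt f) J φ) (gammaStar f φ) := by
    refine (hasSum_gammaStar hlen f hφ).prod_fiberwise fun J => ?_
    refine (((hasSum_shiftExp hlen (shift f) (tiltProd J φ)).mul_left
      (zpow (tiltExp J))).const_smul (tiltCoeff (tilt f) J)).of_eq fun m => ?_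
    exact gammaTerm_apply f J m φ
  exact ((Equiv.sigmaFiberEquiv fun J : TiltIdx α len →₀ ℕ => J.degree).hasSum_iff.2 h1).sigma
    fun k => hasSum_tiltSum hlen (shift f) (tilt f) k φ

theorem bracket_le_of_gammaTerm {f : Character α len} {x : JIdx α len} {φ : PS} {β : MIdx}
    (h : MvPowerSeries.coeff β (gammaTerm f x φ) ≠ 0) :
    ∃ γ, MvPowerSeries.coeff γ φ ≠ 0 ∧ bracket γ ≤ bracket β := by
  obtain ⟨γ, h1, h2⟩ := (isShiftGrading_bracket.moves_dBasis x).smul (f (Z x)) φ β h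
  refine ⟨γ, h1, ?_⟩
  have h3 := degree_le_of_weight (J := x.1)
  rw [← bracket_eq_weight, ← bracket_eq_weight] at h2
  have h5 : ((0 : N2 →+ ℤ) x.2) = 0 := rfl
  simp only [h5, add_zero] at h2
  have h6 : (0 : ℤ) ≤ (x.1.degree : ℤ) := Int.natCast_nonneg _
  linarith

theorem isTameHom_gammaStar (hlen : ∀ i : Fin 2, 0 < len (single i 1)) (f : Character α len) :
    IsTameHom (gammaStar f) := by
  have h := fun (φ : PS) (hφ : φ ∈ bddSeries) => hasSum_tiltSum_gammaStar hlen f hφ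
  rw [gammaStar_eq_famSum] at h ⊢
  refine (isExpFamily_tiltSum hlen (shift f) (tilt f)).isTameHom (isLocFinite_gammaTerm hlen f) h ?_
  intro x N φ hφ β hβ
  obtain ⟨γ, h1, h2⟩ := bracket_le_of_gammaTerm hβ
  exact (hφ γ h1).trans h2

theorem gammaStar_zn (hlen : ∀ i : Fin 2, 0 < len (single i 1)) (f : Character α len)
    (n : {n : N2 // n ≠ 0}) : gammaStar f (zn n) = zn n + tiltSeries f n.1 := by
  rw [(isExpFamily_tiltSum hlen (shift f) (tilt f)).sum_zn
    (fun φ hφ => hasSum_tiltSum_gammaStar hlen f hφ) n, tiltSum_zero, shiftExp_zn hlen,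
    tiltSeries_eq]
  abel

/-- T_0 already translates by `shiftPart`, and the tilt translates further by `tiltPart`. By the
semigroup law the amounts add up to π^(0). -/
theorem gammaStar_zk (hlen : ∀ i : Fin 2, 0 < len (single i 1)) (f : Character α len) (k : ℕ) :
    gammaStar f (zk k) = translate k (tiltSeries f 0) := by
  have h1 := (isExpFamily_tiltSum hlen (shift f) (tilt f)).hasSum_zk
    (fun φ hφ => hasSum_tiltSum_gammaStar hlen f hφ) k
  rw [tiltSum_zero] at h1
  simp only [shiftExp_zk hlen] at h1
  rw [tiltSeries_eq]
  exact h1.unique (hasSum_translate_add k _ _)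

/-! ### The exponential formula -/

/-- The operators of the exponential formula. -/
def expEnd (f : Character α len) (x : Σ k : ℕ, (Fin k → N2)) : Module.End ℝ PS :=
  ((x.1.factorial : ℝ)⁻¹) • (LinearMap.mulLeft ℝ (∏ i, tiltSeries f (x.2 i)) *
    (List.ofFn fun i => tiltGen (x.2 i)).reverse.prod)

theorem expEnd_apply (f : Character α len) (x : Σ k : ℕ, (Fin k → N2)) (φ : PS) :
    expEnd f x φ = expTerm f φ x.1 x.2 := rfl

theorem prod_reverse_ofFn_succ {k : ℕ} (n : N2) (v : Fin k → N2) :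
    (List.ofFn fun i => tiltGen ((Fin.cons n v : Fin (k + 1) → N2) i)).reverse.prod =
      (List.ofFn fun i => tiltGen (v i)).reverse.prod * tiltGen n := by
  simp [List.ofFn_succ]

theorem expTerm_cons (f : Character α len) (φ : PS) {k : ℕ} (n : N2) (v : Fin k → N2) :
    ((k : ℝ) + 1) • expTerm f φ (k + 1) (Fin.cons n v) =
      tiltSeries f n * expTerm f (tiltGen n φ) k v := by
  rw [expTerm, expTerm, prod_reverse_ofFn_succ, Fin.prod_univ_succ, Fin.cons_zero, smul_smul,
    mul_smul_comm, Nat.factorial_succ, ← mul_assoc]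
  simp only [Fin.cons_succ, Module.End.mul_apply]
  congr 1
  push_cast
  field_simp

theorem continuous_prod_reverse_ofFn {k : ℕ} (v : Fin k → N2) :
    Continuous (List.ofFn fun i => tiltGen (v i)).reverse.prod := by
  induction k with
  | zero => rw [List.ofFn_zero]; exact continuous_id
  | succ k ih =>
    have := prod_reverse_ofFn_succ (v 0) (fun i => v i.succ)
    rw [show (Fin.cons (v 0) fun i => v i.succ : Fin (k + 1) → N2) = v from Fin.cons_self_tail v]
      at this
    rw [this]
    exact continuous_end_mul (ih _) (continuous_tiltGen _)

theorem moves_prod_reverse_ofFn {k : ℕ} (v : Fin k → N2) :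
    Moves (weight bracketWeight) (List.ofFn fun i => tiltGen (v i)).reverse.prod (k : ℤ) := by
  induction k with
  | zero => simpa using moves_one
  | succ k ih =>
    have := prod_reverse_ofFn_succ (v 0) (fun i => v i.succ)
    rw [show (Fin.cons (v 0) fun i => v i.succ : Fin (k + 1) → N2) = v from Fin.cons_self_tail v]
      at this
    rw [this]
    have h := (ih fun i => v i.succ).mul (isShiftGrading_bracket.moves_tiltGen (v 0))
    simpa using h

theorem exists_of_coeff_expTerm_ne_zero {f : Character α len} {φ : PS} {k : ℕ} {v : Fin k → N2}
    {β : MIdx} (h : MvPowerSeries.coeff β (expTerm f φ k v) ≠ 0) :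
    ∃ γ δ, γ + δ = β ∧ MvPowerSeries.coeff γ (∏ i, tiltSeries f (v i)) ≠ 0 ∧
      ∃ ε, MvPowerSeries.coeff ε φ ≠ 0 ∧ bracket δ = bracket ε + k := by
  rw [expTerm, map_smul] at h
  obtain ⟨γ, δ, h1, h2, h3⟩ := exists_le_of_coeff_mul_ne_zero (right_ne_zero_of_mul h)
  obtain ⟨ε, h4, h5⟩ := moves_prod_reverse_ofFn v _ _ h3
  rw [← bracket_eq_weight, ← bracket_eq_weight] at h5
  exact ⟨γ, δ, h1, h2, ε, h4, h5⟩

theorem exists_len_lt_of_coeff_expTerm (hlen : ∀ i : Fin 2, 0 < len (single i 1))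
    {f : Character α len} {φ : PS} {k : ℕ} {v : Fin k → N2} {β : MIdx}
    (h : MvPowerSeries.coeff β (expTerm f φ k v) ≠ 0) (i : Fin k) :
    ∃ γ ≤ β, len (v i) < homog α len γ := by
  obtain ⟨γ, δ, rfl, h2, -⟩ := exists_of_coeff_expTerm_ne_zero h
  obtain ⟨ε, h3, h4⟩ := exists_le_of_coeff_prod_ne_zero h2 (Finset.mem_univ i)
  exact ⟨ε, h3.trans (self_le_add_right γ δ), len_lt_of_coeff_tiltSeries hlen h4⟩

theorem finite_expTerm_fixed (hlen : ∀ i : Fin 2, 0 < len (single i 1)) (f : Character α len)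
    (k : ℕ) (β : MIdx) :
    {v : Fin k → N2 | ∃ φ, MvPowerSeries.coeff β (expTerm f φ k v) ≠ 0}.Finite := by
  refine (Set.Finite.pi' fun _ : Fin k => finite_len_lt_homog (α := α) hlen β).subset ?_
  rintro v ⟨φ, h⟩ i
  exact exists_len_lt_of_coeff_expTerm hlen h i

/-- The bracket of `β` alone does not bound k, because the terms z_m of π^(n) have bracket -1 and
can offset the gain from the derivations. The bound is read off from the factor `δ ≤ β` coming from
the derivatives, whose bracket is at least N + k. -/
theorem finite_expTerm (hlen : ∀ i : Fin 2, 0 < len (single i 1)) (f : Character α len) (N : ℤ)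
    (β : MIdx) : {x : Σ k : ℕ, (Fin k → N2) |
      ∃ φ ∈ level N, MvPowerSeries.coeff β (expTerm f φ x.1 x.2) ≠ 0}.Finite := by
  obtain ⟨B, hB⟩ := ((Set.finite_Iic β).image bracket).bddAbove
  refine ((Set.finite_Iic (B - N).toNat).biUnion fun k _ =>
    (finite_expTerm_fixed hlen f k β).image fun v => (⟨k, v⟩ : Σ k : ℕ, (Fin k → N2))).subset ?_
  rintro ⟨k, v⟩ ⟨φ, hφ, h⟩
  refine Set.mem_biUnion (x := k) ?_ ⟨v, ⟨φ, h⟩, rfl⟩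
  obtain ⟨γ, δ, rfl, -, ε, h1, h2⟩ := exists_of_coeff_expTerm_ne_zero h
  have h3 : bracket δ ≤ B := hB ⟨δ, self_le_add_left δ γ, rfl⟩
  have h4 : N ≤ bracket ε := hφ ε h1
  simp only [Set.mem_Iic]
  dsimp only at h2
  omega

theorem isLocFinite_expEnd (hlen : ∀ i : Fin 2, 0 < len (single i 1)) (f : Character α len) :
    IsLocFinite (expEnd f) where
  continuous x := (continuous_end_mul (continuous_const_mul _)
    (continuous_prod_reverse_ofFn x.2)).const_smul _
  finite := finite_expTerm hlen f

theorem summable_expEnd (hlen : ∀ i : Fin 2, 0 < len (single i 1)) (f : Character α len) (k : ℕ)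
    (φ : PS) : Summable fun v : Fin k → N2 => expEnd f ⟨k, v⟩ φ :=
  summable_iff_coeff.2 fun β => (finite_expTerm_fixed hlen f k β).subset fun _ hv => ⟨φ, hv⟩

/-- The part of order `k` of the exponential formula. -/
def expSum (hlen : ∀ i : Fin 2, 0 < len (single i 1)) (f : Character α len) (k : ℕ) :
    Module.End ℝ PS :=
  sumEnd (fun v : Fin k → N2 => expEnd f ⟨k, v⟩) (summable_expEnd hlen f k)

theorem hasSum_expSum (hlen : ∀ i : Fin 2, 0 < len (single i 1)) (f : Character α len) (k : ℕ)
    (φ : PS) : HasSum (fun v : Fin k → N2 => expTerm f φ k v) (expSum hlen f k φ) :=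
  hasSum_sumEnd _ (summable_expEnd hlen f k) φ

theorem expSum_zero (hlen : ∀ i : Fin 2, 0 < len (single i 1)) (f : Character α len) :
    expSum hlen f 0 = 1 := by
  refine LinearMap.ext fun φ => (hasSum_expSum hlen f 0 φ).unique ?_
  simp [expTerm]

theorem isExpFamily_expSum (hlen : ∀ i : Fin 2, 0 < len (single i 1)) (f : Character α len) :
    IsExpFamily (tiltSeries f) id (tiltSeries f) (expSum hlen f) where
  hasSum_coeff n := by
    classical
    have := hasSum_single (f := fun m => if id m = n then tiltSeries f m else 0) n
      (fun m hm => if_neg hm)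
    rw [if_pos (by rfl)] at this
    exact this.of_eq fun m => by congr
  zero_one := by rw [expSum_zero, Module.End.one_apply]
  zero_mul φ ψ := by rw [expSum_zero]; rfl
  recursion k φ := by
    have h1 := ((Fin.consEquiv fun _ : Fin (k + 1) => N2).hasSum_iff.2
      (hasSum_expSum hlen f (k + 1) φ)).const_smul ((k : ℝ) + 1)
    refine h1.prod_fiberwise fun n => ?_
    refine ((hasSum_expSum hlen f k (tiltGen n φ)).mul_left (tiltSeries f n)).of_eq fun v => ?_
    exact expTerm_cons f φ n v

theorem hasSum_expSum_famSum (hlen : ∀ i : Fin 2, 0 < len (single i 1)) (f : Character α len)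
    {φ : PS} (hφ : φ ∈ bddSeries) :
    HasSum (fun k => expSum hlen f k φ) (famSum (expEnd f) φ) :=
  ((isLocFinite_expEnd hlen f).hasSum hφ).sigma fun k => hasSum_expSum hlen f k φ

theorem prod_tiltSeries_mem_level (f : Character α len) {k : ℕ} (v : Fin k → N2) :
    ∏ i, tiltSeries f (v i) ∈ level (-k) := by
  induction k with
  | zero => simpa using one_mem_level
  | succ k ih =>
    rw [Fin.prod_univ_succ]
    convert mul_mem_level (tstar_le_level (tiltSeries_mem_tstar f (v 0)))
      (ih fun i => v i.succ) using 2
    push_cast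
    ring

/-- The k factors π^(n) lose at most k in the bracket, and the k derivations gain exactly k. -/
theorem level_of_expTerm (f : Character α len) (x : Σ k : ℕ, (Fin k → N2)) (N : ℤ) (φ : PS)
    (hφ : φ ∈ level N) : expEnd f x φ ∈ level N := by
  obtain ⟨k, v⟩ := x
  intro β hβ
  obtain ⟨γ, δ, rfl, h1, ε, h2, h3⟩ := exists_of_coeff_expTerm_ne_zero hβ
  have h5 : -(k : ℤ) ≤ bracket γ := prod_tiltSeries_mem_level f v γ h1
  have h6 : N ≤ bracket ε := hφ ε h2
  show N ≤ bracket (γ + δ)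
  dsimp only at h3
  rw [bracket_add]
  omega

/-- The two families differ in `T 0` and in their coefficients, but both sums are tame morphisms, so
agreement on variables suffices. -/
theorem gammaStar_eq_expSum (hlen : ∀ i : Fin 2, 0 < len (single i 1)) (f : Character α len)
    {φ : PS} (hφ : φ ∈ bddSeries) : gammaStar f φ = famSum (expEnd f) φ := by
  have hE := isExpFamily_expSum hlen f
  have hS := fun (φ : PS) (hφ : φ ∈ bddSeries) => hasSum_expSum_famSum hlen f hφ
  refine (isTameHom_gammaStar hlen f).ext
    (hE.isTameHom (isLocFinite_expEnd hlen f) hS (level_of_expTerm f)) ?_ hφ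
  rintro (k | n)
  · have h1 := hE.hasSum_zk hS k
    rw [expSum_zero] at h1
    exact (gammaStar_zk hlen f k).trans ((hasSum_translate k _).unique h1)
  · rw [hE.sum_zn hS n, expSum_zero]
    exact gammaStar_zn hlen f n

end

section

variable {α : ℝ} {len : N2 →+ ℝ}

/-! ### Triangularity -/

/-- Each pair contributes |γ| - |n|, which is positive by the defining condition of `TiltIdx`. -/
theorem weight_homog_nonneg (J : TiltIdx α len →₀ ℕ) :
    0 ≤ weight (fun y : TiltIdx α len => weight (homogWeight α len) y.1.1 + (α - len y.1.2)) J ∧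
      (J ≠ 0 → 0 <
        weight (fun y : TiltIdx α len => weight (homogWeight α len) y.1.1 + (α - len y.1.2)) J) := by
  have hpos : ∀ y : TiltIdx α len, 0 < weight (homogWeight α len) y.1.1 + (α - len y.1.2) := by
    intro y
    have h1 := y.2.2
    rw [homog_eq_weight] at h1
    linarith
  rw [weight_apply, Finsupp.sum]
  refine ⟨Finset.sum_nonneg fun y _ => nsmul_nonneg (hpos y).le _, fun hJ => ?_⟩
  refine Finset.sum_pos (fun y hy => nsmul_pos (hpos y) (mem_support_iff.1 hy)) ?_
  exact support_nonempty_iff.2 hJ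

theorem homog_le_of_gammaTerm (hlen : ∀ i : Fin 2, 0 < len (single i 1)) {f : Character α len}
    {x : JIdx α len} {φ : PS} {β : MIdx} (h : MvPowerSeries.coeff β (gammaTerm f x φ) ≠ 0) :
    ∃ γ, MvPowerSeries.coeff γ φ ≠ 0 ∧ homog α len γ ≤ homog α len β ∧
      (x ≠ 0 → homog α len γ < homog α len β) := by
  obtain ⟨γ, h1, h2⟩ := ((isShiftGrading_homog α len).moves_dBasis x).smul (f (Z x)) φ β h
  have h3 := weight_homog_nonneg x.1
  have h4 := len_nonneg hlen x.2
  refine ⟨γ, h1, ?_, fun hx => ?_⟩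
  · rw [homog_eq_weight, homog_eq_weight]
    linarith [h3.1]
  · rw [homog_eq_weight, homog_eq_weight]
    by_cases hJ : x.1 = 0
    · have : x.2 ≠ 0 := fun hm => hx (Prod.ext hJ hm)
      linarith [h3.1, len_pos hlen this]
    · linarith [h3.2 hJ]

theorem gammaTerm_zero (f : Character α len) (φ : PS) : gammaTerm f 0 φ = φ := by
  have h : (0 : JIdx α len) = (0, 0) := rfl
  rw [h, gammaTerm_apply, shiftTerm, tiltProd_zero]
  simp [tiltCoeff, zpow, hpow_zero]

theorem exists_of_coeff_gammaStar_ne_zero (hlen : ∀ i : Fin 2, 0 < len (single i 1))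
    {f : Character α len} {φ : PS} (hφ : φ ∈ bddSeries) {β : MIdx}
    (h : MvPowerSeries.coeff β (gammaStar f φ) ≠ 0) :
    (∃ γ, MvPowerSeries.coeff γ φ ≠ 0 ∧ bracket γ ≤ bracket β) ∧
      ∃ γ, MvPowerSeries.coeff γ φ ≠ 0 ∧ homog α len γ ≤ homog α len β := by
  obtain ⟨x, hx⟩ := (hasSum_gammaStar hlen f hφ).exists_coeff_ne_zero h
  obtain ⟨γ, h1, h2, -⟩ := homog_le_of_gammaTerm hlen hx
  exact ⟨bracket_le_of_gammaTerm hx, γ, h1, h2⟩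

theorem exists_of_coeff_gammaStar_sub_ne_zero (hlen : ∀ i : Fin 2, 0 < len (single i 1))
    {f : Character α len} {φ : PS} (hφ : φ ∈ bddSeries) {β : MIdx}
    (h : MvPowerSeries.coeff β (gammaStar f φ - φ) ≠ 0) :
    ∃ γ, MvPowerSeries.coeff γ φ ≠ 0 ∧ homog α len γ < homog α len β := by
  classical
  -- The identity is written as a family concentrated at index 0, where it cancels the corresponding
  -- term of Γ_f^*.
  have h1 := hasSum_single (f := fun x : JIdx α len => if x = 0 then φ else 0) 0
    (fun x hx => if_neg hx)
  rw [if_pos rfl] at h1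
  obtain ⟨x, hx⟩ := ((hasSum_gammaStar hlen f hφ).sub h1).exists_coeff_ne_zero h
  rcases eq_or_ne x 0 with rfl | hx0
  · simp [gammaTerm_zero] at hx
  · rw [if_neg hx0, sub_zero] at hx
    obtain ⟨γ, h2, -, h3⟩ := homog_le_of_gammaTerm hlen hx
    exact ⟨γ, h2, h3 hx0⟩

/-- The part with nonnegative bracket is preserved because the bracket never decreases. For the
remaining monomials z_n the explicit image z_n + π^(n) is used; expansion into monomials separates
the two cases. -/
theorem gammaStar_mem_tstar (hlen : ∀ i : Fin 2, 0 < len (single i 1)) (f : Character α len)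
    {φ : PS} (hφ : φ ∈ Tstar) : gammaStar f φ ∈ Tstar := by
  have hmem : ∀ γ, MvPowerSeries.coeff γ φ • zpow γ ∈ Tstar := by
    intro γ
    by_cases h0 : MvPowerSeries.coeff γ φ = 0
    · rw [h0, zero_smul]
      exact zero_mem _
    · exact Submodule.smul_mem _ _ (zpow_mem_supported (S := tstarIdx) (hφ γ h0))
  have hT := isTameHom_gammaStar hlen f
  refine (hT.map_hasSum (hasSum_monomials φ) fun γ => tstar_le_level (hmem γ)).mem_supported
    (S := tstarIdx) fun γ => ?_
  by_cases h0 : MvPowerSeries.coeff γ φ = 0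
  -- Writing 0 as 0 • 0 lets `map_smul` show that 0 is mapped to 0.
  · rw [h0, zero_smul, ← zero_smul ℝ (0 : PS), hT.map_smul _ _ (zero_mem _), zero_smul]
    exact zero_mem _
  · rw [hT.map_smul _ _ ⟨bracket γ, zpow_mem_supported (γ := γ) (le_refl (bracket γ))⟩]
    refine Submodule.smul_mem _ _ ?_
    rcases hφ γ h0 with h | ⟨n, rfl⟩
    · intro β hβ
      exact Or.inl (hT.mem_level 0 _ (zpow_mem_supported h) β hβ)
    · have h1 : zpow (single (Sum.inr n) 1) = zn n := rfl
      rw [h1, gammaStar_zn hlen]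
      exact add_mem (h1 ▸ zpow_mem_supported (S := tstarIdx) (Or.inr ⟨n, rfl⟩))
        (tiltSeries_mem_tstar f n.1)

/-- The values of the homogeneity on `T^*`. -/
def homogValues (α : ℝ) (len : N2 →+ ℝ) : Set ℝ :=
  Set.range fun p : ℕ × N2 => α * p.1 + len p.2

/-- On the support of `Tstar` the integer [γ] + 1 is nonnegative, and the remaining part of |γ| is
the length of ∑ γ(n) n. -/
theorem homog_mem_homogValues {γ : MIdx} (h : γ ∈ tstarIdx) :
    homog α len γ ∈ homogValues α len := by
  let w : Idx → N2
    | Sum.inl _ => 0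
    | Sum.inr n => n.1
  refine ⟨((bracket γ + 1).toNat, weight w γ), ?_⟩
  have h1 := bracket_of_mem_tstarIdx h
  have h2 : (((bracket γ + 1).toNat : ℕ) : ℝ) = bracket γ + 1 := by
    have : (((bracket γ + 1).toNat : ℕ) : ℤ) = bracket γ + 1 := Int.toNat_of_nonneg (by omega)
    exact_mod_cast this
  have h3 : len (weight w γ) = weight (lenWeight len) γ := by
    rw [weight_apply, weight_apply, Finsupp.sum, Finsupp.sum, map_sum]
    refine Finset.sum_congr rfl fun i _ => ?_
    rw [map_nsmul]
    cases i <;> simp [w, lenWeight]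
  show α * (((bracket γ + 1).toNat : ℕ) : ℝ) + len (weight w γ) = _
  rw [homog_eq_bracket_add, h2, h3]

theorem finite_homogValues_lt (hα : 0 < α) (hlen : ∀ i : Fin 2, 0 < len (single i 1)) (C : ℝ) :
    (homogValues α len ∩ Set.Iio C).Finite := by
  refine (((Set.finite_Iic ⌈C / α⌉₊).prod (finite_len_le hlen C)).image
    fun p : ℕ × N2 => α * p.1 + len p.2).subset ?_
  rintro _ ⟨⟨⟨j, n⟩, rfl⟩, h⟩
  simp only [Set.mem_Iio] at h
  have h1 := len_nonneg hlen n
  have h2 : 0 ≤ α * j := by positivity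
  refine ⟨(j, n), ⟨?_, show len n ≤ C by linarith⟩, rfl⟩
  show j ≤ _
  rw [← Nat.cast_le (α := ℝ)]
  refine le_trans ?_ (Nat.le_ceil _)
  rw [le_div_iff₀ hα]
  linarith

/-- The number of homogeneities below that of `β`. -/
def homogRank (α : ℝ) (len : N2 →+ ℝ) (β : MIdx) : ℕ :=
  (homogValues α len ∩ Set.Iio (homog α len β)).ncard

/-- The value |γ| itself is counted for `β` but not for `γ`, and the sets counted are finite. The
real-valued order is thereby replaced by one suited to induction. -/
theorem homogRank_lt (hα : 0 < α) (hlen : ∀ i : Fin 2, 0 < len (single i 1)) {γ β : MIdx}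
    (hγ : γ ∈ tstarIdx) (h : homog α len γ < homog α len β) :
    homogRank α len γ < homogRank α len β := by
  refine Set.ncard_lt_ncard ⟨fun x hx => ⟨hx.1, lt_trans hx.2 h⟩, fun hc => ?_⟩
    (finite_homogValues_lt hα hlen _)
  exact lt_irrefl (homog α len γ) (hc ⟨homog_mem_homogValues hγ, h⟩).2

/-! ### Unitriangular equations φ + N φ = ψ -/

section Triangular

variable {S : Set MIdx} {rank : MIdx → ℕ} {N : PS → PS}

theorem eq_zero_of_triangular
    (htri : ∀ φ ∈ supported S, ∀ β, MvPowerSeries.coeff β (N φ) ≠ 0 →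
      ∃ γ, MvPowerSeries.coeff γ φ ≠ 0 ∧ rank γ < rank β)
    {φ : PS} (hφ : φ ∈ supported S) (h : φ + N φ = 0) : φ = 0 := by
  have key : ∀ k β, rank β = k → MvPowerSeries.coeff β φ = 0 := by
    intro k
    induction k using Nat.strong_induction_on with
    | _ k ih =>
      intro β hβ
      by_contra hc
      have h1 : MvPowerSeries.coeff β (N φ) ≠ 0 := by
        rw [eq_neg_of_add_eq_zero_right h, map_neg]
        exact neg_ne_zero.2 hc
      obtain ⟨γ, h2, h3⟩ := htri φ hφ β h1
      exact h2 (ih _ (hβ ▸ h3) γ rfl)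
  ext β
  exact key _ β rfl

/-- The iteration s ↦ ψ - N s starts from 0. Since N only feeds coefficients of smaller rank into
the `β`-coefficient, this coefficient is constant from step `rank β + 1` on. -/
theorem exists_solution_of_triangular
    (hmem : ∀ φ ∈ supported S, N φ ∈ supported S)
    (hsub : ∀ φ ∈ supported S, ∀ ψ ∈ supported S, N (φ - ψ) = N φ - N ψ)
    (htri : ∀ φ ∈ supported S, ∀ β, MvPowerSeries.coeff β (N φ) ≠ 0 →
      ∃ γ, MvPowerSeries.coeff γ φ ≠ 0 ∧ rank γ < rank β)
    {ψ : PS} (hψ : ψ ∈ supported S) : ∃ φ ∈ supported S, φ + N φ = ψ := by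
  obtain ⟨s, hs0, hs⟩ : ∃ s : ℕ → PS, s 0 = 0 ∧ ∀ j, s (j + 1) = ψ - N (s j) :=
    ⟨fun j => Nat.rec 0 (fun _ φ => ψ - N φ) j, rfl, fun _ => rfl⟩
  have hsS : ∀ j, s j ∈ supported S := by
    intro j
    induction j with
    | zero => rw [hs0]; exact zero_mem _
    | succ j ih => rw [hs]; exact sub_mem hψ (hmem _ ih)
  have hstep : ∀ j β, rank β < j → MvPowerSeries.coeff β (s (j + 1)) =
      MvPowerSeries.coeff β (s j) := by
    intro j
    induction j with
    | zero => intro β h; omega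
    | succ j ih =>
      intro β hβ
      by_contra hc
      have h1 : MvPowerSeries.coeff β (N (s (j + 1) - s j)) ≠ 0 := by
        intro h0
        apply hc
        rw [hsub _ (hsS _) _ (hsS _), map_sub, sub_eq_zero] at h0
        rw [hs (j + 1), map_sub, h0, ← map_sub, ← hs]
      obtain ⟨γ, h2, h3⟩ := htri _ (sub_mem (hsS _) (hsS _)) β h1
      exact h2 (by rw [map_sub, ih γ (by omega), sub_self])
  have hstable : ∀ β j, rank β < j → MvPowerSeries.coeff β (s j) =
      MvPowerSeries.coeff β (s (rank β + 1)) := by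
    intro β j hj
    induction j, hj using Nat.le_induction with
    | base => rfl
    | succ j hj ih => rw [hstep j β hj, ih]
  let φ : PS := fun β => MvPowerSeries.coeff β (s (rank β + 1))
  have hφ : ∀ β, MvPowerSeries.coeff β φ = MvPowerSeries.coeff β (s (rank β + 1)) := fun _ => rfl
  have hφS : φ ∈ supported S := fun β hβ => hsS (rank β + 1) β hβ
  refine ⟨φ, hφS, ?_⟩
  ext β
  -- `φ` and the iterate of index `rank β + 1` agree on all multi-indices of rank below that of `β`,
  -- which are the only ones N can use here.
  have h1 : MvPowerSeries.coeff β (N φ) = MvPowerSeries.coeff β (N (s (rank β + 1))) := by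
    by_contra hc
    have h2 : MvPowerSeries.coeff β (N (φ - s (rank β + 1))) ≠ 0 := by
      rw [hsub _ hφS _ (hsS _), map_sub]
      exact sub_ne_zero.2 hc
    obtain ⟨γ, h3, h4⟩ := htri _ (sub_mem hφS (hsS _)) β h2
    exact h3 (by rw [map_sub, hφ, hstable γ (rank β + 1) (by omega), sub_self])
  have h2 := hstable β (rank β + 2) (by omega)
  rw [map_add, h1, hφ, ← h2, hs (rank β + 1), map_sub]
  ring

end Triangular

theorem gammaStar_sub (hlen : ∀ i : Fin 2, 0 < len (single i 1)) (f : Character α len) {φ ψ : PS}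
    (hφ : φ ∈ bddSeries) (hψ : ψ ∈ bddSeries) :
    gammaStar f (φ - ψ) = gammaStar f φ - gammaStar f ψ := by
  have hT := isTameHom_gammaStar hlen f
  rw [sub_eq_add_neg, hT.map_add _ hφ _ (neg_mem hψ), ← neg_one_smul ℝ ψ, hT.map_smul _ _ hψ,
    neg_one_smul, sub_eq_add_neg]

theorem homogRank_gammaStar_sub (hα : 0 < α) (hlen : ∀ i : Fin 2, 0 < len (single i 1))
    (f : Character α len) {S : Set MIdx} (hS : S ⊆ tstarIdx) :
    ∀ φ ∈ supported S, ∀ β, MvPowerSeries.coeff β (gammaStar f φ - φ) ≠ 0 →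
      ∃ γ, MvPowerSeries.coeff γ φ ≠ 0 ∧ homogRank α len γ < homogRank α len β := by
  intro φ hφ β h
  have hb : φ ∈ bddSeries := mem_bddSeries_of_tstar (supported_mono hS hφ)
  obtain ⟨γ, h1, h2⟩ := exists_of_coeff_gammaStar_sub_ne_zero hlen hb h
  exact ⟨γ, h1, homogRank_lt hα hlen (hS (hφ γ h1)) h2⟩

/-- A general support S is allowed because surjectivity is needed both on `Tstar` and on the
supports `tiltSupport`, where inverse characters are constructed. -/
theorem gammaStar_surjOn (hα : 0 < α) (hlen : ∀ i : Fin 2, 0 < len (single i 1))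
    (f : Character α len) {S : Set MIdx} (hS : S ⊆ tstarIdx)
    (hmem : ∀ φ ∈ supported S, gammaStar f φ ∈ supported S) {ψ : PS} (hψ : ψ ∈ supported S) :
    ∃ φ ∈ supported S, gammaStar f φ = ψ := by
  have hb : ∀ φ ∈ supported S, φ ∈ bddSeries := fun φ hφ =>
    mem_bddSeries_of_tstar (supported_mono hS hφ)
  obtain ⟨φ, h1, h2⟩ := exists_solution_of_triangular (N := fun φ => gammaStar f φ - φ)
    (fun φ hφ => sub_mem (hmem φ hφ) hφ)
    (fun φ hφ ψ hψ => by rw [gammaStar_sub hlen f (hb φ hφ) (hb ψ hψ)]; abel)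
    (homogRank_gammaStar_sub hα hlen f hS) hψ
  exact ⟨φ, h1, by rw [← h2]; abel⟩

theorem gammaStar_eq_zero (hα : 0 < α) (hlen : ∀ i : Fin 2, 0 < len (single i 1))
    (f : Character α len) {φ : PS} (hφ : φ ∈ Tstar) (h : gammaStar f φ = 0) : φ = 0 :=
  eq_zero_of_triangular (N := fun φ => gammaStar f φ - φ)
    (homogRank_gammaStar_sub hα hlen f le_rfl) hφ (by rw [h]; abel)

/-- `Γ_f^*` as a linear endomorphism of `T^*`. -/
def gammaLinear (hlen : ∀ i : Fin 2, 0 < len (single i 1)) (f : Character α len) :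
    Tstar →ₗ[ℝ] Tstar where
  toFun φ := ⟨gammaStar f φ, gammaStar_mem_tstar hlen f φ.2⟩
  map_add' φ ψ := Subtype.ext ((isTameHom_gammaStar hlen f).map_add _
    (mem_bddSeries_of_tstar φ.2) _ (mem_bddSeries_of_tstar ψ.2))
  map_smul' c φ := Subtype.ext ((isTameHom_gammaStar hlen f).map_smul c _
    (mem_bddSeries_of_tstar φ.2))

theorem exists_isGammaStar (hα : 0 < α) (hlen : ∀ i : Fin 2, 0 < len (single i 1))
    (f : Character α len) : ∃ E : Tstar ≃ₗ[ℝ] Tstar, IsGammaStar f E := by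
  refine ⟨LinearEquiv.ofBijective (gammaLinear hlen f) ⟨?_, ?_⟩, fun φ => rfl⟩
  · rw [← LinearMap.ker_eq_bot, LinearMap.ker_eq_bot']
    intro φ h
    exact Subtype.ext (gammaStar_eq_zero hα hlen f φ.2 (congrArg Subtype.val h))
  · intro ψ
    obtain ⟨φ, h1, h2⟩ := gammaStar_surjOn hα hlen f (S := tstarIdx) le_rfl
      (fun φ hφ => gammaStar_mem_tstar hlen f hφ) ψ.2
    exact ⟨⟨φ, h1⟩, Subtype.ext h2⟩

end

section

variable {α : ℝ} {len : N2 →+ ℝ}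

/-! ### Translation of polynomials in `x` -/

/-- The translation `p ↦ p(· + h)`. -/
def polyShift (h : Fin 2 → ℝ) : MvPolynomial (Fin 2) ℝ →ₐ[ℝ] MvPolynomial (Fin 2) ℝ :=
  MvPolynomial.aeval fun i => MvPolynomial.X i + MvPolynomial.C (h i)

theorem polyShift_comp (h h' : Fin 2 → ℝ) :
    (polyShift h').comp (polyShift h) = polyShift (h + h') := by
  refine MvPolynomial.algHom_ext fun i => ?_
  simp [polyShift, MvPolynomial.algebraMap_eq]
  ring

/-- The coefficient `binom(m, n) h^{m-n}` of `x^n` in `(x+h)^m`. -/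
def shiftCoeff (h : Fin 2 → ℝ) (m n : N2) : ℝ := binom m n * hpow h (m - n)

theorem shiftCoeff_eq_zero (h : Fin 2 → ℝ) {m n : N2} (hmn : ¬ n ≤ m) : shiftCoeff h m n = 0 := by
  obtain ⟨i, hi⟩ : ∃ i, m i < n i := by
    by_contra! hc
    exact hmn hc
  rw [shiftCoeff, binom, Finset.prod_eq_zero (Finset.mem_univ i) (Nat.choose_eq_zero_of_lt hi)]
  simp

theorem shiftCoeff_self (h : Fin 2 → ℝ) (m : N2) : shiftCoeff h m m = 1 := by
  simp [shiftCoeff, binom_self, hpow_zero]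

theorem X_add_C_pow (h : ℝ) (i : Fin 2) (k : ℕ) :
    (MvPolynomial.X i + MvPolynomial.C h : MvPolynomial (Fin 2) ℝ) ^ k =
      ∑ j ∈ Finset.range (k + 1), MvPolynomial.monomial (single i j) (h ^ (k - j) * k.choose j) := by
  rw [add_pow]
  refine Finset.sum_congr rfl fun j _ => ?_
  rw [MvPolynomial.X_pow_eq_monomial, ← map_pow, ← map_natCast (MvPolynomial.C (σ := Fin 2)),
    mul_assoc, ← map_mul, mul_comm, MvPolynomial.C_mul_monomial, mul_one]

theorem coeff_polyShift_monomial (h : Fin 2 → ℝ) (m n : N2) :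
    MvPolynomial.coeff n (polyShift h (MvPolynomial.monomial m 1)) = shiftCoeff h m n := by
  classical
  rw [polyShift, MvPolynomial.aeval_monomial, map_one, one_mul,
    Finsupp.prod_fintype _ _ (fun _ => pow_zero _), Fin.prod_univ_two, X_add_C_pow, X_add_C_pow,
    Finset.sum_mul_sum, MvPolynomial.coeff_sum]
  simp only [MvPolynomial.coeff_sum, MvPolynomial.monomial_mul, MvPolynomial.coeff_monomial]
  have key : ∀ a b : ℕ, (single 0 a + single 1 b : N2) = n ↔ a = n 0 ∧ b = n 1 := by
    intro a b
    constructor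
    · rintro rfl
      simp
    · rintro ⟨rfl, rfl⟩
      ext i
      fin_cases i <;> simp
  simp only [key, ite_and]
  have h1 : shiftCoeff h m n = h 0 ^ (m 0 - n 0) * (m 0).choose (n 0) *
      (h 1 ^ (m 1 - n 1) * (m 1).choose (n 1)) := by
    simp [shiftCoeff, binom, hpow]
    ring
  by_cases h0 : n 0 ≤ m 0
  · by_cases h2 : n 1 ≤ m 1
    · simp [h1, Finset.sum_ite_eq', h0, h2]
    · have h3 : (m 1).choose (n 1) = 0 := Nat.choose_eq_zero_of_lt (by omega)
      simp [h1, Finset.sum_ite_eq', h2, h3]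
  · have h3 : (m 0).choose (n 0) = 0 := Nat.choose_eq_zero_of_lt (by omega)
    simp [h1, Finset.sum_ite_eq', h0, h3]

theorem coeff_polyShift (h : Fin 2 → ℝ) (p : MvPolynomial (Fin 2) ℝ) (n : N2) :
    MvPolynomial.coeff n (polyShift h p) =
      ∑ m ∈ p.support, MvPolynomial.coeff m p * shiftCoeff h m n := by
  conv_lhs => rw [p.as_sum, map_sum, MvPolynomial.coeff_sum]
  refine Finset.sum_congr rfl fun m _ => ?_
  have h1 : (MvPolynomial.monomial m (MvPolynomial.coeff m p) : MvPolynomial (Fin 2) ℝ) =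
      MvPolynomial.coeff m p • MvPolynomial.monomial m 1 := by
    rw [MvPolynomial.smul_monomial, smul_eq_mul, mul_one]
  rw [h1, map_smul, MvPolynomial.coeff_smul, coeff_polyShift_monomial, smul_eq_mul]

/-- Both sides are the coefficient of x^n in (x + h + h')^m, read off from translation by h followed
by h'. -/
theorem finsum_shiftCoeff (h h' : Fin 2 → ℝ) (m n : N2) :
    ∑ᶠ l, shiftCoeff h m l * shiftCoeff h' l n = shiftCoeff (h + h') m n := by
  rw [← coeff_polyShift_monomial (h + h'), ← polyShift_comp, AlgHom.comp_apply, coeff_polyShift]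
  simp only [coeff_polyShift_monomial]
  refine finsum_eq_sum_of_support_subset _ fun l hl => ?_
  simp only [Finset.mem_coe, MvPolynomial.mem_support_iff, coeff_polyShift_monomial]
  exact left_ne_zero_of_mul hl

/-! ### Characters are determined by their series -/

theorem coeff_shiftPart_single (h : Fin 2 → ℝ) (n : N2) (m : {m : N2 // m ≠ 0}) :
    MvPowerSeries.coeff (single (Sum.inr m) 1) (shiftPart h n) =
      (open Classical in if n < m.1 then shiftCoeff h m.1 n else 0) :=
  coeff_linSeries_single _ m

theorem coeff_shiftPart_eq_zero (h : Fin 2 → ℝ) (n : N2) {γ : MIdx} (hγ : 0 ≤ bracket γ) :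
    MvPowerSeries.coeff γ (shiftPart h n) = 0 := by
  by_contra hc
  obtain ⟨m, rfl, -⟩ := exists_of_coeff_shiftPart_ne_zero hc
  rw [bracket_single] at hγ
  exact absurd hγ (by simp [bracketWeight])

theorem coeff_tiltPart_single (t : TiltIdx α len → ℝ) (n : N2) (m : {m : N2 // m ≠ 0}) :
    MvPowerSeries.coeff (single (Sum.inr m) 1) (tiltPart t n) = 0 := by
  refine coeff_tiltPart_eq_zero t fun h => absurd h.1 ?_
  rw [bracket_single]
  simp [bracketWeight]

theorem coeff_tiltSeries_single (f : Character α len) (n : N2) (m : {m : N2 // m ≠ 0}) :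
    MvPowerSeries.coeff (single (Sum.inr m) 1) (tiltSeries f n) =
      (open Classical in if n < m.1 then shiftCoeff (shift f) m.1 n else 0) := by
  rw [tiltSeries_eq, map_add, coeff_tiltPart_single, zero_add, coeff_shiftPart_single]

theorem coeff_tiltSeries (f : Character α len) (y : TiltIdx α len) :
    MvPowerSeries.coeff y.1.1 (tiltSeries f y.1.2) = tilt f y := by
  rw [tiltSeries_eq, map_add, coeff_tiltPart _ y.2, coeff_shiftPart_eq_zero _ _ y.2.1, add_zero]

/-- At m = n + e_i the coefficient is linear in h_i with positive factor, so any single series π^(n)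
determines the shift. -/
theorem coeff_tiltSeries_add_single (f : Character α len) (n : N2) (i : Fin 2) :
    MvPowerSeries.coeff (single (Sum.inr ⟨n + single i 1, add_single_ne_zero n i⟩) 1)
      (tiltSeries f n) = (n i + 1) * shift f i := by
  classical
  have hlt : n < n + single i 1 := by
    refine lt_of_le_of_ne (self_le_add_right _ _) fun h => ?_
    have := DFunLike.congr_fun h i
    simp at this
  rw [coeff_tiltSeries_single, if_pos hlt, shiftCoeff]
  congr 1
  · rw [binom, Finset.prod_eq_single i (fun j _ hj => by simp [hj]) (by simp)]
    simp
  · rw [add_tsub_cancel_left, hpow,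
      Finset.prod_eq_single i (fun j _ hj => by simp [hj]) (by simp)]
    simp

theorem shift_eq_of_tiltSeries_eq {f g : Character α len} {n : N2}
    (h : tiltSeries f n = tiltSeries g n) : shift f = shift g := by
  funext i
  have h1 := coeff_tiltSeries_add_single f n i
  rw [h, coeff_tiltSeries_add_single] at h1
  exact (mul_left_cancel₀ (by positivity) h1).symm

theorem character_ext_tiltSeries {f g : Character α len}
    (h : ∀ n, tiltSeries f n = tiltSeries g n) : f = g := by
  refine character_ext (shift_eq_of_tiltSeries_eq (h 0)) ?_
  funext y
  rw [← coeff_tiltSeries, ← coeff_tiltSeries, h]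

theorem tiltSeries_charOf (h : Fin 2 → ℝ) (t : TiltIdx α len → ℝ) (n : N2) :
    tiltSeries (charOf h t) n = tiltPart t n + shiftPart h n := by
  rw [tiltSeries_eq, shift_charOf, tilt_charOf]

theorem tiltPart_zero (n : N2) : tiltPart (0 : TiltIdx α len → ℝ) n = 0 := by
  ext γ
  by_cases h : 0 ≤ bracket γ ∧ len n < homog α len γ
  · rw [coeff_tiltPart _ h]
    rfl
  · rw [coeff_tiltPart_eq_zero _ h]
    rfl

theorem shiftPart_zero_shift (n : N2) : shiftPart 0 n = 0 := by
  classical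
  refine (hasSum_linSeries _).unique (hasSum_zero.of_eq fun m => ?_)
  split_ifs with h
  · have : ∃ i, (m.1 - n) i ≠ 0 := by
      by_contra! hc
      have : m.1 ≤ n := fun i => by
        have := hc i
        rw [Finsupp.tsub_apply] at this
        omega
      exact absurd h (not_lt_of_ge this)
    obtain ⟨i, hi⟩ := this
    rw [hpow, Finset.prod_eq_zero (Finset.mem_univ i) (by rw [Pi.zero_apply, zero_pow hi]),
      mul_zero, zero_smul]
  · rw [zero_smul]

/-! ### The composition rule -/

theorem gammaStar_shiftPart (hlen : ∀ i : Fin 2, 0 < len (single i 1)) (f : Character α len)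
    (h : Fin 2 → ℝ) (n : N2) :
    HasSum (fun l : {l : N2 // l ≠ 0} => (open Classical in
      if n < l.1 then shiftCoeff h l.1 n else 0) • (zn l + tiltSeries f l.1))
      (gammaStar f (shiftPart h n)) := by
  classical
  have hT := isTameHom_gammaStar hlen f
  have hmem : ∀ l : {l : N2 // l ≠ 0}, zn l ∈ level (-1) := fun l => X_mem_level _
  refine (hT.map_hasSum (hasSum_linSeries _)
    fun l => Submodule.smul_mem _ _ (hmem l)).of_eq fun l => ?_
  rw [hT.map_smul _ _ ⟨_, hmem l⟩, gammaStar_zn hlen]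
  rfl

/-- The z_m-coefficient of z_l + π^(l) is the binomial shift coefficient for every l, including l =
m. The sum over l > n is the composition law of these coefficients without its term l = n. -/
theorem coeff_single_gammaStar_shiftPart (hlen : ∀ i : Fin 2, 0 < len (single i 1))
    (f : Character α len) (h : Fin 2 → ℝ) (n : N2) (m : {m : N2 // m ≠ 0}) :
    MvPowerSeries.coeff (single (Sum.inr m) 1) (gammaStar f (shiftPart h n)) =
      shiftCoeff (shift f + h) m.1 n - shiftCoeff (shift f) m.1 n := by
  classical
  have h1 : ∀ l : {l : N2 // l ≠ 0}, MvPowerSeries.coeff (single (Sum.inr m) 1)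
      (zn l + tiltSeries f l.1) = shiftCoeff (shift f) m.1 l.1 := by
    intro l
    rw [map_add, coeff_zn, coeff_tiltSeries_single]
    rcases eq_or_ne l m with rfl | hlm
    · simp [shiftCoeff_self]
    · rw [if_neg hlm, zero_add]
      split_ifs with hlt
      · rfl
      · rw [shiftCoeff_eq_zero]
        exact fun hle => hlt (lt_of_le_of_ne hle fun h' => hlm (Subtype.ext h'))
  rw [← (gammaStar_shiftPart hlen f h n).finsum_coeff]
  simp only [map_smul, h1, smul_eq_mul]
  have hfin : (Function.support fun l => shiftCoeff (shift f) m.1 l * shiftCoeff h l n).Finite := by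
    refine (Set.finite_Iic m.1).subset fun l hl => ?_
    by_contra hc
    exact left_ne_zero_of_mul hl (shiftCoeff_eq_zero _ hc)
  have hfin1 : (Function.support fun l => if l = n then shiftCoeff (shift f) m.1 n else 0).Finite :=
    (Set.finite_singleton n).subset fun l hl => by
      by_contra hc
      exact hl (if_neg hc)
  have h2 : ∑ᶠ l : N2, (if n < l then shiftCoeff h l n else 0) * shiftCoeff (shift f) m.1 l =
      shiftCoeff (shift f + h) m.1 n - shiftCoeff (shift f) m.1 n := by
    rw [← finsum_shiftCoeff]
    conv_rhs => rw [← (finsum_eq_single (fun l => if l = n then shiftCoeff (shift f) m.1 n else 0) n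
      (fun l hl => if_neg hl)).trans (if_pos rfl), ← finsum_sub_distrib hfin hfin1]
    refine finsum_congr fun l => ?_
    rcases eq_or_ne l n with rfl | hln
    · simp [shiftCoeff_self]
    · rw [if_neg hln, sub_zero]
      split_ifs with hlt
      · rw [mul_comm]
      · rw [zero_mul, shiftCoeff_eq_zero h fun hle => hlt (lt_of_le_of_ne hle hln.symm), mul_zero]
  rw [← h2]
  -- Including l = 0 changes nothing, since n < 0 is impossible.
  refine (finsum_subtype_eq_finsum_cond (f := fun l : N2 =>
    (if n < l then shiftCoeff h l n else 0) * shiftCoeff (shift f) m.1 l) (· ≠ 0)).trans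
    (finsum_congr fun l => ?_)
  rcases eq_or_ne l 0 with rfl | hl
  · simp
  · simp [hl]

theorem coeff_single_gammaStar_tiltSeries (hlen : ∀ i : Fin 2, 0 < len (single i 1))
    (f f' : Character α len) (n : N2) (m : {m : N2 // m ≠ 0}) :
    MvPowerSeries.coeff (single (Sum.inr m) 1) (gammaStar f (tiltSeries f' n)) =
      shiftCoeff (shift f + shift f') m.1 n - shiftCoeff (shift f) m.1 n := by
  have hT := isTameHom_gammaStar hlen f
  have h0 : tiltPart (tilt f') n ∈ level 0 := fun γ hγ => (tiltPart_mem _ n γ hγ).1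
  rw [tiltSeries_eq, hT.map_add _ ⟨0, h0⟩ _ (mem_bddSeries_of_tstar (shiftPart_mem_tstar _ _)),
    map_add, coeff_single_gammaStar_shiftPart hlen, add_eq_right]
  by_contra hc
  have := hT.mem_level 0 _ h0 _ hc
  rw [Set.mem_ofPred, bracket_single] at this
  exact absurd this (by simp [bracketWeight])

theorem tiltSeries_mem_bddSeries (f : Character α len) (n : N2) : tiltSeries f n ∈ bddSeries :=
  mem_bddSeries_of_tstar (tiltSeries_mem_tstar f n)

/-- The character with series `π^(n) + Γ_f^* π'^(n)`. -/
def charComp (f f' : Character α len) : Character α len :=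
  charOf (shift f + shift f') fun y =>
    MvPowerSeries.coeff y.1.1 (tiltSeries f y.1.2 + gammaStar f (tiltSeries f' y.1.2))

theorem shift_charComp (f f' : Character α len) : shift (charComp f f') = shift f + shift f' :=
  shift_charOf _ _

/-- For [γ] ≥ 0 and |γ| > |n| the coefficients agree by construction; if |γ| ≤ |n| both sides
vanish, since Γ_f^* does not lower homogeneity. On the monomials z_m the shift coefficients compose.
-/
theorem tiltSeries_charComp (hlen : ∀ i : Fin 2, 0 < len (single i 1)) (f f' : Character α len)
    (n : N2) :
    tiltSeries (charComp f f') n = tiltSeries f n + gammaStar f (tiltSeries f' n) := by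
  classical
  have hmem : tiltSeries f n + gammaStar f (tiltSeries f' n) ∈ Tstar :=
    add_mem (tiltSeries_mem_tstar f n) (gammaStar_mem_tstar hlen f (tiltSeries_mem_tstar f' n))
  ext γ
  by_cases hγ : γ ∈ tstarIdx
  swap
  · have h1 : MvPowerSeries.coeff γ (tiltSeries (charComp f f') n) = 0 := by
      by_contra hc
      exact hγ (tiltSeries_mem_tstar _ n γ hc)
    rw [h1]
    by_contra hc
    exact hγ (hmem γ (Ne.symm hc))
  by_cases h0 : 0 ≤ bracket γ
  · by_cases h1 : len n < homog α len γ
    · rw [coeff_tiltSeries (charComp f f') ⟨(γ, n), h0, h1⟩, charComp, tilt_charOf]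
    · have h2 : MvPowerSeries.coeff γ (tiltSeries (charComp f f') n) = 0 := by
        by_contra hc
        exact h1 (len_lt_of_coeff_tiltSeries hlen hc)
      have h3 : MvPowerSeries.coeff γ (tiltSeries f n) = 0 := by
        by_contra hc
        exact h1 (len_lt_of_coeff_tiltSeries hlen hc)
      rw [h2, map_add, h3, zero_add]
      by_contra hc
      obtain ⟨-, δ, h4, h5⟩ := exists_of_coeff_gammaStar_ne_zero hlen
        (tiltSeries_mem_bddSeries f' n) (Ne.symm hc)
      exact h1 ((len_lt_of_coeff_tiltSeries hlen h4).trans_le h5)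
  · obtain ⟨m, rfl⟩ := hγ.resolve_left h0
    rw [map_add, coeff_single_gammaStar_tiltSeries hlen, coeff_tiltSeries_single,
      coeff_tiltSeries_single, shift_charComp]
    by_cases hlt : n < m.1
    · rw [if_pos hlt, if_pos hlt]
      ring
    · rw [if_neg hlt, if_neg hlt]
      rcases eq_or_ne n m.1 with rfl | hne
      · simp [shiftCoeff_self]
      · have hle : ¬ n ≤ m.1 := fun hle => hlt (lt_of_le_of_ne hle hne)
        rw [shiftCoeff_eq_zero _ hle, shiftCoeff_eq_zero _ hle]
        ring

theorem gammaStar_translate (hlen : ∀ i : Fin 2, 0 < len (single i 1)) (f : Character α len)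
    (k : ℕ) {ρ : PS} (hρ : ρ ∈ level (-1)) :
    gammaStar f (translate k ρ) = translate k (tiltSeries f 0 + gammaStar f ρ) := by
  have hT := isTameHom_gammaStar hlen f
  have hρb : ρ ∈ bddSeries := ⟨_, hρ⟩
  -- The possible loss of l in the bracket of ρ^l is made up by the index of z_{k+l}, so all terms
  -- lie in one level, as `map_hasSum` requires.
  have hmem : ∀ l, ρ ^ l * zk (k + l) ∈ level k := by
    intro l
    convert mul_mem_level (pow_mem_level hρ l) (X_mem_level (Sum.inl (k + l))) using 2
    simp [bracketWeight]
  have h1 := hT.map_hasSum (hasSum_translate k ρ) fun l => Submodule.smul_mem _ _ (hmem l)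
  rw [add_comm]
  refine h1.unique ((hasSum_translate_add k (gammaStar f ρ) (tiltSeries f 0)).of_eq fun l => ?_)
  rw [hT.map_smul _ _ ⟨_, hmem l⟩, hT.map_mul _ (pow_mem hρb l) _ (X_mem_bddSeries _),
    hT.map_pow hρb, gammaStar_zk hlen]

/-- Both sides are tame morphisms, so the relation between the series need only be tested on
variables; for z_k it is again the semigroup law of translation. -/
theorem gammaStar_comp (hlen : ∀ i : Fin 2, 0 < len (single i 1)) {f f' g : Character α len}
    (h : ∀ n, tiltSeries g n = tiltSeries f n + gammaStar f (tiltSeries f' n)) {φ : PS}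
    (hφ : φ ∈ bddSeries) : gammaStar g φ = gammaStar f (gammaStar f' φ) := by
  have hT := isTameHom_gammaStar hlen f
  refine (isTameHom_gammaStar hlen g).ext (hT.comp (isTameHom_gammaStar hlen f')) ?_ hφ
  rintro (k | n)
  · show gammaStar g (zk k) = gammaStar f (gammaStar f' (zk k))
    rw [gammaStar_zk hlen, gammaStar_zk hlen,
      gammaStar_translate hlen f k (tstar_le_level (tiltSeries_mem_tstar f' 0)), h]
  · show gammaStar g (zn n) = gammaStar f (gammaStar f' (zn n))
    rw [gammaStar_zn hlen, gammaStar_zn hlen, hT.map_add _ (X_mem_bddSeries _) _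
      (tiltSeries_mem_bddSeries f' _), gammaStar_zn hlen, h, add_assoc]

theorem gammaStar_charComp (hlen : ∀ i : Fin 2, 0 < len (single i 1)) (f f' : Character α len)
    {φ : PS} (hφ : φ ∈ bddSeries) :
    gammaStar (charComp f f') φ = gammaStar f (gammaStar f' φ) :=
  gammaStar_comp hlen (tiltSeries_charComp hlen f f') hφ

theorem eq_charComp (hlen : ∀ i : Fin 2, 0 < len (single i 1)) {f f' g : Character α len}
    (h : ∀ n, tiltSeries g n = tiltSeries f n + gammaStar f (tiltSeries f' n)) :
    g = charComp f f' :=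
  character_ext_tiltSeries fun n => (h n).trans (tiltSeries_charComp hlen f f' n).symm

/-! ### The unit and inverses -/

theorem tiltSeries_trivial (n : N2) : tiltSeries (charOf 0 0 : Character α len) n = 0 := by
  rw [tiltSeries_charOf, tiltPart_zero, shiftPart_zero_shift, add_zero]

theorem translate_zero (k : ℕ) : translate k 0 = zk k := by
  refine (hasSum_translate k 0).unique ?_
  have := hasSum_single (f := fun l => ((k + l).choose k : ℝ) • ((0 : PS) ^ l * zk (k + l))) 0
    (fun l hl => by rw [zero_pow hl, zero_mul, smul_zero])
  simpa using this

theorem gammaStar_trivial (hlen : ∀ i : Fin 2, 0 < len (single i 1)) {φ : PS}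
    (hφ : φ ∈ bddSeries) : gammaStar (charOf 0 0 : Character α len) φ = φ := by
  refine (isTameHom_gammaStar hlen _).ext IsTameHom.id ?_ hφ
  rintro (k | n)
  · show gammaStar _ (zk k) = zk k
    rw [gammaStar_zk hlen, tiltSeries_trivial, translate_zero]
  · show gammaStar _ (zn n) = zn n
    rw [gammaStar_zn hlen, tiltSeries_trivial, add_zero]

theorem tiltSupport_subset (n : N2) : tiltSupport α len n ⊆ tstarIdx := fun _ h => Or.inl h.1

theorem gammaStar_mem_tiltSupport (hlen : ∀ i : Fin 2, 0 < len (single i 1))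
    (f : Character α len) (n : N2) {φ : PS} (hφ : φ ∈ supported (tiltSupport α len n)) :
    gammaStar f φ ∈ supported (tiltSupport α len n) := by
  intro β hβ
  have hb : φ ∈ bddSeries := mem_bddSeries_of_tstar (supported_mono (tiltSupport_subset n) hφ)
  obtain ⟨⟨γ, h1, h2⟩, δ, h3, h4⟩ := exists_of_coeff_gammaStar_ne_zero hlen hb hβ
  exact ⟨(hφ γ h1).1.trans h2, (hφ δ h3).2.trans_le h4⟩

theorem tiltPart_coeff {n : N2} {φ : PS} (hφ : φ ∈ supported (tiltSupport α len n))
    (t : TiltIdx α len → ℝ) (ht : ∀ y, y.1.2 = n → t y = MvPowerSeries.coeff y.1.1 φ) :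
    tiltPart t n = φ := by
  ext γ
  by_cases h : 0 ≤ bracket γ ∧ len n < homog α len γ
  · rw [coeff_tiltPart _ h, ht _ rfl]
  · rw [coeff_tiltPart_eq_zero _ h]
    by_contra hc
    exact h (hφ γ (Ne.symm hc))

/-- Composition of f with the pure shift f₀ by -h has zero shift, so its series g^(n) lie in
`tiltSupport`. The triangular equation Γ_f^* w^(n) = -g^(n) is solvable there, and the series w^(n)
+ π_{f₀}^(n) belong to a right inverse of f. -/
theorem exists_inverse (hα : 0 < α) (hlen : ∀ i : Fin 2, 0 < len (single i 1))
    (f : Character α len) : ∃ f', shift f' = -shift f ∧ charComp f f' = charOf 0 0 := by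
  let f₀ : Character α len := charOf (-shift f) 0
  have hf₀ : ∀ n, tiltSeries f₀ n = shiftPart (-shift f) n := fun n => by
    rw [tiltSeries_charOf, tiltPart_zero, zero_add]
  have hg : ∀ n, tiltSeries (charComp f f₀) n ∈ supported (tiltSupport α len n) := by
    intro n
    rw [tiltSeries_eq, shift_charComp, shift_charOf, add_neg_cancel, shiftPart_zero_shift, add_zero]
    exact tiltPart_mem _ n
  choose w hw1 hw2 using fun n => gammaStar_surjOn hα hlen f (tiltSupport_subset n)
    (fun φ hφ => gammaStar_mem_tiltSupport hlen f n hφ) (neg_mem (hg n))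
  let f' : Character α len := charOf (-shift f) fun y => MvPowerSeries.coeff y.1.1 (w y.1.2)
  have hf' : ∀ n, tiltSeries f' n = w n + tiltSeries f₀ n := fun n => by
    rw [tiltSeries_charOf, hf₀, tiltPart_coeff (hw1 n) _ fun y hy => by rw [hy]]
  refine ⟨f', shift_charOf _ _, character_ext_tiltSeries fun n => ?_⟩
  have hwb : w n ∈ bddSeries :=
    mem_bddSeries_of_tstar (supported_mono (tiltSupport_subset n) (hw1 n))
  rw [tiltSeries_charComp hlen, hf', (isTameHom_gammaStar hlen f).map_add _ hwb _
    (tiltSeries_mem_bddSeries _ _), hw2, tiltSeries_charComp hlen, tiltSeries_trivial]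
  abel

/-- All series involved are linear in the variables z_n, so no coefficient with [γ] ≥ 0 arises. -/
theorem charComp_pureShift (hlen : ∀ i : Fin 2, 0 < len (single i 1)) (h h' : Fin 2 → ℝ) :
    charComp (charOf h 0 : Character α len) (charOf h' 0) = charOf (h + h') 0 := by
  classical
  refine character_ext (by rw [shift_charComp, shift_charOf, shift_charOf, shift_charOf]) ?_
  funext y
  have hs : ∀ (h : Fin 2 → ℝ) n, tiltSeries (charOf h 0 : Character α len) n = shiftPart h n :=
    fun h n => by rw [tiltSeries_charOf, tiltPart_zero, zero_add]
  rw [tilt_charOf, ← coeff_tiltSeries, tiltSeries_charComp hlen, map_add, hs, hs,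
    coeff_shiftPart_eq_zero _ _ y.2.1, zero_add, Pi.zero_apply]
  by_contra hc
  obtain ⟨l, hl⟩ := (gammaStar_shiftPart hlen _ h' y.1.2).exists_coeff_ne_zero hc
  rw [map_smul, map_add, hs, coeff_shiftPart_eq_zero _ _ y.2.1, coeff_zn_eq_zero, add_zero,
    smul_zero] at hl
  · exact hl rfl
  · rintro m hm
    have := y.2.1
    rw [hm, bracket_single] at this
    exact absurd this (by simp [bracketWeight])

end

/-! ### Values of power series at (a, p) -/

section
variable {α : ℝ} {len : N2 →+ ℝ}

/-- The value `z^γ[a,p]` of a monomial. -/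
def monoValue (a : Polynomial ℝ) (p : MvPowerSeries (Fin 2) ℝ) (γ : MIdx) : ℝ :=
  γ.prod fun i c => coord a p i ^ c

section Value

variable {a : Polynomial ℝ} {p : MvPowerSeries (Fin 2) ℝ} {φ ψ : PS} {v w : ℝ}

theorem hasValue_iff : HasValue φ a p v ↔
    HasSum (fun γ : MIdx => MvPowerSeries.coeff γ φ * monoValue a p γ) v := Iff.rfl

theorem monoValue_add (γ δ : MIdx) :
    monoValue a p (γ + δ) = monoValue a p γ * monoValue a p δ :=
  Finsupp.prod_add_index' (fun _ => pow_zero _) fun _ _ _ => pow_add _ _ _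

theorem monoValue_eq_zero {γ : MIdx} {i : Idx} (hi : coord a p i = 0) (hγ : γ i ≠ 0) :
    monoValue a p γ = 0 :=
  Finset.prod_eq_zero (Finsupp.mem_support_iff.2 hγ) (by simp [hi, hγ])

/-- Coefficients of monomials that vanish at (a, p) are irrelevant. For polynomial a or p this
reduces the infinite series of `translate` and `shiftPart` to finite sums. -/
theorem hasValue_congr (h : ∀ γ, monoValue a p γ ≠ 0 →
    MvPowerSeries.coeff γ φ = MvPowerSeries.coeff γ ψ) :
    HasValue φ a p v ↔ HasValue ψ a p v := by
  rw [hasValue_iff, hasValue_iff]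
  refine iff_of_eq (congrArg (fun F => HasSum F v) (funext fun γ => ?_))
  by_cases hγ : monoValue a p γ = 0
  · rw [hγ, mul_zero, mul_zero]
  · rw [h γ hγ]

theorem HasValue.add (hφ : HasValue φ a p v) (hψ : HasValue ψ a p w) :
    HasValue (φ + ψ) a p (v + w) := by
  rw [hasValue_iff] at *
  simpa only [map_add, add_mul] using HasSum.add hφ hψ

theorem HasValue.smul (r : ℝ) (hφ : HasValue φ a p v) : HasValue (r • φ) a p (r * v) := by
  rw [hasValue_iff] at *
  simpa only [map_smul, smul_eq_mul, mul_assoc] using HasSum.mul_left r hφ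

theorem hasValue_monomial (γ : MIdx) (r : ℝ) :
    HasValue (MvPowerSeries.monomial γ r) a p (r * monoValue a p γ) := by
  classical
  rw [hasValue_iff]
  convert hasSum_single (f := fun δ => MvPowerSeries.coeff δ (MvPowerSeries.monomial γ r) *
    monoValue a p δ) γ fun δ hδ => ?_ using 1
  · rw [MvPowerSeries.coeff_monomial_same]
  · rw [MvPowerSeries.coeff_monomial_ne hδ, zero_mul]

theorem hasValue_one : HasValue 1 a p 1 := by
  simpa [monoValue] using hasValue_monomial (a := a) (p := p) 0 1

theorem hasValue_X (i : Idx) : HasValue (MvPowerSeries.X i) a p (coord a p i) := by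
  simpa [monoValue, MvPowerSeries.X_def] using hasValue_monomial (a := a) (p := p) (single i 1) 1

theorem hasSum_cauchyProduct {A : Type*} [AddCommMonoid A] [Finset.HasAntidiagonal A]
    {F G : A → ℝ} {v w : ℝ} (hF : HasSum F v) (hG : HasSum G w) :
    HasSum (fun γ => ∑ x ∈ antidiagonal γ, F x.1 * G x.2) (v * w) := by
  have hs := summable_mul_of_summable_norm hF.summable.norm hG.summable.norm
  have h2 := hF.summable.tsum_mul_tsum_eq_tsum_sum_antidiagonal hG.summable hs
  rw [hF.tsum_eq, hG.tsum_eq] at h2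
  rw [h2]
  exact (summable_sum_mul_antidiagonal_of_summable_mul hs).hasSum

theorem HasValue.mul (hφ : HasValue φ a p v) (hψ : HasValue ψ a p w) :
    HasValue (φ * ψ) a p (v * w) := by
  classical
  have key := hasSum_cauchyProduct (hasValue_iff.1 hφ) (hasValue_iff.1 hψ)
  rw [hasValue_iff]
  convert key using 2 with γ
  rw [MvPowerSeries.coeff_mul, Finset.sum_mul]
  refine Finset.sum_congr rfl fun x hx => ?_
  rw [← mem_antidiagonal.1 hx, monoValue_add]
  ring

theorem HasValue.pow (hφ : HasValue φ a p v) (l : ℕ) : HasValue (φ ^ l) a p (v ^ l) := by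
  induction l with
  | zero => simpa using hasValue_one
  | succ l ih => simpa only [pow_succ] using ih.mul hφ

theorem HasValue.sum {ι : Type*} (s : Finset ι) {F : ι → PS} {c : ι → ℝ}
    (h : ∀ i ∈ s, HasValue (F i) a p (c i)) : HasValue (∑ i ∈ s, F i) a p (∑ i ∈ s, c i) := by
  simp only [hasValue_iff, map_sum, Finset.sum_mul] at *
  exact hasSum_sum h

theorem hasValue_aeval {F : Idx → PS} {c : Idx → ℝ} (h : ∀ i, HasValue (F i) a p (c i))
    (P : MvPolynomial Idx ℝ) :
    HasValue (MvPolynomial.aeval F P) a p (MvPolynomial.eval c P) := by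
  induction P using MvPolynomial.induction_on with
  | C r =>
    rw [MvPolynomial.aeval_C, MvPolynomial.eval_C, Algebra.algebraMap_eq_smul_one]
    simpa using hasValue_one.smul r
  | add P Q hP hQ => simpa only [map_add] using hP.add hQ
  | mul_X P i hP =>
    simpa only [map_mul, MvPolynomial.aeval_X, MvPolynomial.eval_X] using hP.mul (h i)

theorem coeff_translate_comp (a : Polynomial ℝ) (c : ℝ) (k : ℕ) :
    (a.comp (Polynomial.X + Polynomial.C c)).coeff k =
      ∑ l ∈ Finset.range (a.natDegree + 1), ((k + l).choose k : ℝ) * (c ^ l * a.coeff (k + l)) := by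
  rw [← Polynomial.taylor_apply, Polynomial.taylor_coeff, Polynomial.eval_eq_sum_range'
    (n := a.natDegree + 1)]
  · refine Finset.sum_congr rfl fun l _ => ?_
    rw [Polynomial.hasseDeriv_coeff, add_comm l k]
    ring
  · exact lt_of_le_of_lt (Polynomial.natDegree_hasseDeriv_le a k) (by omega)

/-- The series `∑_l binom(k + l, k) ρ^l z_{k + l}` has as value the `k`-th coefficient of the
translated polynomial. -/
theorem hasValue_translate {ρ : PS} {c : ℝ} (k : ℕ) (hρ : HasValue ρ a p c) :
    HasValue (translate k ρ) a p ((a.comp (Polynomial.X + Polynomial.C c)).coeff k) := by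
  rw [coeff_translate_comp]
  have hfin : HasValue (∑ l ∈ Finset.range (a.natDegree + 1),
      ((k + l).choose k : ℝ) • (ρ ^ l * zk (k + l))) a p
      (∑ l ∈ Finset.range (a.natDegree + 1), ((k + l).choose k : ℝ) * (c ^ l * a.coeff (k + l))) :=
    HasValue.sum _ fun l _ => ((hρ.pow l).mul (hasValue_X _)).smul _
  -- Terms with l beyond the degree of `a` contain a variable z_{k+l} whose value is zero.
  refine (hasValue_congr fun γ hγ => ?_).2 hfin
  rw [← (hasSum_translate k ρ).finsum_coeff γ, map_sum]
  refine finsum_eq_sum_of_support_subset _ fun l hl => ?_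
  rw [Finset.coe_range, Set.mem_Iio]
  by_contra hlt
  refine hl ?_
  have hz : γ (Sum.inl (k + l)) = 0 := by
    by_contra hne
    exact hγ (monoValue_eq_zero (i := Sum.inl (k + l))
      (Polynomial.coeff_eq_zero_of_natDegree_lt (by omega)) hne)
  show MvPowerSeries.coeff γ _ = 0
  rw [map_smul, coeff_mul_X_eq_zero _ hz, smul_zero]

end Value

theorem gammaStar_coe (hlen : ∀ i : Fin 2, 0 < len (single i 1)) (f : Character α len)
    (P : MvPolynomial Idx ℝ) : gammaStar f (P : PS) =
      MvPolynomial.aeval (fun i : Idx => gammaStar f (MvPowerSeries.X i)) P :=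
  (isTameHom_gammaStar hlen f).map_coe P

/-- Γ_f^* substitutes its values on the variables, and evaluation respects sums and products. It
remains to evaluate these images: they give the coefficients of a(· + c_0) and of p + ∑ c_n x^n. -/
theorem hasValue_gammaStar (hlen : ∀ i : Fin 2, 0 < len (single i 1)) (f : Character α len)
    (P : MvPolynomial Idx ℝ) {a : Polynomial ℝ} {p : MvPowerSeries (Fin 2) ℝ} {c : N2 → ℝ}
    (hc : ∀ n, HasValue (tiltSeries f n) a p (c n)) :
    HasValue (gammaStar f (P : PS)) a p
      (polyValue P (a.comp (Polynomial.X + Polynomial.C (c 0))) (p + tiltBy c)) := by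
  rw [gammaStar_coe hlen]
  refine hasValue_aeval ?_ P
  rintro (k | n)
  · have h := hasValue_translate k (hc 0)
    rwa [← gammaStar_zk hlen] at h
  · have h := (hasValue_X (Sum.inr n)).add (hc n.1)
    rw [← gammaStar_zn hlen f n] at h
    convert h using 1
    show MvPowerSeries.coeff n.1 (p + tiltBy c) = MvPowerSeries.coeff n.1 p + c n.1
    rw [map_add]
    congr 1
    exact if_neg n.2

/-- The values of the series of pure shift type. -/
theorem hasValue_shiftPart (h : Fin 2 → ℝ) (n : N2) (a : Polynomial ℝ)
    (p : MvPolynomial (Fin 2) ℝ) :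
    HasValue (shiftPart h n) a p (open Classical in ∑ m ∈ p.support.subtype (· ≠ 0),
      (if n < m.1 then shiftCoeff h m.1 n else 0) * MvPolynomial.coeff m.1 p) := by
  classical
  have hfin : HasValue (∑ m ∈ p.support.subtype (· ≠ 0),
      (if n < m.1 then shiftCoeff h m.1 n else 0) • zn m) a p
      (∑ m ∈ p.support.subtype (· ≠ 0),
        (if n < m.1 then shiftCoeff h m.1 n else 0) * MvPolynomial.coeff m.1 p) :=
    HasValue.sum _ fun m _ => (hasValue_X _).smul _
  refine (hasValue_congr fun γ hγ => ?_).2 hfin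
  rw [shiftPart, ← (hasSum_linSeries _).finsum_coeff γ, map_sum]
  refine finsum_eq_sum_of_support_subset _ fun m hm => ?_
  rw [Finset.mem_coe, Finset.mem_subtype, MvPolynomial.mem_support_iff]
  intro h0
  refine hm ?_
  have hz : γ (Sum.inr m) = 0 := by
    by_contra hne
    exact hγ (monoValue_eq_zero (i := Sum.inr m) h0 hne)
  show MvPowerSeries.coeff γ _ = 0
  rw [map_smul, ← one_mul (zn m), coeff_mul_X_eq_zero _ hz, smul_zero]

theorem exists_hasValue_tiltSeries (f : Character α len) (n : N2)
    (hfin : {y : TiltIdx α len | y.1.2 = n ∧ tilt f y ≠ 0}.Finite) (a : Polynomial ℝ)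
    (p : MvPolynomial (Fin 2) ℝ) : ∃ v, HasValue (tiltSeries f n) a p v := by
  classical
  have h1 : ∃ v, HasValue (tiltPart (tilt f) n) a p v := by
    refine ⟨_, (summable_of_hasFiniteSupport ((hfin.image fun y => y.1.1).subset
      fun γ hγ => ?_)).hasSum⟩
    have hγ' : MvPowerSeries.coeff γ (tiltPart (tilt f) n) ≠ 0 := fun h0 => hγ (by
      show MvPowerSeries.coeff γ (tiltPart (tilt f) n) * _ = 0
      rw [h0, zero_mul])
    by_cases hy : 0 ≤ bracket γ ∧ len n < homog α len γ
    · rw [coeff_tiltPart _ hy] at hγ'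
      exact ⟨⟨(γ, n), hy⟩, ⟨rfl, hγ'⟩, rfl⟩
    · exact absurd (dif_neg hy) hγ'
  obtain ⟨v, hv⟩ := h1
  exact ⟨_, by rw [tiltSeries_eq]; exact hv.add (hasValue_shiftPart _ n a p)⟩

/-- In the expansion of p(· + h) the diagonal term m = n gives the coefficient of p, and the terms m
> n give the value of π^(n). The condition p(0) = 0 makes the sum over nonzero exponents the full
sum, which matters at n = 0. -/
theorem coeff_polyShift_eq_add (h : Fin 2 → ℝ) (n : N2) (p : MvPolynomial (Fin 2) ℝ)
    (hp : MvPolynomial.constantCoeff p = 0) :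
    MvPolynomial.coeff n (polyShift h p) = MvPolynomial.coeff n p +
      (open Classical in ∑ m ∈ p.support.subtype (· ≠ 0),
        (if n < m.1 then shiftCoeff h m.1 n else 0) * MvPolynomial.coeff m.1 p) := by
  classical
  have hne : ∀ m ∈ p.support, m ≠ 0 := by
    rintro m hm rfl
    exact MvPolynomial.mem_support_iff.1 hm hp
  rw [Finset.sum_subtype_of_mem (fun m : N2 => (if n < m then shiftCoeff h m n else 0) *
    MvPolynomial.coeff m p) hne, coeff_polyShift]
  have h1 : MvPolynomial.coeff n p =
      ∑ m ∈ p.support, if n = m then MvPolynomial.coeff m p else 0 := by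
    rw [Finset.sum_ite_eq]
    split_ifs with hn
    · rfl
    · exact MvPolynomial.notMem_support_iff.1 hn
  rw [h1, ← Finset.sum_add_distrib]
  refine Finset.sum_congr rfl fun m _ => ?_
  rcases eq_or_ne n m with rfl | hnm
  · simp [shiftCoeff_self]
  · by_cases hle : n ≤ m
    · rw [if_neg hnm, if_pos (lt_of_le_of_ne hle hnm)]
      ring
    · rw [if_neg hnm, if_neg fun hlt => hle hlt.le, shiftCoeff_eq_zero h hle]
      ring

theorem coeff_zero_polyShift (h : Fin 2 → ℝ) (p : MvPolynomial (Fin 2) ℝ) :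
    MvPolynomial.coeff 0 (polyShift h p) = MvPolynomial.eval h p := by
  rw [← MvPolynomial.constantCoeff_eq, polyShift]
  induction p using MvPolynomial.induction_on with
  | C r => simp
  | add P Q hP hQ => simp only [map_add, hP, hQ]
  | mul_X P i hP => simp only [map_mul, hP, MvPolynomial.aeval_X, MvPolynomial.eval_X, map_add,
      MvPolynomial.constantCoeff_X, MvPolynomial.constantCoeff_C, zero_add]

/-- The action of a pure shift on polynomial functionals. -/
theorem hasValue_gammaStar_pureShift (hlen : ∀ i : Fin 2, 0 < len (single i 1))
    {f : Character α len} (hf : tilt f = 0) (P : MvPolynomial Idx ℝ) (a : Polynomial ℝ)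
    (p : MvPolynomial (Fin 2) ℝ) (hp : MvPolynomial.constantCoeff p = 0) :
    HasValue (gammaStar f (P : PS)) a p
      (polyValue P (a.comp (Polynomial.X + Polynomial.C (MvPolynomial.eval (shift f) p)))
        ((polyShift (shift f) p - MvPolynomial.C (MvPolynomial.eval (shift f) p) :
          MvPolynomial (Fin 2) ℝ) : MvPowerSeries (Fin 2) ℝ)) := by
  classical
  have key := hasValue_gammaStar hlen f P (a := a) (p := p)
    (c := fun n => ∑ m ∈ p.support.subtype (· ≠ 0),
      (if n < m.1 then shiftCoeff (shift f) m.1 n else 0) * MvPolynomial.coeff m.1 p) fun n => by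
    rw [tiltSeries_eq, hf, tiltPart_zero, zero_add]
    exact hasValue_shiftPart _ n a p
  convert key using 1
  -- At n = 0 the identity shows that the value of π^(0), the amount of translation of `a`, is p(h).
  have h0 := coeff_polyShift_eq_add (shift f) 0 p hp
  rw [coeff_zero_polyShift, ← MvPolynomial.constantCoeff_eq, hp, zero_add] at h0
  rw [h0, polyValue, polyValue]
  congr 2
  funext i
  rcases i with k | n
  · rfl
  · have hn := coeff_polyShift_eq_add (shift f) n.1 p hp
    show MvPowerSeries.coeff n.1 _ = MvPowerSeries.coeff n.1 _
    rw [map_add, MvPolynomial.coeff_coe, MvPolynomial.coeff_sub, hn, MvPolynomial.coeff_C,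
      if_neg n.2.symm, sub_zero, MvPolynomial.coeff_coe]
    congr 1
    exact (if_neg n.2).symm

end

section
variable {α : ℝ} {len : N2 →+ ℝ}

/-! ### The structure group -/

theorem IsGammaStar.unique {f : Character α len} {E E' : Tstar ≃ₗ[ℝ] Tstar}
    (h : IsGammaStar f E) (h' : IsGammaStar f E') : E = E' :=
  LinearEquiv.ext fun φ => Subtype.ext ((h φ).trans (h' φ).symm)

theorem IsGammaStar.mul (hlen : ∀ i : Fin 2, 0 < len (single i 1)) {f f' : Character α len}
    {E E' : Tstar ≃ₗ[ℝ] Tstar} (h : IsGammaStar f E) (h' : IsGammaStar f' E') :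
    IsGammaStar (charComp f f') (E * E') := fun φ => by
  rw [gammaStar_charComp hlen f f' (mem_bddSeries_of_tstar φ.2), ← h' φ, ← h (E' φ)]
  rfl

theorem isGammaStar_one (hlen : ∀ i : Fin 2, 0 < len (single i 1)) :
    IsGammaStar (charOf 0 0 : Character α len) 1 := fun φ =>
  (gammaStar_trivial hlen (mem_bddSeries_of_tstar φ.2)).symm

theorem IsGammaStar.inv (hα : 0 < α) (hlen : ∀ i : Fin 2, 0 < len (single i 1))
    {f f' : Character α len} {E : Tstar ≃ₗ[ℝ] Tstar} (h : IsGammaStar f E)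
    (hf : charComp f f' = charOf 0 0) : IsGammaStar f' E⁻¹ := by
  -- The product `E * E'` represents the trivial character, so uniqueness identifies `E'` with
  -- `E⁻¹`.
  obtain ⟨E', h'⟩ := exists_isGammaStar hα hlen f'
  have h1 := h.mul hlen h'
  rw [hf] at h1
  rwa [inv_eq_of_mul_eq_one_right (h1.unique (isGammaStar_one hlen))]

/-- The subgroup of automorphisms `Γ_f^*` with `f` in a set closed under composition and
inversion. -/
def gammaSubgroup (hα : 0 < α) (hlen : ∀ i : Fin 2, 0 < len (single i 1))
    (S : Set (Character α len)) (h1 : charOf 0 0 ∈ S)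
    (h2 : ∀ f ∈ S, ∀ f' ∈ S, charComp f f' ∈ S)
    (h3 : ∀ f ∈ S, ∃ f' ∈ S, charComp f f' = charOf 0 0) : Subgroup (Tstar ≃ₗ[ℝ] Tstar) where
  carrier := {E | ∃ f ∈ S, IsGammaStar f E}
  one_mem' := ⟨_, h1, isGammaStar_one hlen⟩
  mul_mem' := fun ⟨f, hf, h⟩ ⟨f', hf', h'⟩ => ⟨_, h2 f hf f' hf', h.mul hlen h'⟩
  inv_mem' := fun ⟨f, hf, h⟩ =>
    let ⟨f', hf', h'⟩ := h3 f hf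
    ⟨f', hf', h.inv hα hlen h'⟩

theorem eq_charOf_of_tilt_eq_zero {f : Character α len} (hf : tilt f = 0) :
    f = charOf (shift f) 0 :=
  character_ext (shift_charOf _ _).symm (hf.trans (tilt_charOf _ _).symm)

theorem zn_mem_tstar (n : {n : N2 // n ≠ 0}) : zn n ∈ Tstar :=
  zpow_mem_supported (Or.inr ⟨n, rfl⟩)

theorem shift_eq_of_isGammaStar (hlen : ∀ i : Fin 2, 0 < len (single i 1))
    {f g : Character α len} {E : Tstar ≃ₗ[ℝ] Tstar} (hf : IsGammaStar f E)
    (hg : IsGammaStar g E) : shift f = shift g := by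
  -- Any nonzero exponent would do: the image of z_n reveals π^(n), and π^(n) reveals the shift.
  let n : {n : N2 // n ≠ 0} := ⟨single 0 1, by simp⟩
  have h := (hf ⟨zn n, zn_mem_tstar n⟩).symm.trans (hg ⟨zn n, zn_mem_tstar n⟩)
  change gammaStar f (zn n) = gammaStar g (zn n) at h
  rw [gammaStar_zn hlen, gammaStar_zn hlen] at h
  exact shift_eq_of_tiltSeries_eq (add_left_cancel h)

/-- Each subgroup comes from a class of characters closed under `charComp` and containing right
inverses: all of them, those without tilt, those without shift. On pure shifts composition adds the
parameters, and h is recovered from the automorphism, which makes the correspondence bijective. -/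
theorem exists_structureGroup (hα : 0 < α) (hlen : ∀ i : Fin 2, 0 < len (single i 1)) :
    ∃ G Gbar Gtilde : Subgroup (Tstar ≃ₗ[ℝ] Tstar),
      (G : Set (Tstar ≃ₗ[ℝ] Tstar)) = {E | ∃ f : Character α len, IsGammaStar f E} ∧
      (Gbar : Set (Tstar ≃ₗ[ℝ] Tstar)) =
        {E | ∃ f : Character α len, tilt f = 0 ∧ IsGammaStar f E} ∧
      (Gtilde : Set (Tstar ≃ₗ[ℝ] Tstar)) =
        {E | ∃ f : Character α len, shift f = 0 ∧ IsGammaStar f E} ∧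
      Gbar ≤ G ∧ Gtilde ≤ G ∧
      ∃ e : Multiplicative (Fin 2 → ℝ) ≃* Gbar, ∀ f : Character α len, tilt f = 0 →
        IsGammaStar f (e (Multiplicative.ofAdd (shift f)) : Tstar ≃ₗ[ℝ] Tstar) := by
  let G := gammaSubgroup hα hlen Set.univ trivial (fun _ _ _ _ => trivial) fun f _ =>
    let ⟨f', _, h⟩ := exists_inverse hα hlen f
    ⟨f', trivial, h⟩
  let Gbar := gammaSubgroup hα hlen {f | tilt f = 0} (tilt_charOf _ _)
    (fun f hf f' hf' => by
      rw [eq_charOf_of_tilt_eq_zero hf, eq_charOf_of_tilt_eq_zero hf', charComp_pureShift hlen]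
      exact tilt_charOf _ _)
    fun f hf => ⟨charOf (-shift f) 0, tilt_charOf _ _, by
      conv_lhs => rw [eq_charOf_of_tilt_eq_zero hf]
      rw [shift_charOf, charComp_pureShift hlen, add_neg_cancel]⟩
  let Gtilde := gammaSubgroup hα hlen {f | shift f = 0} (shift_charOf _ _)
    (fun f hf f' hf' => by
      show shift (charComp f f') = 0
      rw [shift_charComp, show shift f = 0 from hf, show shift f' = 0 from hf', add_zero])
    fun f hf =>
      let ⟨f', h, h'⟩ := exists_inverse hα hlen f
      ⟨f', by rw [Set.mem_ofPred_eq, h, show shift f = 0 from hf, neg_zero], h'⟩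
  choose E hE using fun h : Fin 2 → ℝ => exists_isGammaStar hα hlen (charOf h 0 : Character α len)
  have hmem : ∀ h, E h ∈ Gbar := fun h => ⟨charOf h 0, tilt_charOf _ _, hE h⟩
  let e₀ : Multiplicative (Fin 2 → ℝ) →* Gbar := MonoidHom.mk' (fun h => ⟨E h.toAdd, hmem _⟩)
    fun h h' => Subtype.ext ((hE _).unique (by
      have := (hE h.toAdd).mul hlen (hE h'.toAdd)
      rwa [charComp_pureShift hlen] at this))
  have he₀ : Function.Bijective e₀ := by
    constructor
    · intro h h' hh
      have h1 : E h.toAdd = E h'.toAdd := congrArg Subtype.val hh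
      have h2 := shift_eq_of_isGammaStar hlen (hE h.toAdd) (h1 ▸ hE h'.toAdd)
      rw [shift_charOf, shift_charOf] at h2
      exact h2
    · rintro ⟨E', f, hf, h⟩
      refine ⟨Multiplicative.ofAdd (shift f), Subtype.ext ((hE _).unique ?_)⟩
      rw [toAdd_ofAdd, ← eq_charOf_of_tilt_eq_zero hf]
      exact h
  refine ⟨G, Gbar, Gtilde, ?_, rfl, rfl, fun E ⟨f, _, h⟩ => ⟨f, trivial, h⟩,
    fun E ⟨f, _, h⟩ => ⟨f, trivial, h⟩, MulEquiv.ofBijective e₀ he₀, fun f hf => ?_⟩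
  · ext E
    exact ⟨fun ⟨f, _, h⟩ => ⟨f, h⟩, fun ⟨f, h⟩ => ⟨f, trivial, h⟩⟩
  · have := hE (shift f)
    rwa [← eq_charOf_of_tilt_eq_zero hf] at this

end

end ShiftTilt

end

/-! ### Assembly of the proposition -/

theorem mainTheorem3 (α : ℝ) (hα : 0 < α) (len : N2 →+ ℝ)
    (hlen : ∀ i : Fin 2, 0 < len (Finsupp.single i 1)) :
    -- parametrization of `Alg(T^+, ℝ)` by shift and tilt coefficients
    (Function.Bijective (fun f : Character α len => (shift f, tilt f)) ∧
      ∀ (f : Character α len) (x : JIdx α len),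
        f (Z x) = hpow (shift f) x.2 * x.1.prod fun y c => tilt f y ^ c) ∧
    -- `π^(n) ∈ T^*`
    (∀ (f : Character α len) (n : N2), tiltSeries f n ∈ Tstar) ∧
    -- the sum defining `Γ_f^*` is effectively finite and defines an automorphism of `T^*`
    (∀ β : MIdx, {x : JIdx α len |
        ∃ φ ∈ Tstar, MvPowerSeries.coeff β (dBasis x φ) ≠ 0}.Finite) ∧
    (∀ f : Character α len, ∃ E : Tstar ≃ₗ[ℝ] Tstar, IsGammaStar f E) ∧
    -- i) exponential formula, the sum being effectively finite
    (∀ (f : Character α len) (β : MIdx),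
      {x : Σ k : ℕ, (Fin k → N2) |
        ∃ φ ∈ Tstar, MvPowerSeries.coeff β (expTerm f φ x.1 x.2) ≠ 0}.Finite ∧
      ∀ φ ∈ Tstar, MvPowerSeries.coeff β (gammaStar f φ) =
        ∑ᶠ x : Σ k : ℕ, (Fin k → N2), MvPowerSeries.coeff β (expTerm f φ x.1 x.2)) ∧
    (∀ (f : Character α len) (k : ℕ) (β : MIdx),
      (Function.support fun l : ℕ => MvPowerSeries.coeff β
        (((k + l).choose k : ℝ) • (tiltSeries f 0 ^ l * zk (k + l)))).Finite ∧
      MvPowerSeries.coeff β (gammaStar f (zk k)) =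
        ∑ᶠ l : ℕ, MvPowerSeries.coeff β
          (((k + l).choose k : ℝ) • (tiltSeries f 0 ^ l * zk (k + l)))) ∧
    (∀ (f : Character α len) (n : {n : N2 // n ≠ 0}),
      gammaStar f (zn n) = zn n + tiltSeries f n.1) ∧
    -- ii) multiplicativity
    (∀ (f : Character α len) (k : ℕ) (φ : Fin k → PS),
      (∀ i, φ i ∈ Tstar) → ∏ i, φ i ∈ Tstar →
        gammaStar f (∏ i, φ i) = ∏ i, gammaStar f (φ i)) ∧
    -- iii) composition rule
    (∀ f f' : Character α len, ∃! g : Character α len,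
      ∀ n, tiltSeries g n = tiltSeries f n + gammaStar f (tiltSeries f' n)) ∧
    (∀ f f' g : Character α len,
      (∀ n, tiltSeries g n = tiltSeries f n + gammaStar f (tiltSeries f' n)) →
        shift g = shift f + shift f' ∧
        ∀ φ ∈ Tstar, gammaStar g φ = gammaStar f (gammaStar f' φ)) ∧
    -- iv) action on polynomial functionals: as an identity of formal power series,
    (∀ (f : Character α len) (P : MvPolynomial Idx ℝ), (P : PS) ∈ Tstar →
      gammaStar f (P : PS) =
        MvPolynomial.aeval (fun i : Idx => gammaStar f (MvPowerSeries.X i)) P) ∧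
    -- and evaluated at all `(a, p)` for which the values `c n = π^(n)[a,p]` make sense
    (∀ (f : Character α len) (P : MvPolynomial Idx ℝ), (P : PS) ∈ Tstar →
      ∀ (a : Polynomial ℝ) (p : MvPolynomial (Fin 2) ℝ) (c : N2 → ℝ),
        (∀ n, HasValue (tiltSeries f n) a p (c n)) →
        HasValue (gammaStar f (P : PS)) a p
          (polyValue P (a.comp (Polynomial.X + Polynomial.C (c 0)))
            ((p : MvPowerSeries (Fin 2) ℝ) + tiltBy c))) ∧
    -- (which is the case for all `(a, p)` if each `π^(n)` has finitely many tilt coefficients)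
    (∀ (f : Character α len) (n : N2), {y : TiltIdx α len | y.1.2 = n ∧ tilt f y ≠ 0}.Finite →
      ∀ (a : Polynomial ℝ) (p : MvPolynomial (Fin 2) ℝ), ∃ v, HasValue (tiltSeries f n) a p v) ∧
    -- v), vi) the group `G^*` and the subgroups of pure shifts and of pure tilts
    (∃ G Gbar Gtilde : Subgroup (Tstar ≃ₗ[ℝ] Tstar),
      (G : Set (Tstar ≃ₗ[ℝ] Tstar)) = {E | ∃ f : Character α len, IsGammaStar f E} ∧
      (Gbar : Set (Tstar ≃ₗ[ℝ] Tstar)) =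
        {E | ∃ f : Character α len, tilt f = 0 ∧ IsGammaStar f E} ∧
      (Gtilde : Set (Tstar ≃ₗ[ℝ] Tstar)) =
        {E | ∃ f : Character α len, shift f = 0 ∧ IsGammaStar f E} ∧
      Gbar ≤ G ∧ Gtilde ≤ G ∧
      ∃ e : Multiplicative (Fin 2 → ℝ) ≃* Gbar, ∀ f : Character α len, tilt f = 0 →
        IsGammaStar f (e (Multiplicative.ofAdd (shift f)) : Tstar ≃ₗ[ℝ] Tstar)) ∧
    (∀ f : Character α len, tilt f = 0 →
      ∀ P : MvPolynomial Idx ℝ, (P : PS) ∈ Tstar →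
      ∀ (a : Polynomial ℝ) (p : MvPolynomial (Fin 2) ℝ), MvPolynomial.constantCoeff p = 0 →
        HasValue (gammaStar f (P : PS)) a p
          (polyValue P
            (a.comp (Polynomial.X + Polynomial.C (MvPolynomial.eval (shift f) p)))
            ((MvPolynomial.aeval (fun i => MvPolynomial.X i + MvPolynomial.C (shift f i)) p -
              MvPolynomial.C (MvPolynomial.eval (shift f) p) : MvPolynomial (Fin 2) ℝ) :
                MvPowerSeries (Fin 2) ℝ))) := by
  refine ⟨⟨bijective_shift_tilt, character_apply_Z⟩, tiltSeries_mem_tstar, fun β => ?_,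
    exists_isGammaStar hα hlen, fun f β => ⟨?_, fun φ hφ => ?_⟩, fun f k β => ?_,
    gammaStar_zn hlen, fun f k φ hφ _ => ?_, fun f f' => ?_, fun f f' g h => ⟨?_, fun φ hφ => ?_⟩,
    fun f P _ => gammaStar_coe hlen f P, fun f P _ a p c hc => hasValue_gammaStar hlen f P hc,
    exists_hasValue_tiltSeries, exists_structureGroup hα hlen,
    fun f hf P _ a p hp => hasValue_gammaStar_pureShift hlen hf P a p hp⟩
  -- The bound `-1` is the one valid for the bracket on all of `Tstar`.
  · exact (finite_dBasis hlen (-1) β).subset fun x ⟨φ, hφ, h⟩ => ⟨φ, tstar_le_level hφ, h⟩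
  · exact (finite_expTerm hlen f (-1) β).subset fun x ⟨φ, hφ, h⟩ => ⟨φ, tstar_le_level hφ, h⟩
  · rw [gammaStar_eq_expSum hlen f (mem_bddSeries_of_tstar hφ), coeff_famSum]
    simp only [expEnd_apply]
  · have h := hasSum_translate k (tiltSeries f 0)
    exact ⟨h.finite_coeff β, by rw [gammaStar_zk hlen, h.finsum_coeff]⟩
  · exact (isTameHom_gammaStar hlen f).map_prod _ φ fun i _ => mem_bddSeries_of_tstar (hφ i)
  · exact ⟨charComp f f', tiltSeries_charComp hlen f f', fun g hg => eq_charComp hlen hg⟩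
  · rw [eq_charComp hlen h, shift_charComp]
  · exact gammaStar_comp hlen h (mem_bddSeries_of_tstar hφ)
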